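/- **Setting.** An *N-function* is a function $\Phi(u)=\int_0^u\varphi(t)\,dt$, $u\ge 0$, where $\varphi:[0,\infty)\to[0,\infty)$ is nondecreasing and right continuous, $\varphi(0)=0$, $\varphi(t)>0$ for $t>0$ and $\varphi(t)\to\infty$ as $t\to\infty$. Its complementary function is $\Psi(v)=\sup_{u>0}(uv-\Phi(u))$, $v\ge 0$. A function $F$ satisfies the $\Delta_2$-condition if there are $k>0$, $l\ge0$ with $F(2u)\le kF(u)$ for all $u>l$. For functions $P,Q$ write $P\prec\prec Q$ if $\lim_{t\to\infty}P(t)/Q(\delta t)=0$ for every $\delta>0$. Let $n\ge1$ and let $\Omega\subset\mathbb{R}^n$ be a bounded open set with the cone property (every $x\in\Omega$ is the vertex of a finite open cone contained in $\Omega$ and congruent to one fixed cone). Let $\Phi$ be an N-function such that $\Phi$ and its complementary function $\Psi$ satisfy the $\Delta_2$-condition and $$\int_0^1\frac{\Phi^{-1}(t)}{t^{(n+1)/n}}\,dt<\infty,\qquad \int_1^\infty\frac{\Phi^{-1}(t)}{t^{(n+1)/n}}\,dt=\infty ,$$ and let $\Phi_*$ be given by $\Phi_*^{-1}(s)=\int_0^s\Phi^{-1}(t)\,t^{-(n+1)/n}\,dt$,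 $s\ge 0$. $L_\Phi(\Omega)$ is the Orlicz space with the Luxemburg norm $\|u\|_\Phi=\inf\{\lambda>0:\int_\Omega\Phi(|u|/\lambda)\,dx\le1\}$, and $W^1_\Phi(\Omega)$ is the closure of $C^1(\overline\Omega)$ (functions that are continuously differentiable in $\Omega$ and extend, with their gradient, continuously to $\overline\Omega$) in the norm $\max\{\|u\|_\Phi,\|\partial_1u\|_\Phi,\dots,\|\partial_nu\|_\Phi\}$; $Du\in L_\Phi(\Omega)^n$ denotes the corresponding gradient of $u\in W^1_\Phi(\Omega)$. Let $f:\Omega\times\mathbb{R}^n\to\mathbb{R}$ be such that $f(\cdot,p)$ is measurable for every $p$, and such that there are constants $c_f^1,c_f^2>0$ for which, for a.e. $x\in\Omega$, the function $f(x,\cdot)$ is continuous and convex and $$c_f^1\,\Phi(|p|)\le f(x,p)\le c_f^2\,(1+\Phi(|p|))\qquad\text{for all }p\in\mathbb{R}^n .$$ Let $g:\Omega\times\mathbb{R}\to\overline{\mathbb{R}}$ be such that $x\mapsto g(x,v(x))$ is measurable on $\Omega$ for every measurable $v$, $g(x,\cdot)$ is lower semicontinuous for a.e. $x\in\Omega$,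 and, for some N-function $B\prec\prec\Phi_*$, some constant $c_g>0$ and some $b_g\in L^1(\Omega)$, $$g(x,s)\ge c_g\,B(|s|)-b_g(x)\qquad\text{for a.e. }x\in\Omega\text{ and all }s\in\mathbb{R}.$$ **Theorem 3 (existence of minimizers).** The functional $$G(u)=F(u,\Omega)+\int_\Omega g(x,u(x))\,dx,\qquad F(u,\Omega)=\int_\Omega f(x,Du(x))\,dx,$$ takes values in $(-\infty,+\infty]$ on $W^1_\Phi(\Omega)$, and for every nonempty weakly closed set $X\subseteq W^1_\Phi(\Omega)$ it attains its minimum on $X$: there is $u\in X$ with $G(u)\le G(v)$ for all $v\in X$. -/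

import Mathlib

open MeasureTheory Set Filter Topology
open scoped ENNReal

noncomputable section

/-- An `N`-function `Φ(u) = ∫₀ᵘ φ(t) dt` on `[0, ∞)`, given by its density `φ`. -/
structure NFunction where
  density : ℝ → ℝ
  density_zero : density 0 = 0
  density_pos : ∀ t, 0 < t → 0 < density t
  density_mono : MonotoneOn density (Ici 0)
  density_rightCont : ∀ t, 0 ≤ t → ContinuousWithinAt density (Ici t) t
  density_atTop : Tendsto density atTop atTop

namespace NFunction

/-- The value `Φ(u)`; only used for `u ≥ 0`. -/
def eval (Φ : NFunction) (u : ℝ) : ℝ := ∫ t in (0 : ℝ)..u, Φ.density t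

instance : CoeFun NFunction (fun _ => ℝ → ℝ) := ⟨eval⟩

variable (Φ : NFunction)

theorem eval_zero : Φ 0 = 0 := by simp [eval]

theorem intervalIntegrable {a b : ℝ} (ha : 0 ≤ a) (hb : 0 ≤ b) :
    IntervalIntegrable Φ.density volume a b := by
  apply MonotoneOn.intervalIntegrable
  apply Φ.density_mono.mono
  intro x hx
  exact le_trans (le_min ha hb) hx.1

theorem sub_eq {a b : ℝ} (ha : 0 ≤ a) (hb : 0 ≤ b) :
    Φ b - Φ a = ∫ t in a..b, Φ.density t :=
  intervalIntegral.integral_interval_sub_left (Φ.intervalIntegrable le_rfl hb)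
    (Φ.intervalIntegrable le_rfl ha)

theorem sub_le {a b : ℝ} (ha : 0 ≤ a) (hab : a ≤ b) :
    Φ b - Φ a ≤ (b - a) * Φ.density b := by
  rw [Φ.sub_eq ha (ha.trans hab)]
  have h := intervalIntegral.integral_mono_on hab (Φ.intervalIntegrable ha (ha.trans hab))
    (intervalIntegrable_const (c := Φ.density b))
    (fun x hx => Φ.density_mono (ha.trans hx.1) (ha.trans hab) hx.2)
  simpa using h

theorem le_sub {a b : ℝ} (ha : 0 ≤ a) (hab : a ≤ b) :
    (b - a) * Φ.density a ≤ Φ b - Φ a := by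
  rw [Φ.sub_eq ha (ha.trans hab)]
  have h := intervalIntegral.integral_mono_on hab
    (intervalIntegrable_const (c := Φ.density a)) (Φ.intervalIntegrable ha (ha.trans hab))
    (fun x hx => Φ.density_mono ha (ha.trans hx.1) hx.1)
  simpa using h

theorem density_nonneg {t : ℝ} (ht : 0 ≤ t) : 0 ≤ Φ.density t := by
  rcases ht.eq_or_lt with h | h
  · rw [← h, Φ.density_zero]
  · exact (Φ.density_pos t h).le

theorem eval_mono {a b : ℝ} (ha : 0 ≤ a) (hab : a ≤ b) : Φ a ≤ Φ b := by
  have h := Φ.le_sub ha hab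
  have h2 := mul_nonneg (sub_nonneg.2 hab) (Φ.density_nonneg ha)
  linarith

theorem eval_nonneg {a : ℝ} (ha : 0 ≤ a) : 0 ≤ Φ a := by
  have h := Φ.eval_mono le_rfl ha
  rwa [Φ.eval_zero] at h

theorem eval_pos {a : ℝ} (ha : 0 < a) : 0 < Φ a := by
  have h := Φ.le_sub (a := a / 2) (b := a) (by positivity) (by linarith)
  have h1 := Φ.density_pos (a / 2) (by positivity)
  have h2 := Φ.eval_nonneg (a := a / 2) (by positivity)
  have h3 : 0 < (a - a / 2) * Φ.density (a / 2) := mul_pos (by linarith) h1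
  linarith

theorem convexOn : ConvexOn ℝ (Ici 0) Φ.eval := by
  apply convexOn_of_slope_mono_adjacent (convex_Ici 0)
  intro x y z hx hz hxy hyz
  have hx : (0 : ℝ) ≤ x := hx
  have h1 : (Φ y - Φ x) / (y - x) ≤ Φ.density y := by
    rw [div_le_iff₀ (by linarith)]
    have := Φ.sub_le hx hxy.le
    linarith
  have h2 : Φ.density y ≤ (Φ z - Φ y) / (z - y) := by
    rw [le_div_iff₀ (by linarith)]
    have := Φ.le_sub (hx.trans hxy.le) hyz.le
    linarith
  exact h1.trans h2

theorem eval_mul_le {c a : ℝ} (hc : 0 ≤ c) (hc1 : c ≤ 1) (ha : 0 ≤ a) :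
    Φ (c * a) ≤ c * Φ a := by
  have h := Φ.convexOn.2 (x := 0) (y := a) (by simp) ha (sub_nonneg.2 hc1) hc (by ring)
  simpa [Φ.eval_zero] using h

theorem measurable_abs : Measurable fun t : ℝ => Φ |t| := by
  have h : Monotone fun t : ℝ => Φ (max t 0) := fun a b hab =>
    Φ.eval_mono (le_max_right _ _) (max_le_max hab le_rfl)
  have h2 := h.measurable.comp (measurable_norm (α := ℝ))
  have h3 : (fun t : ℝ => Φ (max t 0)) ∘ norm = fun t : ℝ => Φ |t| := by
    funext t
    simp [Real.norm_eq_abs]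
  rwa [h3] at h2

/-- The complementary function `Ψ(v) = sup_{u > 0} (u v - Φ(u))`, for `v ≥ 0`. -/
def compl (v : ℝ) : ℝ := sSup ((fun u => u * v - Φ u) '' Ioi 0)

end NFunction

/-- The `Δ₂`-condition (near infinity). -/
def DeltaTwo (F : ℝ → ℝ) : Prop :=
  ∃ k > 0, ∃ l ≥ 0, ∀ u > l, F (2 * u) ≤ k * F u

/-- The inverse on `[0, ∞)` of a continuous, strictly increasing, unbounded function `F`
on `[0, ∞)` with `F 0 = 0`. -/
def halfLineInv (F : ℝ → ℝ) (t : ℝ) : ℝ := sInf {s | 0 ≤ s ∧ t ≤ F s}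

/-- `Φ⁻¹(t) / t ^ ((n + 1) / n)`. -/
def sobolevDensity (Φ : NFunction) (n : ℕ) (t : ℝ) : ℝ :=
  halfLineInv Φ t / t ^ (((n : ℝ) + 1) / n)

/-- `∫₀¹ Φ⁻¹(t) / t ^ ((n + 1) / n) dt < ∞` and `∫₁^∞ Φ⁻¹(t) / t ^ ((n + 1) / n) dt = ∞`. -/
def HasSobolevConjugate (Φ : NFunction) (n : ℕ) : Prop :=
  ∫⁻ t in Ioc (0 : ℝ) 1, ENNReal.ofReal (sobolevDensity Φ n t) < ⊤ ∧
    ∫⁻ t in Ioi (1 : ℝ), ENNReal.ofReal (sobolevDensity Φ n t) = ⊤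

/-- The Sobolev conjugate `Φ_*` on `[0, ∞)`: the function with
`Φ_*⁻¹(s) = ∫₀ˢ Φ⁻¹(t) / t ^ ((n + 1) / n) dt`. -/
def sobolevConjugate (Φ : NFunction) (n : ℕ) : ℝ → ℝ :=
  halfLineInv fun s => ∫ t in (0 : ℝ)..s, sobolevDensity Φ n t

/-- `P ≺≺ Q`: `Q` grows essentially more rapidly than `P` near infinity. -/
def EssentiallySlower (P Q : ℝ → ℝ) : Prop :=
  ∀ δ > 0, Tendsto (fun t => P t / Q (δ * t)) atTop (𝓝 0)

section Orlicz

variable {α : Type*} [MeasurableSpace α]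

/-- The modular `ρ(u) = ∫ Φ(|u|) dμ`. -/
def orliczModular (Φ : NFunction) (μ : Measure α) (u : α → ℝ) : ℝ≥0∞ :=
  ∫⁻ x, ENNReal.ofReal (Φ |u x|) ∂μ

theorem orliczModular_congr (Φ : NFunction) {μ : Measure α} {u v : α → ℝ} (h : u =ᵐ[μ] v) :
    orliczModular Φ μ u = orliczModular Φ μ v := by
  apply lintegral_congr_ae
  filter_upwards [h] with x hx
  rw [hx]

theorem orliczModular_mono (Φ : NFunction) {μ : Measure α} {u v : α → ℝ}
    (h : ∀ x, |u x| ≤ |v x|) : orliczModular Φ μ u ≤ orliczModular Φ μ v :=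
  lintegral_mono fun x => ENNReal.ofReal_le_ofReal (Φ.eval_mono (abs_nonneg _) (h x))

theorem orliczModular_smul_le (Φ : NFunction) {μ : Measure α} (u : α → ℝ) {c : ℝ}
    (hc : 0 ≤ c) (hc1 : c ≤ 1) :
    orliczModular Φ μ (c • u) ≤ ENNReal.ofReal c * orliczModular Φ μ u := by
  unfold orliczModular
  rw [← lintegral_const_mul' _ _ ENNReal.ofReal_ne_top]
  apply lintegral_mono
  intro x
  dsimp only
  rw [← ENNReal.ofReal_mul hc]
  apply ENNReal.ofReal_le_ofReal
  have := Φ.eval_mul_le hc hc1 (abs_nonneg (u x))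
  simpa [abs_mul, abs_of_nonneg hc] using this

theorem orliczModular_convex (Φ : NFunction) {μ : Measure α} {u v : α → ℝ}
    (hu : AEMeasurable u μ) {a b : ℝ} (ha : 0 ≤ a) (hb : 0 ≤ b) (hab : a + b = 1) :
    orliczModular Φ μ (a • u + b • v) ≤
      ENNReal.ofReal a * orliczModular Φ μ u + ENNReal.ofReal b * orliczModular Φ μ v := by
  unfold orliczModular
  rw [← lintegral_const_mul' _ _ ENNReal.ofReal_ne_top,
    ← lintegral_const_mul' _ _ ENNReal.ofReal_ne_top, ← lintegral_add_left']
  · apply lintegral_mono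
    intro x
    dsimp only
    rw [← ENNReal.ofReal_mul ha, ← ENNReal.ofReal_mul hb, ← ENNReal.ofReal_add
      (mul_nonneg ha (Φ.eval_nonneg (abs_nonneg _))) (mul_nonneg hb (Φ.eval_nonneg (abs_nonneg _)))]
    apply ENNReal.ofReal_le_ofReal
    have h1 : |(a • u + b • v) x| ≤ a * |u x| + b * |v x| := by
      have := abs_add_le (a * u x) (b * v x)
      simpa [abs_mul, abs_of_nonneg ha, abs_of_nonneg hb] using this
    have h2 := Φ.convexOn.2 (x := |u x|) (y := |v x|) (mem_Ici.2 (abs_nonneg _))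
      (mem_Ici.2 (abs_nonneg _)) ha hb hab
    exact (Φ.eval_mono (abs_nonneg _) h1).trans (by simpa using h2)
  · exact ((Φ.measurable_abs.comp_aemeasurable hu).ennreal_ofReal).const_mul _

/-- The admissible `λ > 0` in the Luxemburg norm. -/
def luxemburgSet (Φ : NFunction) (μ : Measure α) (u : α → ℝ) : Set ℝ :=
  {r | 0 < r ∧ orliczModular Φ μ (r⁻¹ • u) ≤ 1}

theorem luxemburgSet_congr (Φ : NFunction) {μ : Measure α} {u v : α → ℝ} (h : u =ᵐ[μ] v) :
    luxemburgSet Φ μ u = luxemburgSet Φ μ v := by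
  ext r
  have : orliczModular Φ μ (r⁻¹ • u) = orliczModular Φ μ (r⁻¹ • v) := by
    apply orliczModular_congr
    filter_upwards [h] with x hx
    simp [hx]
  simp [luxemburgSet, this]

theorem luxemburgSet_add (Φ : NFunction) {μ : Measure α} {u v : α → ℝ} (hu : AEMeasurable u μ)
    {r s : ℝ} (hr : r ∈ luxemburgSet Φ μ u) (hs : s ∈ luxemburgSet Φ μ v) :
    r + s ∈ luxemburgSet Φ μ (u + v) := by
  obtain ⟨hr0, hr⟩ := hr
  obtain ⟨hs0, hs⟩ := hs
  refine ⟨add_pos hr0 hs0, ?_⟩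
  have hrs : 0 < r + s := add_pos hr0 hs0
  have key : (r + s)⁻¹ • (u + v) =
      (r / (r + s)) • (r⁻¹ • u) + (s / (r + s)) • (s⁻¹ • v) := by
    funext x
    simp
    field_simp
  rw [key]
  refine (orliczModular_convex Φ (hu.const_smul _) (by positivity) (by positivity)
    (by field_simp)).trans ?_
  calc _ ≤ ENNReal.ofReal (r / (r + s)) * 1 + ENNReal.ofReal (s / (r + s)) * 1 := by gcongr
    _ = 1 := by
      rw [mul_one, mul_one, ← ENNReal.ofReal_add (by positivity) (by positivity)]
      rw [show r / (r + s) + s / (r + s) = 1 by field_simp]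
      simp

theorem luxemburgSet_smul (Φ : NFunction) {μ : Measure α} {u : α → ℝ} {c r : ℝ} (hc : c ≠ 0)
    (hr : r ∈ luxemburgSet Φ μ u) : |c| * r ∈ luxemburgSet Φ μ (c • u) := by
  obtain ⟨hr0, hr⟩ := hr
  have hc' : 0 < |c| := abs_pos.2 hc
  refine ⟨by positivity, le_trans (orliczModular_mono Φ fun x => ?_) hr⟩
  simp only [Pi.smul_apply, smul_eq_mul, abs_mul, abs_inv, abs_abs, abs_of_pos hr0]
  apply le_of_eq
  field_simp

theorem luxemburgSet_zero (Φ : NFunction) (μ : Measure α) :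
    luxemburgSet Φ μ (0 : α → ℝ) = Ioi 0 := by
  ext r
  simp [luxemburgSet, orliczModular, Φ.eval_zero]

theorem luxemburgSet_nonneg_bdd (Φ : NFunction) (μ : Measure α) (u : α → ℝ) :
    BddBelow (luxemburgSet Φ μ u) := ⟨0, fun _ h => h.1.le⟩

/-- The Orlicz space `L_Φ(μ)`, as a space of classes of almost everywhere equal functions. -/
def orliczSubmodule (Φ : NFunction) (μ : Measure α) : Submodule ℝ (α →ₘ[μ] ℝ) where
  carrier := {u | (luxemburgSet Φ μ u).Nonempty}
  zero_mem' := by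
    rw [mem_ofPred_eq, luxemburgSet_congr Φ (AEEqFun.coeFn_zero (β := ℝ)), luxemburgSet_zero]
    exact ⟨1, mem_Ioi.2 one_pos⟩
  add_mem' := by
    rintro u v ⟨r, hr⟩ ⟨s, hs⟩
    rw [mem_ofPred_eq, luxemburgSet_congr Φ (AEEqFun.coeFn_add u v)]
    exact ⟨_, luxemburgSet_add Φ u.aemeasurable hr hs⟩
  smul_mem' := by
    rintro c u ⟨r, hr⟩
    rw [mem_ofPred_eq, luxemburgSet_congr Φ (AEEqFun.coeFn_smul c u)]
    by_cases hc : c = 0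
    · subst hc
      rw [zero_smul, luxemburgSet_zero]
      exact ⟨1, mem_Ioi.2 one_pos⟩
    · exact ⟨_, luxemburgSet_smul Φ hc hr⟩

/-- The Orlicz space `L_Φ(μ)` as a type, with the Luxemburg norm below. Its elements are the
classes of those measurable `u` for which `∫ Φ(|u| / r) dμ ≤ 1` for some `r > 0`. -/
def OrliczSpace (Φ : NFunction) (μ : Measure α) : Type _ := orliczSubmodule Φ μ

namespace OrliczSpace

variable {Φ : NFunction} {μ : Measure α}

instance : AddCommGroup (OrliczSpace Φ μ) :=
  inferInstanceAs (AddCommGroup (orliczSubmodule Φ μ))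

instance : Module ℝ (OrliczSpace Φ μ) :=
  inferInstanceAs (Module ℝ (orliczSubmodule Φ μ))

/-- The underlying function of an element of `L_Φ(μ)`. -/
def toFun (u : OrliczSpace Φ μ) : α → ℝ := (u.1 : α →ₘ[μ] ℝ)

instance : CoeFun (OrliczSpace Φ μ) (fun _ => α → ℝ) := ⟨toFun⟩

theorem aemeasurable (u : OrliczSpace Φ μ) : AEMeasurable u μ := AEEqFun.aemeasurable u.1

theorem coeFn_add (u v : OrliczSpace Φ μ) : ⇑(u + v) =ᵐ[μ] ⇑u + ⇑v :=
  AEEqFun.coeFn_add u.1 v.1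

theorem coeFn_smul (c : ℝ) (u : OrliczSpace Φ μ) : ⇑(c • u) =ᵐ[μ] c • ⇑u :=
  AEEqFun.coeFn_smul c u.1

theorem coeFn_zero : ⇑(0 : OrliczSpace Φ μ) =ᵐ[μ] 0 := AEEqFun.coeFn_zero

theorem ext_ae {u v : OrliczSpace Φ μ} (h : ⇑u =ᵐ[μ] ⇑v) : u = v :=
  Subtype.ext (AEEqFun.ext h)

/-- The Luxemburg norm `‖u‖ = inf {r > 0 : ∫ Φ(|u| / r) dμ ≤ 1}`. -/
instance : Norm (OrliczSpace Φ μ) := ⟨fun u => sInf (luxemburgSet Φ μ u)⟩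

theorem norm_def (u : OrliczSpace Φ μ) : ‖u‖ = sInf (luxemburgSet Φ μ u) := rfl

theorem nonempty (u : OrliczSpace Φ μ) : (luxemburgSet Φ μ u).Nonempty := u.2

theorem norm_zero' : ‖(0 : OrliczSpace Φ μ)‖ = 0 := by
  rw [norm_def, luxemburgSet_congr Φ coeFn_zero, luxemburgSet_zero, csInf_Ioi]

theorem norm_nonneg' (u : OrliczSpace Φ μ) : 0 ≤ ‖u‖ :=
  Real.sInf_nonneg fun _ h => h.1.le

theorem norm_smul_le' (c : ℝ) (u : OrliczSpace Φ μ) : ‖c • u‖ ≤ |c| * ‖u‖ := by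
  by_cases hc : c = 0
  · subst hc
    rw [zero_smul, norm_zero']
    simp
  · have hc' : 0 < |c| := abs_pos.2 hc
    rw [← div_le_iff₀' hc']
    apply le_csInf u.nonempty
    intro r hr
    rw [div_le_iff₀' hc', norm_def, luxemburgSet_congr Φ (coeFn_smul c u)]
    exact csInf_le (luxemburgSet_nonneg_bdd _ _ _) (luxemburgSet_smul Φ hc hr)

theorem eq_zero_of_norm {u : OrliczSpace Φ μ} (h : ‖u‖ = 0) : u = 0 := by
  have hle : ∀ r : ℝ, 0 < r → r < 1 → orliczModular Φ μ u ≤ ENNReal.ofReal r := by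
    intro r hr hr1
    have hlt : sInf (luxemburgSet Φ μ u) < r := by rw [← norm_def, h]; exact hr
    obtain ⟨s, ⟨hs0, hs⟩, hsr⟩ := exists_lt_of_csInf_lt u.nonempty hlt
    have h1 := orliczModular_smul_le Φ (μ := μ) (s⁻¹ • ⇑u) hs0.le (hsr.trans hr1).le
    rw [smul_smul, mul_inv_cancel₀ hs0.ne', one_smul] at h1
    calc _ ≤ _ := h1
      _ ≤ ENNReal.ofReal s * 1 := by gcongr
      _ ≤ ENNReal.ofReal r := by
        rw [mul_one]
        exact ENNReal.ofReal_le_ofReal hsr.le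
  have h0 : orliczModular Φ μ u = 0 := by
    by_contra hne
    obtain ⟨r, hr0, hr⟩ := ENNReal.lt_iff_exists_nnreal_btwn.1 (pos_iff_ne_zero.2 hne)
    have hr0' : (0 : ℝ) < r := by exact_mod_cast hr0
    have h2 := hle (min r (1 / 2)) (lt_min hr0' (by norm_num))
      (lt_of_le_of_lt (min_le_right _ _) (by norm_num))
    have h3 : ENNReal.ofReal (min (r : ℝ) (1 / 2)) ≤ r := by
      rw [← ENNReal.ofReal_coe_nnreal]
      exact ENNReal.ofReal_le_ofReal (min_le_left _ _)
    exact absurd (h2.trans h3) (not_le.2 hr)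
  unfold orliczModular at h0
  have hm : AEMeasurable (fun x => ENNReal.ofReal (Φ |u x|)) μ :=
    (Φ.measurable_abs.comp_aemeasurable u.aemeasurable).ennreal_ofReal
  rw [lintegral_eq_zero_iff' hm] at h0
  apply ext_ae
  filter_upwards [h0, coeFn_zero (Φ := Φ) (μ := μ)] with x hx hx0
  rw [hx0]
  by_contra hne
  have hpos := Φ.eval_pos (abs_pos.2 hne)
  have : Φ |u x| ≤ 0 := by simpa using hx
  linarith

theorem core : NormedSpace.Core ℝ (OrliczSpace Φ μ) where
  norm_nonneg := norm_nonneg'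
  norm_smul c u := by
    apply le_antisymm (norm_smul_le' c u)
    by_cases hc : c = 0
    · subst hc
      simpa using norm_nonneg' _
    · have h := norm_smul_le' c⁻¹ (c • u)
      rw [smul_smul, inv_mul_cancel₀ hc, one_smul, abs_inv, inv_mul_eq_div,
        le_div_iff₀' (abs_pos.2 hc)] at h
      exact h
  norm_triangle u v := by
    rw [norm_def u, norm_def v, ← csInf_add u.nonempty (luxemburgSet_nonneg_bdd _ _ _)
      v.nonempty (luxemburgSet_nonneg_bdd _ _ _)]
    apply le_csInf (u.nonempty.add v.nonempty)
    rintro _ ⟨r, hr, s, hs, rfl⟩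
    rw [norm_def, luxemburgSet_congr Φ (coeFn_add u v)]
    exact csInf_le (luxemburgSet_nonneg_bdd _ _ _) (luxemburgSet_add Φ u.aemeasurable hr hs)
  norm_eq_zero_iff u := ⟨eq_zero_of_norm, fun h => by rw [h, norm_zero']⟩

instance : NormedAddCommGroup (OrliczSpace Φ μ) := NormedAddCommGroup.ofCore core

instance : NormedSpace ℝ (OrliczSpace Φ μ) := NormedSpace.ofCore core

end OrliczSpace

end Orlicz

section Sobolev

variable {n : ℕ}

/-- The cone property: there is one finite open cone (height `r`, cosine of the half-angle `κ`)
such that every point of `Ω` is the vertex of a congruent cone contained in `Ω`. -/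
def ConeProperty (Ω : Set (EuclideanSpace ℝ (Fin n))) : Prop :=
  ∃ r > 0, ∃ κ ∈ Ioo (0 : ℝ) 1, ∀ x ∈ Ω, ∃ e : EuclideanSpace ℝ (Fin n), ‖e‖ = 1 ∧
    ∀ y, 0 < ‖y‖ → ‖y‖ < r → κ * ‖y‖ < inner ℝ e y → x + y ∈ Ω

/-- `φ ∈ C¹(Ω̄)` with gradient `V`: the function is differentiable in `Ω` with gradient `V`, and
both `φ` and `V` are continuous up to the boundary. -/
def IsC1Closure (Ω : Set (EuclideanSpace ℝ (Fin n))) (φ : EuclideanSpace ℝ (Fin n) → ℝ)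
    (V : EuclideanSpace ℝ (Fin n) → EuclideanSpace ℝ (Fin n)) : Prop :=
  ContinuousOn φ (closure Ω) ∧ ContinuousOn V (closure Ω) ∧ ∀ x ∈ Ω, HasGradientAt φ (V x) x

/-- `L_Φ(Ω) × L_Φ(Ω)ⁿ` with the maximum norm, in which `u` is represented by `(u, Du)`. -/
abbrev OrliczJet (Φ : NFunction) (Ω : Set (EuclideanSpace ℝ (Fin n))) : Type :=
  OrliczSpace Φ (volume.restrict Ω) × (Fin n → OrliczSpace Φ (volume.restrict Ω))

/-- The pairs `(φ, Dφ)` with `φ ∈ C¹(Ω̄)`, and `φ` and its partial derivatives in `L_Φ(Ω)`. -/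
def smoothJets (Φ : NFunction) (Ω : Set (EuclideanSpace ℝ (Fin n))) :
    Submodule ℝ (OrliczJet Φ Ω) where
  carrier := {w | ∃ φ V, IsC1Closure Ω φ V ∧ w.1 =ᵐ[volume.restrict Ω] φ ∧
    ∀ i, w.2 i =ᵐ[volume.restrict Ω] fun x => V x i}
  zero_mem' := by
    refine ⟨fun _ => 0, fun _ => 0, ⟨continuousOn_const, continuousOn_const, fun x _ => ?_⟩,
      OrliczSpace.coeFn_zero, fun i => OrliczSpace.coeFn_zero⟩
    exact hasGradientAt_const x 0
  add_mem' := by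
    rintro w z ⟨φ, V, ⟨h1, h2, h3⟩, h4, h5⟩ ⟨ψ, W, ⟨k1, k2, k3⟩, k4, k5⟩
    refine ⟨φ + ψ, V + W, ⟨h1.add k1, h2.add k2, fun x hx => ?_⟩, ?_, fun i => ?_⟩
    · have := (h3 x hx).hasFDerivAt.add (k3 x hx).hasFDerivAt
      rw [hasGradientAt_iff_hasFDerivAt]
      simpa using this
    · exact (OrliczSpace.coeFn_add _ _).trans (h4.add k4)
    · exact (OrliczSpace.coeFn_add _ _).trans ((h5 i).add (k5 i))
  smul_mem' := by
    rintro c w ⟨φ, V, ⟨h1, h2, h3⟩, h4, h5⟩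
    refine ⟨c • φ, c • V, ⟨h1.const_smul c, h2.const_smul c, fun x hx => ?_⟩, ?_, fun i => ?_⟩
    · have := (h3 x hx).hasFDerivAt.const_smul c
      rw [hasGradientAt_iff_hasFDerivAt]
      simpa using this
    · exact (OrliczSpace.coeFn_smul _ _).trans (h4.const_smul c)
    · exact (OrliczSpace.coeFn_smul _ _).trans ((h5 i).const_smul c)

/-- The Orlicz–Sobolev space `W¹_Φ(Ω)`: the closure of `C¹(Ω̄)` in the norm
`max (‖u‖_Φ, ‖∂₁u‖_Φ, …, ‖∂ₙu‖_Φ)`. -/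
abbrev OrliczSobolev (Φ : NFunction) (Ω : Set (EuclideanSpace ℝ (Fin n))) : Type :=
  (smoothJets Φ Ω).topologicalClosure

namespace OrliczSobolev

variable {Φ : NFunction} {Ω : Set (EuclideanSpace ℝ (Fin n))}

/-- The function `u` itself. -/
def fn (u : OrliczSobolev Φ Ω) : EuclideanSpace ℝ (Fin n) → ℝ := u.1.1

/-- The gradient `Du`. -/
def grad (u : OrliczSobolev Φ Ω) (x : EuclideanSpace ℝ (Fin n)) : EuclideanSpace ℝ (Fin n) :=
  WithLp.toLp 2 fun i => u.1.2 i x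

end OrliczSobolev

/-- The integral `∫ h⁺ - ∫ h⁻` of an extended real function whose negative part is integrable. -/
def extIntegral {α : Type*} [MeasurableSpace α] (μ : Measure α) (h : α → EReal) : EReal :=
  ((∫⁻ x, (h x).toENNReal ∂μ : ℝ≥0∞) : EReal) - ((∫⁻ x, (-h x).toENNReal ∂μ : ℝ≥0∞) : EReal)

/-- `F(u, Ω) = ∫_Ω f(x, Du(x)) dx`. -/
def energyF {Φ : NFunction} {Ω : Set (EuclideanSpace ℝ (Fin n))}
    (f : EuclideanSpace ℝ (Fin n) → EuclideanSpace ℝ (Fin n) → ℝ) (u : OrliczSobolev Φ Ω) :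
    EReal :=
  extIntegral (volume.restrict Ω) fun x => (f x (u.grad x) : EReal)

/-- `G(u, Ω) = F(u, Ω) + ∫_Ω g(x, u(x)) dx`. -/
def energyG {Φ : NFunction} {Ω : Set (EuclideanSpace ℝ (Fin n))}
    (f : EuclideanSpace ℝ (Fin n) → EuclideanSpace ℝ (Fin n) → ℝ)
    (g : EuclideanSpace ℝ (Fin n) → ℝ → EReal) (u : OrliczSobolev Φ Ω) : EReal :=
  energyF f u + extIntegral (volume.restrict Ω) fun x => g x (u.fn x)

end Sobolev

end

/-! The proof is the direct method. Since f ≥ c₁ Φ(|p|) ≥ 0 and g ≥ -|b_g|, both terms of the energy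
are bounded below, so along a minimizing sequence of finite energy the integrals of Φ(|Du|) and of
B(|u|) stay bounded.

Coercivity (`exists_norm_le_of_modular_le`). These two bounds control ‖∂ᵢu‖_Φ and ‖u‖₁. The norm
‖u‖_Φ follows from a Poincaré type inequality, `exists_norm_fst_le`: by the cone property every
point of Ω sees a ball of fixed radius inside Ω, u(x) is compared with the values of u on that ball
by integrating Du along segments, and Jensen's inequality carries this over to Φ.

Compactness (`OrliczSobolev.exists_weakLim`). The Δ₂-conditions on Φ and Ψ make bounded families in
L_Φ weakly compact. No description of the dual space is used: truncations at height k have weak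
limits in the Hilbert space L², these limits increase with k to an element of L_Φ, and
`exists_abs_apply_le_of_measure_lt` shows that every continuous functional neglects the truncated
part uniformly on the unit ball. Limits are taken along an ultrafilter, so weak closedness of X
applies directly, with no passage to sequential compactness.

Lower semicontinuity. The gradient term has convex, norm-closed sublevel sets, which are therefore
weakly closed (`lintegral_grad_le_of_weakLim`). The term with g is not convex and needs pointwise
convergence. On compact subsets of Ω a function of W¹_Φ differs in L¹ from its averages at scale ε
by at most ε times the L¹ norm of its gradient, while the averages converge under weak convergence.
This yields almost everywhere convergence (`exists_seq_tendsto_ae_of_weakLim`), and Fatou's lemma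
with the minorant -|b_g| concludes. -/

namespace NFunction

/-! ### N-functions: continuity, Young's inequality, consequences of the Δ₂-conditions. -/

variable (Φ : NFunction)

/-- The density is uncontrolled on the negative axis; its even extension is locally integrable on
all of ℝ, and `Φ |t|` is the continuous primitive of that extension evaluated at |t|. -/
theorem continuous_abs : Continuous fun t : ℝ => Φ |t| := by
  have hm : ∀ a b : ℝ, IntervalIntegrable (fun t => Φ.density |t|) volume a b := by
    have key : ∀ b : ℝ, IntervalIntegrable (fun t => Φ.density |t|) volume 0 b := by
      intro b
      rcases le_total 0 b with hb | hb
      · apply (Φ.intervalIntegrable le_rfl hb).congr_uIoo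
        intro t ht
        rw [uIoo_of_le hb] at ht
        simp [abs_of_pos ht.1]
      · have h := (Φ.intervalIntegrable (a := 0) (b := -b) le_rfl (by linarith)).comp_mul_left
          (c := -1)
        have h2 : IntervalIntegrable (fun x => Φ.density (-1 * x)) volume 0 b := by
          simpa using h
        apply h2.congr_uIoo
        intro t ht
        rw [uIoo_of_ge hb] at ht
        simp [abs_of_neg ht.2]
    intro a b
    exact (key a).symm.trans (key b)
  have h := (intervalIntegral.continuous_primitive hm 0).comp (_root_.continuous_abs)
  refine h.congr fun t => ?_
  apply intervalIntegral.integral_congr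
  intro s hs
  rw [uIcc_of_le (abs_nonneg t)] at hs
  simp [abs_of_nonneg hs.1]

/-- Φ lies above its tangent at `a`, and Φ(a) ≥ 0 is dropped. This linear minorant later bounds |u|
by Φ(|u|). -/
theorem sub_mul_density_le {a s : ℝ} (ha : 0 ≤ a) (hs : 0 ≤ s) :
    (s - a) * Φ.density a ≤ Φ s := by
  rcases le_total a s with h | h
  · have := Φ.le_sub ha h
    have := Φ.eval_nonneg ha
    linarith
  · have := mul_nonneg (sub_nonneg.2 h) (Φ.density_nonneg ha)
    have := Φ.eval_nonneg hs
    linarith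

/-- Once φ(a) ≥ v, the tangent at `a` cancels the growth of u v beyond `a`. Boundedness is what
makes the `sSup` in `compl` a genuine supremum. -/
theorem bddAbove_compl {v : ℝ} (hv : 0 ≤ v) :
    BddAbove ((fun u => u * v - Φ u) '' Ioi 0) := by
  obtain ⟨a, hav, ha⟩ := ((Φ.density_atTop.eventually_ge_atTop v).and
    (eventually_ge_atTop 0)).exists
  refine ⟨a * v, ?_⟩
  rintro _ ⟨u, hu, rfl⟩
  have hu : 0 < u := hu
  have h1 := Φ.sub_mul_density_le ha hu.le
  have h2 := Φ.eval_nonneg hu.le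
  rcases le_total a u with h | h
  · have := mul_le_mul_of_nonneg_left hav (sub_nonneg.2 h)
    simp only
    nlinarith
  · simp only
    nlinarith

theorem mul_sub_le_compl {u v : ℝ} (hu : 0 < u) (hv : 0 ≤ v) : u * v - Φ u ≤ Φ.compl v :=
  le_csSup (Φ.bddAbove_compl hv) ⟨u, hu, rfl⟩

/-- Equality case of Young's inequality: the concave function u ↦ u φ(t) - Φ(u) is maximal at u = t.
-/
theorem compl_density_le {t : ℝ} (ht : 0 ≤ t) :
    Φ.compl (Φ.density t) ≤ t * Φ.density t - Φ t := by
  apply csSup_le (nonempty_Ioi.image _)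
  rintro _ ⟨u, hu, rfl⟩
  have hu : 0 < u := hu
  rcases le_total u t with h | h
  · have := Φ.sub_le hu.le h
    simp only
    linarith
  · have := Φ.le_sub ht h
    simp only
    linarith

end NFunction

theorem DeltaTwo.pow_mul_le {F : ℝ → ℝ} (hF : DeltaTwo F) :
    ∃ k > 0, ∃ l ≥ 0, ∀ (m : ℕ), ∀ u > l, F (2 ^ m * u) ≤ k ^ m * F u := by
  obtain ⟨k, hk, l, hl, h⟩ := hF
  refine ⟨k, hk, l, hl, fun m => ?_⟩
  induction m with
  | zero => intro u _; simp
  | succ m ih =>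
    intro u hu
    have h1 : l < 2 ^ m * u := by
      have : (1 : ℝ) ≤ 2 ^ m := one_le_pow₀ one_le_two
      nlinarith
    have h2 := h _ h1
    have h3 := mul_le_mul_of_nonneg_left (ih u hu) hk.le
    rw [pow_succ, pow_succ, show (2 : ℝ) ^ m * 2 * u = 2 * (2 ^ m * u) by ring]
    linarith

namespace NFunction

variable (Φ : NFunction)

/-- If the complementary function satisfies the `Δ₂`-condition, then `Φ` grows faster than linearly,
uniformly in the starting point. -/
theorem exists_mul_le_eval_mul (hΨ : DeltaTwo Φ.compl) :
    ∃ t₀ > 0, ∀ T : ℝ, ∃ R > 0, ∀ r ≥ R, ∀ t ≥ t₀, T * r * Φ t ≤ Φ (r * t) := by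
  obtain ⟨k, hk, l, hl, h⟩ := hΨ.pow_mul_le
  obtain ⟨t₀, h1, h2⟩ := ((Φ.density_atTop.eventually_gt_atTop l).and
    (eventually_gt_atTop 0)).exists
  refine ⟨t₀, h2, fun T => ?_⟩
  obtain ⟨m, hm⟩ := pow_unbounded_of_one_lt T (one_lt_two (α := ℝ))
  refine ⟨(k / 2) ^ m, by positivity, fun r hr t ht => ?_⟩
  have ht0 : 0 < t := h2.trans_le ht
  have hr0 : 0 < r := lt_of_lt_of_le (by positivity) hr
  set v := Φ.density t
  have hv : l < v := h1.trans_le (Φ.density_mono h2.le ht0.le ht)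
  have hv0 : 0 < v := hl.trans_lt hv
  -- Young's inequality at r t and 2^m v, where v = φ(t), gives Φ(r t) ≥ 2^m r t v - Ψ(2^m v). By Δ₂
  -- for Ψ and r ≥ (k/2)^m, Ψ(2^m v) ≤ k^m Ψ(v) ≤ 2^m r (t v - Φ(t)). The products t v cancel and
  -- leave 2^m r Φ(t), with 2^m > T.
  have e1 := Φ.mul_sub_le_compl (u := r * t) (v := 2 ^ m * v) (by positivity) (by positivity)
  have e2 := h m v hv
  have e3 : Φ.compl v ≤ t * v - Φ t := Φ.compl_density_le ht0.le
  have e4 : 0 ≤ t * v - Φ t := by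
    have := Φ.sub_le le_rfl ht0.le
    rw [Φ.eval_zero] at this
    linarith
  have e5 : k ^ m ≤ 2 ^ m * r := by
    rw [div_pow, ge_iff_le, div_le_iff₀ (by positivity)] at hr
    linarith
  have e6 : k ^ m * Φ.compl v ≤ 2 ^ m * r * (t * v - Φ t) :=
    (mul_le_mul_of_nonneg_left e3 (by positivity)).trans (mul_le_mul_of_nonneg_right e5 e4)
  have e7 : T * (r * Φ t) ≤ 2 ^ m * (r * Φ t) :=
    mul_le_mul_of_nonneg_right hm.le (mul_nonneg hr0.le (Φ.eval_nonneg ht0.le))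
  nlinarith

/-- Under the `Δ₂`-condition, dilations of `Φ` are controlled by `Φ`. -/
theorem exists_eval_mul_le (hΦ : DeltaTwo Φ) {c : ℝ} (hc : 0 ≤ c) :
    ∃ C ≥ 0, ∃ D ≥ 0, ∀ s ≥ 0, Φ (c * s) ≤ C * Φ s + D := by
  obtain ⟨k, hk, l, hl, h⟩ := DeltaTwo.pow_mul_le hΦ
  obtain ⟨m, hm⟩ := pow_unbounded_of_one_lt c (one_lt_two (α := ℝ))
  refine ⟨k ^ m, by positivity, Φ (2 ^ m * l), Φ.eval_nonneg (by positivity), fun s hs => ?_⟩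
  have h1 : Φ (c * s) ≤ Φ (2 ^ m * s) :=
    Φ.eval_mono (by positivity) (mul_le_mul_of_nonneg_right hm.le hs)
  rcases le_or_gt s l with hsl | hsl
  · have h2 : Φ (2 ^ m * s) ≤ Φ (2 ^ m * l) :=
      Φ.eval_mono (by positivity) (mul_le_mul_of_nonneg_left hsl (by positivity))
    have := mul_nonneg (pow_pos hk m).le (Φ.eval_nonneg hs)
    linarith
  · have := h m s hsl
    have := Φ.eval_nonneg (a := 2 ^ m * l) (by positivity)
    linarith

end NFunction

/-! ### Modular and Luxemburg norm: comparison, inclusion in L¹, dominated convergence. -/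

section OrliczBasics

variable {α : Type*} [MeasurableSpace α] {Φ : NFunction} {μ : Measure α}

theorem orliczModular_mono_ae (Φ : NFunction) {u v : α → ℝ}
    (h : ∀ᵐ x ∂μ, |u x| ≤ |v x|) : orliczModular Φ μ u ≤ orliczModular Φ μ v :=
  lintegral_mono_ae (h.mono fun _ hx => ENNReal.ofReal_le_ofReal (Φ.eval_mono (abs_nonneg _) hx))

theorem orliczModular_smul_lt_top [IsFiniteMeasure μ] (hΦ : DeltaTwo Φ) {u : α → ℝ}
    (h : orliczModular Φ μ u < ⊤) (c : ℝ) : orliczModular Φ μ (c • u) < ⊤ := by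
  obtain ⟨C, hC, D, hD, hCD⟩ := Φ.exists_eval_mul_le hΦ (abs_nonneg c)
  have : orliczModular Φ μ (c • u) ≤ ∫⁻ x, (ENNReal.ofReal C * ENNReal.ofReal (Φ |u x|)
      + ENNReal.ofReal D) ∂μ := by
    apply lintegral_mono
    intro x
    simp only [Pi.smul_apply, smul_eq_mul, abs_mul]
    rw [← ENNReal.ofReal_mul hC, ← ENNReal.ofReal_add
      (mul_nonneg hC (Φ.eval_nonneg (abs_nonneg _))) hD]
    exact ENNReal.ofReal_le_ofReal (hCD _ (abs_nonneg _))
  refine this.trans_lt ?_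
  rw [lintegral_add_right _ measurable_const, lintegral_const_mul' _ _ ENNReal.ofReal_ne_top]
  exact ENNReal.add_lt_top.2 ⟨ENNReal.mul_lt_top ENNReal.ofReal_lt_top h, by
    simpa using ENNReal.mul_lt_top ENNReal.ofReal_lt_top (measure_lt_top _ _)⟩

/-- By convexity and Φ(0) = 0, a further division by K ≥ 1 lowers the modular by a factor K. Thus a
bound K on the modular, and not only the bound 1, controls the norm. -/
theorem luxemburgSet_of_modular_le {u : α → ℝ} {r K : ℝ} (hr : 0 < r) (hK : 1 ≤ K)
    (h : orliczModular Φ μ (r⁻¹ • u) ≤ ENNReal.ofReal K) : K * r ∈ luxemburgSet Φ μ u := by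
  have hK0 : 0 < K := one_pos.trans_le hK
  refine ⟨by positivity, ?_⟩
  have h1 := orliczModular_smul_le Φ (μ := μ) (r⁻¹ • u) (inv_nonneg.2 hK0.le)
    (inv_le_one_of_one_le₀ hK)
  rw [smul_smul, ← mul_inv] at h1
  refine h1.trans ?_
  calc _ ≤ ENNReal.ofReal K⁻¹ * ENNReal.ofReal K := by gcongr
    _ = 1 := by
      rw [← ENNReal.ofReal_mul (by positivity), inv_mul_cancel₀ hK0.ne', ENNReal.ofReal_one]

theorem luxemburgSet_nonempty_of_modular_lt_top {u : α → ℝ} (h : orliczModular Φ μ u < ⊤) :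
    (luxemburgSet Φ μ u).Nonempty := by
  refine ⟨_, luxemburgSet_of_modular_le (r := 1) (K := max 1 (orliczModular Φ μ u).toReal)
    one_pos (le_max_left _ _) ?_⟩
  rw [inv_one, one_smul, ← ENNReal.ofReal_toReal h.ne]
  exact ENNReal.ofReal_le_ofReal (by simp)

namespace OrliczSpace

theorem modular_lt_top [IsFiniteMeasure μ] (hΦ : DeltaTwo Φ) (u : OrliczSpace Φ μ) (c : ℝ) :
    orliczModular Φ μ (c • ⇑u) < ⊤ := by
  obtain ⟨r, hr0, hr⟩ := u.nonempty
  have h := orliczModular_smul_lt_top hΦ (hr.trans_lt ENNReal.one_lt_top) (c * r)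
  rwa [smul_smul, mul_assoc, mul_inv_cancel₀ hr0.ne', mul_one] at h

theorem modular_lt_top' [IsFiniteMeasure μ] (hΦ : DeltaTwo Φ) (u : OrliczSpace Φ μ) :
    orliczModular Φ μ u < ⊤ := by simpa using modular_lt_top hΦ u 1

theorem norm_le_of_modular_le {u : OrliczSpace Φ μ} {r K : ℝ} (hr : 0 < r) (hK : 1 ≤ K)
    (h : orliczModular Φ μ (r⁻¹ • ⇑u) ≤ ENNReal.ofReal K) : ‖u‖ ≤ K * r :=
  csInf_le (luxemburgSet_nonneg_bdd _ _ _) (luxemburgSet_of_modular_le hr hK h)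

/-- The strict inequality supplies an admissible s < r, so the infimum need not be attained. Sharp
estimates are obtained later by letting r decrease to the norm. -/
theorem modular_le_one {u : OrliczSpace Φ μ} {r : ℝ} (h : ‖u‖ < r) :
    orliczModular Φ μ (r⁻¹ • ⇑u) ≤ 1 := by
  obtain ⟨s, ⟨hs0, hs⟩, hsr⟩ := exists_lt_of_csInf_lt u.nonempty h
  refine le_trans (orliczModular_mono Φ fun x => ?_) hs
  simp only [Pi.smul_apply, smul_eq_mul, abs_mul]
  rw [abs_of_pos (inv_pos.2 hs0), abs_of_pos (inv_pos.2 (hs0.trans hsr))]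
  gcongr

theorem norm_le_norm_of_abs_le {u v : OrliczSpace Φ μ} (h : ∀ᵐ x ∂μ, |u x| ≤ |v x|) :
    ‖u‖ ≤ ‖v‖ := by
  apply le_of_forall_gt
  intro r hr
  obtain ⟨s, hs, hsr⟩ := exists_between hr
  refine lt_of_le_of_lt ?_ hsr
  have hs0 : 0 < s := (norm_nonneg v).trans_lt hs
  have := norm_le_of_modular_le (u := u) hs0 le_rfl (K := 1) ?_
  · simpa using this
  · simp only [ENNReal.ofReal_one]
    refine le_trans (orliczModular_mono_ae Φ ?_) (modular_le_one hs)
    filter_upwards [h] with x hx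
    simp only [Pi.smul_apply, smul_eq_mul, abs_mul]
    gcongr

/-- The element of `L_Φ(μ)` given by a function. -/
noncomputable def mk (u : α → ℝ) (hu : AEStronglyMeasurable u μ) (h : (luxemburgSet Φ μ u).Nonempty) :
    OrliczSpace Φ μ :=
  ⟨AEEqFun.mk u hu, by
    change (luxemburgSet Φ μ _).Nonempty
    rwa [luxemburgSet_congr Φ (AEEqFun.coeFn_mk u hu)]⟩

theorem coeFn_mk (u : α → ℝ) (hu : AEStronglyMeasurable u μ)
    (h : (luxemburgSet Φ μ u).Nonempty) : ⇑(mk u hu h) =ᵐ[μ] u :=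
  AEEqFun.coeFn_mk u hu

theorem measurable (u : OrliczSpace Φ μ) : Measurable u :=
  (AEEqFun.stronglyMeasurable u.1).measurable

theorem aestronglyMeasurable (u : OrliczSpace Φ μ) : AEStronglyMeasurable u μ :=
  u.measurable.aestronglyMeasurable

theorem coeFn_sub (u v : OrliczSpace Φ μ) : ⇑(u - v) =ᵐ[μ] ⇑u - ⇑v := AEEqFun.coeFn_sub u.1 v.1

theorem nonempty_of_abs_le (v : OrliczSpace Φ μ) {u : α → ℝ} (h : ∀ᵐ x ∂μ, |u x| ≤ |v x|) :
    (luxemburgSet Φ μ u).Nonempty := by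
  obtain ⟨r, hr0, hr⟩ := v.nonempty
  refine ⟨r, hr0, le_trans (orliczModular_mono_ae Φ ?_) hr⟩
  filter_upwards [h] with x hx
  simp only [Pi.smul_apply, smul_eq_mul, abs_mul]
  gcongr

theorem nonempty_of_bounded [IsFiniteMeasure μ] {u : α → ℝ} {k : ℝ} (h : ∀ᵐ x ∂μ, |u x| ≤ k) :
    (luxemburgSet Φ μ u).Nonempty := by
  apply luxemburgSet_nonempty_of_modular_lt_top
  calc _ ≤ ∫⁻ _, ENNReal.ofReal (Φ k) ∂μ := by
        apply lintegral_mono_ae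
        filter_upwards [h] with x hx
        exact ENNReal.ofReal_le_ofReal (Φ.eval_mono (abs_nonneg _) hx)
    _ < ⊤ := by simpa using ENNReal.mul_lt_top ENNReal.ofReal_lt_top (measure_lt_top _ _)

theorem norm_const_mul_le (Φ : NFunction) (μ : Measure α) [IsFiniteMeasure μ] :
    ∃ C ≥ 0, ∀ u : OrliczSpace Φ μ, ∀ k ≥ 0, (∀ᵐ x ∂μ, |u x| ≤ k) → ‖u‖ ≤ C * k := by
  have hne : (luxemburgSet Φ μ fun _ : α => (1 : ℝ)).Nonempty :=
    nonempty_of_bounded (k := 1) (by simp)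
  let o : OrliczSpace Φ μ := mk (fun _ => 1) aestronglyMeasurable_const hne
  refine ⟨‖o‖, norm_nonneg _, fun u k hk hu => ?_⟩
  have : ‖u‖ ≤ ‖k • o‖ := by
    apply norm_le_norm_of_abs_le
    filter_upwards [hu, coeFn_smul k o, coeFn_mk _ aestronglyMeasurable_const hne] with x h1 h2 h3
    rw [h2]
    simp only [Pi.smul_apply, smul_eq_mul]
    rw [h3]
    simpa [abs_of_nonneg hk] using h1
  rwa [norm_smul, Real.norm_eq_abs, abs_of_nonneg hk, mul_comm] at this

/-- The tangent at 1 gives s ≤ Φ(s)/φ(1) + 1, which is integrated over a finite measure. The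
statement is about plain functions because it is also applied to the N-function B and a function
that comes from L_Φ. -/
theorem exists_lintegral_enorm_le_of_modular_le (Φ : NFunction) (μ : Measure α)
    [IsFiniteMeasure μ] : ∃ C ≥ 0, ∀ u : α → ℝ, ∀ K ≥ 0,
      orliczModular Φ μ u ≤ ENNReal.ofReal K →
        ∫⁻ x, ‖u x‖ₑ ∂μ ≤ ENNReal.ofReal (C * (1 + K)) := by
  set d := Φ.density 1
  have hd : 0 < d := Φ.density_pos 1 one_pos
  refine ⟨max (μ.real univ) d⁻¹, le_max_of_le_left measureReal_nonneg, fun u K hK h => ?_⟩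
  calc ∫⁻ x, ‖u x‖ₑ ∂μ ≤ ∫⁻ x, (ENNReal.ofReal d⁻¹ * ENNReal.ofReal (Φ |u x|) + 1) ∂μ := by
        apply lintegral_mono
        intro x
        simp only
        rw [Real.enorm_eq_ofReal_abs, ← ENNReal.ofReal_mul (by positivity), ← ENNReal.ofReal_one,
          ← ENNReal.ofReal_add (mul_nonneg (by positivity) (Φ.eval_nonneg (abs_nonneg _)))
          zero_le_one]
        apply ENNReal.ofReal_le_ofReal
        have := Φ.sub_mul_density_le zero_le_one (abs_nonneg (u x))
        rw [inv_mul_eq_div, ← sub_le_iff_le_add, le_div_iff₀ hd]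
        exact this
    _ = ENNReal.ofReal d⁻¹ * orliczModular Φ μ u + μ univ := by
        rw [lintegral_add_right _ measurable_const, lintegral_const_mul' _ _ ENNReal.ofReal_ne_top,
          lintegral_one]
        rfl
    _ ≤ ENNReal.ofReal d⁻¹ * ENNReal.ofReal K + ENNReal.ofReal (μ.real univ) := by
        gcongr
        rw [ofReal_measureReal]
    _ ≤ _ := by
        rw [← ENNReal.ofReal_mul (by positivity), ← ENNReal.ofReal_add (by positivity)
          measureReal_nonneg]
        apply ENNReal.ofReal_le_ofReal
        have h1 := le_max_left (μ.real univ) d⁻¹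
        have h2 := mul_le_mul_of_nonneg_right (le_max_right (μ.real univ) d⁻¹) hK
        linarith

theorem exists_lintegral_enorm_le (Φ : NFunction) (μ : Measure α) [IsFiniteMeasure μ] :
    ∃ C ≥ 0, ∀ u : OrliczSpace Φ μ, ∫⁻ x, ‖u x‖ₑ ∂μ ≤ ENNReal.ofReal (C * ‖u‖) := by
  obtain ⟨C, hC, h⟩ := exists_lintegral_enorm_le_of_modular_le Φ μ
  refine ⟨C * 2, by positivity, fun u => ?_⟩
  have key : ∀ r > ‖u‖, ∫⁻ x, ‖u x‖ₑ ∂μ ≤ ENNReal.ofReal (C * 2 * r) := by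
    intro r hr
    have hr0 : 0 < r := (norm_nonneg u).trans_lt hr
    have h1 := h (r⁻¹ • ⇑u) 1 zero_le_one (by simpa using modular_le_one hr)
    have h2 : ∫⁻ x, ‖u x‖ₑ ∂μ = ENNReal.ofReal r * ∫⁻ x, ‖(r⁻¹ • ⇑u) x‖ₑ ∂μ := by
      rw [← lintegral_const_mul' _ _ ENNReal.ofReal_ne_top]
      congr 1
      funext x
      simp only [Pi.smul_apply, smul_eq_mul, enorm_mul, ← mul_assoc]
      rw [Real.enorm_of_nonneg (by positivity : 0 ≤ r⁻¹), ← ENNReal.ofReal_mul hr0.le,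
        mul_inv_cancel₀ hr0.ne', ENNReal.ofReal_one, one_mul]
    rw [h2]
    calc _ ≤ ENNReal.ofReal r * ENNReal.ofReal (C * (1 + 1)) := by gcongr
      _ = _ := by rw [← ENNReal.ofReal_mul hr0.le]; congr 1; ring
  have hc : Continuous fun r : ℝ => ENNReal.ofReal (C * 2 * r) :=
    ENNReal.continuous_ofReal.comp (by fun_prop)
  apply ge_of_tendsto (hc.continuousWithinAt (s := Ioi ‖u‖) (x := ‖u‖))
  filter_upwards [self_mem_nhdsWithin] with r hr using key r hr

theorem integrable [IsFiniteMeasure μ] (u : OrliczSpace Φ μ) : Integrable u μ := by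
  obtain ⟨C, -, h⟩ := exists_lintegral_enorm_le Φ μ
  exact ⟨u.aestronglyMeasurable, (h u).trans_lt ENNReal.ofReal_lt_top⟩

/-- The inclusion `L_Φ(μ) ⊆ L¹(μ)` over a finite measure. -/
noncomputable def toL1 (Φ : NFunction) (μ : Measure α) [IsFiniteMeasure μ] :
    OrliczSpace Φ μ →L[ℝ] (α →₁[μ] ℝ) :=
  LinearMap.mkContinuousOfExistsBound
    { toFun := fun u => u.integrable.toL1 u
      map_add' := fun u v => by
        rw [← Integrable.toL1_add]
        exact (Integrable.toL1_eq_toL1_iff _ _ _ _).2 (coeFn_add u v)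
      map_smul' := fun c u => by
        rw [RingHom.id_apply, ← Integrable.toL1_smul]
        exact (Integrable.toL1_eq_toL1_iff _ _ _ _).2 (coeFn_smul c u) }
    (by
      obtain ⟨C, hC, h⟩ := exists_lintegral_enorm_le Φ μ
      refine ⟨C, fun u => ?_⟩
      change ‖u.integrable.toL1 u‖ ≤ _
      rw [Integrable.norm_toL1_eq_lintegral_norm]
      apply ENNReal.toReal_le_of_le_ofReal (by positivity)
      convert h u using 2
      funext x
      rw [ofReal_norm])

theorem coeFn_toL1 [IsFiniteMeasure μ] (u : OrliczSpace Φ μ) : ⇑(toL1 Φ μ u) =ᵐ[μ] u :=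
  u.integrable.coeFn_toL1

theorem norm_toL1 [IsFiniteMeasure μ] (u : OrliczSpace Φ μ) : ‖toL1 Φ μ u‖ = ∫ x, ‖u x‖ ∂μ := by
  rw [L1.norm_eq_integral_norm]
  apply integral_congr_ae
  filter_upwards [coeFn_toL1 u] with x hx
  rw [hx]

/-- Dominated convergence in the Luxemburg norm. -/
theorem tendsto_norm_zero_of_dominated [IsFiniteMeasure μ] (hΦ : DeltaTwo Φ)
    {u : ℕ → OrliczSpace Φ μ} (v : OrliczSpace Φ μ) (hle : ∀ i, ∀ᵐ x ∂μ, |u i x| ≤ |v x|)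
    (hlim : ∀ᵐ x ∂μ, Tendsto (fun i => u i x) atTop (𝓝 0)) :
    Tendsto (fun i => ‖u i‖) atTop (𝓝 0) := by
  rw [Metric.tendsto_atTop']
  intro ε hε
  have hε2 : 0 < ε / 2 := by positivity
  -- By Δ₂ the modular of v/(ε/2) is finite for every ε, so it is an integrable majorant.
  have hlim' : Tendsto (fun i => orliczModular Φ μ ((ε / 2)⁻¹ • ⇑(u i))) atTop (𝓝 0) := by
    have := tendsto_lintegral_of_dominated_convergence'
      (F := fun i x => ENNReal.ofReal (Φ |((ε / 2)⁻¹ • ⇑(u i)) x|)) (f := fun _ => 0) (μ := μ)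
      (fun x => ENNReal.ofReal (Φ |((ε / 2)⁻¹ • ⇑v) x|))
      (fun i => (Φ.measurable_abs.comp_aemeasurable
        ((u i).aemeasurable.const_smul _)).ennreal_ofReal)
      (fun i => by
        filter_upwards [hle i] with x hx
        apply ENNReal.ofReal_le_ofReal
        apply Φ.eval_mono (abs_nonneg _)
        simp only [Pi.smul_apply, smul_eq_mul, abs_mul]
        gcongr)
      (modular_lt_top hΦ v _).ne
      (by
        filter_upwards [hlim] with x hx
        have h1 : Tendsto (fun i => ENNReal.ofReal (Φ |(ε / 2)⁻¹ * u i x|)) atTop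
            (𝓝 (ENNReal.ofReal (Φ |(ε / 2)⁻¹ * 0|))) :=
          ENNReal.tendsto_ofReal ((Φ.continuous_abs.tendsto _).comp (hx.const_mul _))
        simpa [Φ.eval_zero] using h1)
    rw [lintegral_zero] at this
    exact this
  have h1 := (hlim'.eventually (gt_mem_nhds one_pos)).exists_forall_of_atTop
  obtain ⟨N, hN⟩ := h1
  refine ⟨N, fun i hi => ?_⟩
  have := norm_le_of_modular_le hε2 le_rfl (K := 1) (by simpa using (hN i hi.le).le)
  simp
  linarith

/-- Absolute continuity of the norm: by Δ₂, Φ(|v|/ε) is integrable, so its integral over A is at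
most 1 when A is small. -/
theorem exists_norm_le_of_measure_lt [IsFiniteMeasure μ] (hΦ : DeltaTwo Φ) (v : OrliczSpace Φ μ)
    {ε : ℝ} (hε : 0 < ε) : ∃ δ > 0, ∀ (u : OrliczSpace Φ μ) (A : Set α), MeasurableSet A →
      μ A < δ → (∀ᵐ x ∂μ, |u x| ≤ A.indicator (fun x => |v x|) x) → ‖u‖ ≤ ε := by
  obtain ⟨δ, hδ, h⟩ := exists_pos_setLIntegral_lt_of_measure_lt
    (modular_lt_top hΦ v ε⁻¹).ne one_ne_zero
  refine ⟨δ, hδ, fun u A hA hμ hu => ?_⟩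
  have h1 : orliczModular Φ μ (ε⁻¹ • ⇑u) ≤ 1 := by
    refine le_trans ?_ (h A hμ).le
    rw [← lintegral_indicator hA]
    apply lintegral_mono_ae
    filter_upwards [hu] with x hx
    by_cases hxA : x ∈ A
    · rw [indicator_of_mem hxA] at hx ⊢
      apply ENNReal.ofReal_le_ofReal
      apply Φ.eval_mono (abs_nonneg _)
      simp only [Pi.smul_apply, smul_eq_mul, abs_mul]
      gcongr
    · rw [indicator_of_notMem hxA] at hx
      have : u x = 0 := abs_nonpos_iff.1 hx
      simp [this, Φ.eval_zero]
  simpa using norm_le_of_modular_le hε le_rfl (K := 1) (by simpa using h1)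

end OrliczSpace

end OrliczBasics

/-! ### Weak limits along filters. -/

section WeakLimits

variable {ι E F : Type*} [NormedAddCommGroup E] [NormedSpace ℝ E] [NormedAddCommGroup F]
  [NormedSpace ℝ F]

/-- Weak convergence along a filter. -/
def WeakLim (U : Filter ι) (w : ι → E) (w₀ : E) : Prop :=
  ∀ l : E →L[ℝ] ℝ, Tendsto (fun i => l (w i)) U (𝓝 (l w₀))

namespace WeakLim

variable {U : Filter ι} {w z : ι → E} {w₀ z₀ : E}

theorem map (h : WeakLim U w w₀) (T : E →L[ℝ] F) : WeakLim U (fun i => T (w i)) (T w₀) :=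
  fun l => h (l.comp T)

theorem add (h : WeakLim U w w₀) (k : WeakLim U z z₀) :
    WeakLim U (fun i => w i + z i) (w₀ + z₀) := fun l => by
  simpa using (h l).add (k l)

theorem sub (h : WeakLim U w w₀) (k : WeakLim U z z₀) :
    WeakLim U (fun i => w i - z i) (w₀ - z₀) := fun l => by
  simpa using (h l).sub (k l)

/-- Mazur's theorem by Hahn–Banach separation. Order relations, modular bounds, membership in the
Sobolev space and the sublevel sets of the gradient energy all pass to weak limits through it. -/
theorem mem_of_convex [U.NeBot] (h : WeakLim U w w₀) {S : Set E} (hS : Convex ℝ S)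
    (hc : IsClosed S) (hw : ∀ᶠ i in U, w i ∈ S) : w₀ ∈ S := by
  by_contra hne
  obtain ⟨l, c, h1, h2⟩ := geometric_hahn_banach_closed_point hS hc hne
  exact absurd h2 (not_lt.2 (le_of_tendsto (h l) (hw.mono fun i hi => (h1 _ hi).le)))

theorem tendsto_toWeakSpace (h : WeakLim U w w₀) :
    Tendsto (fun i => toWeakSpace ℝ E (w i)) U (𝓝 (toWeakSpace ℝ E w₀)) := by
  refine (WeakBilin.tendsto_iff_forall_eval_tendsto (topDualPairing ℝ E).flip
    fun x y hxy => ?_).2 h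
  exact (SeparatingDual.eq_iff_forall_dual_eq (R := ℝ)).2 fun l => DFunLike.congr_fun hxy l

end WeakLim

/-- Riesz identifies H with its dual, where closed balls are weak-* compact by Banach–Alaoglu. -/
theorem exists_weakLim_of_inner {H : Type*} [NormedAddCommGroup H] [InnerProductSpace ℝ H]
    [CompleteSpace H] (U : Ultrafilter ι) (w : ι → H) {C : ℝ} (hw : ∀ i, ‖w i‖ ≤ C) :
    ∃ w₀, WeakLim (U : Filter ι) w w₀ := by
  let J := InnerProductSpace.toDual ℝ H
  have hK := WeakDual.isCompact_closedBall (𝕜 := ℝ) (0 : StrongDual ℝ H) C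
  obtain ⟨f, -, hf⟩ := hK.ultrafilter_le_nhds (U.map fun i => StrongDual.toWeakDual (J (w i))) (by
    rw [le_principal_iff]
    refine Ultrafilter.mem_map.2 (mem_of_superset univ_mem fun i _ => ?_)
    simpa [J] using hw i)
  refine ⟨J.symm (WeakDual.toStrongDual f), fun l => ?_⟩
  have h1 : Tendsto (fun i => (StrongDual.toWeakDual (J (w i))) (J.symm l)) U
      (𝓝 (f (J.symm l))) :=
    (WeakDual.eval_continuous (J.symm l)).tendsto f |>.comp hf
  have h2 : ∀ x, l x = J x (J.symm l) := fun x => by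
    rw [InnerProductSpace.toDual_apply_apply, real_inner_comm,
      InnerProductSpace.toDual_symm_apply]
  simp only [h2]
  convert h1 using 2
  · rfl
  · rw [LinearIsometryEquiv.apply_symm_apply]
    rfl

/-- Along an ultrafilter, the failure of f < c eventually means f ≥ c eventually. Hence one-sided
bounds, the kind that convex sets provide, suffice for convergence. -/
theorem tendsto_of_ultrafilter {U : Ultrafilter ι} {f : ι → ℝ} {a : ℝ}
    (h₁ : ∀ c, (∀ᶠ i in U, f i ≤ c) → a ≤ c) (h₂ : ∀ c, (∀ᶠ i in U, c ≤ f i) → c ≤ a) :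
    Tendsto f U (𝓝 a) := by
  refine tendsto_order.2 ⟨fun c hc => ?_, fun c hc => ?_⟩
  · by_contra hne
    rw [← Ultrafilter.eventually_not] at hne
    exact absurd (h₁ c (hne.mono fun i hi => not_lt.1 hi)) (not_le.2 hc)
  · by_contra hne
    rw [← Ultrafilter.eventually_not] at hne
    exact absurd (h₂ c (hne.mono fun i hi => not_lt.1 hi)) (not_le.2 hc)

end WeakLimits

/-! ### Continuous functionals on L_Φ are uniformly small on functions of small support. -/

section OrliczWeak

variable {α : Type*} [MeasurableSpace α] {Φ : NFunction} {μ : Measure α} [IsFiniteMeasure μ]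

namespace OrliczSpace

theorem measurable_eval {μ : Measure α} (u : OrliczSpace Φ μ) :
    Measurable fun x => ENNReal.ofReal (Φ |u x|) :=
  (Φ.measurable_abs.comp u.measurable).ennreal_ofReal

/-- If the complementary function satisfies the `Δ₂`-condition, then the modular grows faster than
the norm. -/
theorem exists_norm_le_max (μ : Measure α) [IsFiniteMeasure μ] (hΨ : DeltaTwo Φ.compl) :
    ∃ K ≥ 1, ∀ T > 0, ∃ R > 0, ∀ u : OrliczSpace Φ μ,
    ∀ ρ ≥ 0, orliczModular Φ μ u ≤ ENNReal.ofReal ρ → ‖u‖ ≤ K * max R (ρ / T) := by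
  obtain ⟨t₀, ht₀, h⟩ := Φ.exists_mul_le_eval_mul hΨ
  have hK0 : 0 ≤ Φ t₀ * μ.real univ := mul_nonneg (Φ.eval_nonneg ht₀.le) measureReal_nonneg
  refine ⟨Φ t₀ * μ.real univ + 1, by linarith, fun T hT => ?_⟩
  obtain ⟨R, hR, hRT⟩ := h T
  refine ⟨R, hR, fun u ρ hρ hu => ?_⟩
  set r := max R (ρ / T) with hr
  have hr0 : 0 < r := hR.trans_le (le_max_left _ _)
  apply norm_le_of_modular_le hr0 (by linarith)
  -- Where s/r ≤ t₀, Φ(s/r) is at most Φ(t₀); elsewhere the superlinear growth gives T r Φ(s/r) ≤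
  -- Φ(s). Integration bounds the modular of u/r by Φ(t₀) μ(univ) + ρ/(T r), and r ≥ ρ/T makes the
  -- second term at most 1. So K does not depend on T.
  have hpt : ∀ s ≥ 0, Φ (r⁻¹ * s) ≤ Φ t₀ + (T * r)⁻¹ * Φ s := by
    intro s hs
    have h1 := mul_nonneg (inv_nonneg.2 (mul_pos hT hr0).le) (Φ.eval_nonneg hs)
    have h2 := Φ.eval_nonneg ht₀.le
    rcases le_total (r⁻¹ * s) t₀ with hle | hle
    · have := Φ.eval_mono (by positivity) hle
      linarith
    · have h3 := hRT r (le_max_left _ _) _ hle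
      rw [mul_inv_cancel_left₀ hr0.ne', ← le_inv_mul_iff₀ (by positivity)] at h3
      linarith
  calc orliczModular Φ μ (r⁻¹ • ⇑u)
      ≤ ∫⁻ x, (ENNReal.ofReal (Φ t₀) + ENNReal.ofReal (T * r)⁻¹ * ENNReal.ofReal (Φ |u x|)) ∂μ := by
        apply lintegral_mono
        intro x
        simp only [Pi.smul_apply, smul_eq_mul, abs_mul, abs_of_pos (inv_pos.2 hr0)]
        rw [← ENNReal.ofReal_mul (by positivity), ← ENNReal.ofReal_add (Φ.eval_nonneg ht₀.le)
          (mul_nonneg (by positivity) (Φ.eval_nonneg (abs_nonneg _)))]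
        exact ENNReal.ofReal_le_ofReal (hpt _ (abs_nonneg _))
    _ = ENNReal.ofReal (Φ t₀ * μ.real univ) + ENNReal.ofReal (T * r)⁻¹ * orliczModular Φ μ u := by
        rw [lintegral_add_left measurable_const, lintegral_const,
          lintegral_const_mul' _ _ ENNReal.ofReal_ne_top, ENNReal.ofReal_mul (Φ.eval_nonneg ht₀.le),
          ofReal_measureReal]
        rfl
    _ ≤ ENNReal.ofReal (Φ t₀ * μ.real univ) + ENNReal.ofReal (T * r)⁻¹ * ENNReal.ofReal ρ := by
        gcongr
    _ ≤ ENNReal.ofReal (Φ t₀ * μ.real univ + 1) := by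
        rw [← ENNReal.ofReal_mul (by positivity), ← ENNReal.ofReal_add hK0 (by positivity)]
        apply ENNReal.ofReal_le_ofReal
        have : ρ ≤ T * r := by
          have := le_max_right R (ρ / T)
          rw [div_le_iff₀ hT] at this
          linarith
        gcongr
        rw [inv_mul_le_iff₀ (by positivity)]
        linarith

/-- Continuous functionals are small on functions of small support, uniformly in the unit ball. -/
theorem exists_abs_apply_le_of_measure_lt (hΦ : DeltaTwo Φ) (hΨ : DeltaTwo Φ.compl)
    (l : OrliczSpace Φ μ →L[ℝ] ℝ) {ε : ℝ} (hε : 0 < ε) : ∃ δ > 0, ∀ z : OrliczSpace Φ μ, ‖z‖ < 1 →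
      ∀ A, MeasurableSet A → μ A < δ → (∀ᵐ x ∂μ, x ∉ A → z x = 0) → |l z| ≤ ε := by
  suffices hs : ∀ l : OrliczSpace Φ μ →L[ℝ] ℝ, ∃ δ > 0, ∀ z : OrliczSpace Φ μ, ‖z‖ < 1 →
      ∀ A, MeasurableSet A → μ A < δ → (∀ᵐ x ∂μ, x ∉ A → z x = 0) → l z ≤ ε by
    obtain ⟨δ₁, h1, h1'⟩ := hs l
    obtain ⟨δ₂, h2, h2'⟩ := hs (-l)
    refine ⟨min δ₁ δ₂, lt_min h1 h2, fun z hz A hA hμ hzA => abs_le.2 ⟨?_, ?_⟩⟩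
    · have := h2' z hz A hA (hμ.trans_le (min_le_right _ _)) hzA
      simp at this
      linarith
    · exact h1' z hz A hA (hμ.trans_le (min_le_left _ _)) hzA
  clear l
  intro l
  obtain ⟨K, hK, h⟩ := exists_norm_le_max μ hΨ
  -- The final estimate is T l(z) ≤ 3: one unit for the near-maximizer, one for the modular of z,
  -- one for l on the removed part of w.
  set T := 3 / ε with hTdef
  have hT : 0 < T := by positivity
  have hT' : 0 < T * (‖l‖ + 1) * K := by positivity
  obtain ⟨R, hR, hRT⟩ := h _ hT'
  set ρ : OrliczSpace Φ μ → ℝ := fun w => (orliczModular Φ μ w).toReal with hρ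
  have hρ0 : ∀ w, 0 ≤ ρ w := fun w => ENNReal.toReal_nonneg
  -- Ψ ∈ Δ₂ makes the modular dominate any multiple of the norm up to a constant, so T l - ρ is
  -- bounded above.
  have hbdd : BddAbove (range fun w => T * l w - ρ w) := by
    refine ⟨T * (‖l‖ + 1) * K * R, ?_⟩
    rintro _ ⟨w, rfl⟩
    have h1 := hRT w (ρ w) (hρ0 w) (by
      rw [ENNReal.ofReal_toReal (modular_lt_top' hΦ w).ne])
    have h2 : l w ≤ (‖l‖ + 1) * ‖w‖ := by
      have := (le_abs_self _).trans (l.le_opNorm w)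
      nlinarith [norm_nonneg w]
    have h3 : T * l w ≤ T * ((‖l‖ + 1) * (K * max R (ρ w / (T * (‖l‖ + 1) * K)))) := by
      gcongr
      exact h2.trans (by gcongr)
    have h4 : T * ((‖l‖ + 1) * (K * max R (ρ w / (T * (‖l‖ + 1) * K)))) =
        max (T * (‖l‖ + 1) * K * R) (ρ w) := by
      rw [← mul_assoc, ← mul_assoc, mul_max_of_nonneg _ _ hT'.le, mul_div_cancel₀ _ hT'.ne']
    have h5 : max (T * (‖l‖ + 1) * K * R) (ρ w) ≤ T * (‖l‖ + 1) * K * R + ρ w :=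
      max_le (by linarith [hρ0 w]) (by linarith [mul_pos hT' hR])
    simp only
    linarith
  -- Take w within 1 of the supremum of T l - ρ, and replace w by z on the small set A. The modular
  -- grows by at most ρ(z) ≤ 1 because the supports are disjoint, and the competitor cannot exceed
  -- the supremum; this bounds T l(z). The size of A is dictated by w alone, hence is uniform in z.
  obtain ⟨_, ⟨w, rfl⟩, hw⟩ := exists_lt_of_lt_csSup (range_nonempty _)
    (sub_one_lt (sSup (range fun w => T * l w - ρ w)))
  obtain ⟨δ, hδ, hδ'⟩ := exists_norm_le_of_measure_lt hΦ w
    (ε := (T * (‖l‖ + 1))⁻¹) (by positivity)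
  refine ⟨δ, hδ, fun z hz A hA hμ hzA => ?_⟩
  have hAw : AEStronglyMeasurable (A.indicator w) μ := w.aestronglyMeasurable.indicator hA
  have hne : (luxemburgSet Φ μ (A.indicator w)).Nonempty := by
    apply nonempty_of_abs_le w (ae_of_all _ fun x => ?_)
    by_cases hx : x ∈ A <;> simp [hx]
  set wA := mk _ hAw hne
  have hwA := coeFn_mk _ hAw hne
  have hnorm : ‖wA‖ ≤ (T * (‖l‖ + 1))⁻¹ := by
    apply hδ' wA A hA hμ
    filter_upwards [hwA] with x hx
    rw [hx]
    by_cases hxA : x ∈ A <;> simp [hxA]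
  have hmod : orliczModular Φ μ ⇑(w - wA + z) ≤ orliczModular Φ μ w + orliczModular Φ μ z := by
    unfold orliczModular
    rw [← lintegral_add_left w.measurable_eval]
    apply lintegral_mono_ae
    filter_upwards [hwA, hzA, coeFn_add (w - wA) z, coeFn_sub w wA] with x h1 h2 h3 h4
    rw [h3, Pi.add_apply, h4, Pi.sub_apply, h1]
    by_cases hxA : x ∈ A
    · simp [hxA]
    · simp [hxA, h2 hxA]
  have hz1 : orliczModular Φ μ z ≤ 1 := by simpa using modular_le_one hz
  have hmod' : ρ (w - wA + z) ≤ ρ w + 1 := by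
    have := ENNReal.toReal_mono (ENNReal.add_lt_top.2
      ⟨modular_lt_top' hΦ w, modular_lt_top' hΦ z⟩).ne hmod
    rw [ENNReal.toReal_add (modular_lt_top' hΦ w).ne (modular_lt_top' hΦ z).ne] at this
    have h1 := ENNReal.toReal_mono ENNReal.one_ne_top hz1
    rw [ENNReal.toReal_one] at h1
    exact this.trans (by simp only [hρ]; linarith)
  have hle : T * l (w - wA + z) - ρ (w - wA + z) ≤ _ := le_csSup hbdd ⟨_, rfl⟩
  have hlA : T * l wA ≤ 1 := by
    have h1 := (le_abs_self _).trans (l.le_opNorm wA)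
    have h2 : ‖l‖ * ‖wA‖ ≤ (‖l‖ + 1) * (T * (‖l‖ + 1))⁻¹ := by gcongr; linarith
    have h3 : T * ((‖l‖ + 1) * (T * (‖l‖ + 1))⁻¹) = 1 := by field_simp
    rw [← h3]
    gcongr
    exact h1.trans h2
  simp only [map_add, map_sub] at hle
  have : T * l z ≤ 3 := by
    linarith
  have h4 : T * l z ≤ T * ε := by
    have : T * ε = 3 := by rw [hTdef]; field_simp
    linarith
  exact le_of_mul_le_mul_left h4 hT

end OrliczSpace

end OrliczWeak

/-! ### Properties inherited by weak limits in Lᵖ. -/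

section OrliczWeakCompact

variable {α : Type*} [MeasurableSpace α] {Φ : NFunction} {μ : Measure α}

/-- Convergence in Lᵖ yields an almost everywhere convergent subsequence, so closedness may be
tested on almost everywhere limits. -/
theorem MeasureTheory.Lp.isClosed_of_ae {p : ℝ≥0∞} [Fact (1 ≤ p)] {S : Set (Lp ℝ p μ)}
    (h : ∀ (f : ℕ → Lp ℝ p μ) (g : Lp ℝ p μ), (∀ n, f n ∈ S) →
      (∀ᵐ x ∂μ, Tendsto (fun n => f n x) atTop (𝓝 (g x))) → g ∈ S) : IsClosed S := by
  refine IsSeqClosed.isClosed fun f g hf hfg => ?_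
  obtain ⟨ns, -, hns⟩ := (tendstoInMeasure_of_tendsto_Lp hfg).exists_seq_tendsto_ae
  exact h _ g (fun n => hf (ns n)) hns

theorem ae_nonneg_of_weakLim {ι : Type*} {p : ℝ≥0∞} [Fact (1 ≤ p)] {U : Filter ι} [U.NeBot]
    {f : ι → Lp ℝ p μ} {g : Lp ℝ p μ} (h : WeakLim U f g) (hf : ∀ i, ∀ᵐ x ∂μ, 0 ≤ f i x) :
    ∀ᵐ x ∂μ, 0 ≤ g x := by
  refine h.mem_of_convex (S := {f : Lp ℝ p μ | ∀ᵐ x ∂μ, 0 ≤ f x}) ?_ ?_ (Eventually.of_forall hf)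
  · intro f hf g hg a b ha hb _
    filter_upwards [hf, hg, Lp.coeFn_add (a • f) (b • g), Lp.coeFn_smul a f, Lp.coeFn_smul b g]
      with x h1 h2 h3 h4 h5
    rw [h3, Pi.add_apply, h4, h5]
    simp only [Pi.smul_apply, smul_eq_mul]
    positivity
  · refine Lp.isClosed_of_ae fun f g hf hfg => ?_
    filter_upwards [ae_all_iff.2 hf, hfg] with x h1 h2
    exact ge_of_tendsto' h2 h1

theorem orliczModular_le_of_weakLim {ι : Type*} {p : ℝ≥0∞} [Fact (1 ≤ p)] {U : Filter ι} [U.NeBot]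
    {f : ι → Lp ℝ p μ} {g : Lp ℝ p μ} (h : WeakLim U f g)
    (hf : ∀ i, orliczModular Φ μ (f i) ≤ 1) : orliczModular Φ μ g ≤ 1 := by
  refine h.mem_of_convex (S := {f : Lp ℝ p μ | orliczModular Φ μ f ≤ 1}) ?_ ?_
    (Eventually.of_forall hf)
  · intro f hf g hg a b ha hb hab
    change orliczModular Φ μ _ ≤ 1
    have h1 : ⇑(a • f + b • g) =ᵐ[μ] a • ⇑f + b • ⇑g := by
      filter_upwards [Lp.coeFn_add (a • f) (b • g), Lp.coeFn_smul a f, Lp.coeFn_smul b g]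
        with x h3 h4 h5
      rw [h3, Pi.add_apply, h4, h5]
      rfl
    rw [orliczModular_congr Φ h1]
    refine (orliczModular_convex Φ (Lp.stronglyMeasurable f).measurable.aemeasurable
      ha hb hab).trans ?_
    calc _ ≤ ENNReal.ofReal a * 1 + ENNReal.ofReal b * 1 := by
          gcongr
          · exact hf
          · exact hg
      _ = 1 := by rw [mul_one, mul_one, ← ENNReal.ofReal_add ha hb, hab, ENNReal.ofReal_one]
  · refine Lp.isClosed_of_ae fun f g hf hfg => ?_
    change ∫⁻ x, _ ∂μ ≤ 1
    calc ∫⁻ x, ENNReal.ofReal (Φ |g x|) ∂μ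
        = ∫⁻ x, liminf (fun n => ENNReal.ofReal (Φ |f n x|)) atTop ∂μ := by
          apply lintegral_congr_ae
          filter_upwards [hfg] with x hx
          exact (ENNReal.tendsto_ofReal ((Φ.continuous_abs.tendsto _).comp hx)).liminf_eq.symm
      _ ≤ liminf (fun n => ∫⁻ x, ENNReal.ofReal (Φ |f n x|) ∂μ) atTop :=
          lintegral_liminf_le fun n =>
            (Φ.measurable_abs.comp (Lp.stronglyMeasurable (f n)).measurable).ennreal_ofReal
      _ ≤ 1 := by
          refine liminf_le_of_frequently_le' (Eventually.frequently (Eventually.of_forall hf))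

namespace OrliczSpace

variable [IsFiniteMeasure μ]

/-- L_Φ and Lᵖ need not contain one another, so `l` is no functional on Lᵖ. But among functions
bounded by k, almost everywhere convergence implies convergence in L_Φ; hence {|f| ≤ k, l f ≤ c} is
closed and convex in Lᵖ, and weak limits stay in it. -/
theorem le_of_weakLim_of_bounded (hΦ : DeltaTwo Φ) {ι : Type*} {p : ℝ≥0∞} [Fact (1 ≤ p)]
    {U : Filter ι} [U.NeBot] {f : ι → Lp ℝ p μ} {g : Lp ℝ p μ} (h : WeakLim U f g) {k : ℝ}
    (hf : ∀ i, ∀ᵐ x ∂μ, |f i x| ≤ k) (l : OrliczSpace Φ μ →L[ℝ] ℝ)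
    {z : ι → OrliczSpace Φ μ} (hz : ∀ i, z i =ᵐ[μ] f i) {z₀ : OrliczSpace Φ μ}
    (hz₀ : z₀ =ᵐ[μ] g) {c : ℝ} (hc : ∀ᶠ i in U, l (z i) ≤ c) : l z₀ ≤ c := by
  have key : ∀ f : Lp ℝ p μ, (∀ᵐ x ∂μ, |f x| ≤ k) → ∃ z : OrliczSpace Φ μ, z =ᵐ[μ] f := by
    intro f hf
    exact ⟨_, coeFn_mk (Φ := Φ) f (Lp.aestronglyMeasurable f) (nonempty_of_bounded hf)⟩
  refine (h.mem_of_convex (S := {f : Lp ℝ p μ | (∀ᵐ x ∂μ, |f x| ≤ k) ∧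
    ∀ z : OrliczSpace Φ μ, z =ᵐ[μ] f → l z ≤ c}) ?_ ?_ ?_).2 z₀ hz₀
  · rintro f ⟨hf, hfc⟩ g ⟨hg, hgc⟩ a b ha hb hab
    have h1 : ⇑(a • f + b • g) =ᵐ[μ] a • ⇑f + b • ⇑g := by
      filter_upwards [Lp.coeFn_add (a • f) (b • g), Lp.coeFn_smul a f, Lp.coeFn_smul b g]
        with x h3 h4 h5
      rw [h3, Pi.add_apply, h4, h5]
      rfl
    refine ⟨?_, fun z hz => ?_⟩
    · filter_upwards [hf, hg, h1] with x h2 h3 h4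
      rw [h4]
      simp only [Pi.add_apply, Pi.smul_apply, smul_eq_mul]
      calc |a * f x + b * g x| ≤ |a * f x| + |b * g x| := abs_add_le _ _
        _ = a * |f x| + b * |g x| := by rw [abs_mul, abs_mul, abs_of_nonneg ha, abs_of_nonneg hb]
        _ ≤ a * k + b * k := by gcongr
        _ = k := by rw [← add_mul, hab, one_mul]
    · obtain ⟨zf, hzf⟩ := key f hf
      obtain ⟨zg, hzg⟩ := key g hg
      have h2 : z = a • zf + b • zg := by
        apply ext_ae
        filter_upwards [hz, h1, hzf, hzg, coeFn_add (a • zf) (b • zg), coeFn_smul a zf,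
          coeFn_smul b zg] with x e1 e2 e3 e4 e5 e6 e7
        simp only [e1, e2, e5, Pi.add_apply, e6, e7, Pi.smul_apply, e3, e4]
      rw [h2, map_add, map_smul, map_smul, smul_eq_mul, smul_eq_mul]
      calc a * l zf + b * l zg ≤ a * c + b * c := by
            gcongr
            · exact hfc _ hzf
            · exact hgc _ hzg
        _ = c := by rw [← add_mul, hab, one_mul]
  · refine Lp.isClosed_of_ae fun f g hf hfg => ?_
    have hg : ∀ᵐ x ∂μ, |g x| ≤ k := by
      filter_upwards [ae_all_iff.2 fun n => (hf n).1, hfg] with x h1 h2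
      exact le_of_tendsto' h2.abs h1
    refine ⟨hg, fun z hz => ?_⟩
    choose y hy using fun n => key (f n) (hf n).1
    have hne : (luxemburgSet Φ μ fun _ : α => 2 * k).Nonempty :=
      nonempty_of_bounded (k := |2 * k|) (by simp)
    have hlim : Tendsto (fun n => ‖y n - z‖) atTop (𝓝 0) := by
      apply tendsto_norm_zero_of_dominated hΦ (mk (fun _ => 2 * k) aestronglyMeasurable_const hne)
      · intro n
        filter_upwards [coeFn_mk _ aestronglyMeasurable_const hne, hy n, hz, coeFn_sub (y n) z,
          (hf n).1, hg] with x e1 e2 e3 e4 e5 e6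
        rw [e1, e4, Pi.sub_apply, e2, e3]
        have := abs_sub (f n x) (g x)
        have := le_abs_self (2 * k)
        linarith
      · filter_upwards [ae_all_iff.2 hy, hz, ae_all_iff.2 fun n => coeFn_sub (y n) z, hfg]
          with x e1 e2 e3 e4
        have : (fun i => (y i - z) x) = fun i => f i x - g x := by
          funext i
          rw [e3, Pi.sub_apply, e1, e2]
        rw [this]
        simpa using e4.sub_const (g x)
    have h1 : Tendsto y atTop (𝓝 z) := tendsto_iff_norm_sub_tendsto_zero.2 hlim
    exact le_of_tendsto' ((l.continuous.tendsto z).comp h1) fun n => (hf n).2 _ (hy n)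
  · filter_upwards [hc] with i hi
    refine ⟨hf i, fun y hy => ?_⟩
    rwa [show y = z i from ext_ae (hy.trans (hz i).symm)]

end OrliczSpace

end OrliczWeakCompact

/-! ### Weak compactness of bounded families in L_Φ. -/

section OrliczReflexive

variable {α : Type*} [MeasurableSpace α] {Φ : NFunction} {μ : Measure α}

namespace OrliczSpace

/-- The truncation `min (u, k)` of a function `u ≥ 0`. -/
noncomputable def trunc (k : ℕ) (u : OrliczSpace Φ μ) : OrliczSpace Φ μ :=
  mk (fun x => min |u x| k) (by
    have := u.measurable
    exact Measurable.aestronglyMeasurable (by fun_prop))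
    (nonempty_of_abs_le u (ae_of_all _ fun x => by
      rw [abs_of_nonneg (le_min (abs_nonneg _) k.cast_nonneg)]
      exact min_le_left _ _))

theorem coeFn_trunc (k : ℕ) (u : OrliczSpace Φ μ) :
    trunc k u =ᵐ[μ] fun x => min |u x| k := coeFn_mk _ _ _

/-- A monotone sequence of nonnegative functions with modular at most one converges. -/
theorem exists_limit_of_monotone {v : ℕ → α → ℝ} (hv : ∀ k, Measurable (v k))
    (h0 : ∀ k, ∀ᵐ x ∂μ, 0 ≤ v k x) (hmono : ∀ k, ∀ᵐ x ∂μ, v k x ≤ v (k + 1) x)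
    (hmod : ∀ k, orliczModular Φ μ (v k) ≤ 1) :
    ∃ w : OrliczSpace Φ μ, (∀ k, ∀ᵐ x ∂μ, v k x ≤ w x) ∧
      ∀ᵐ x ∂μ, Tendsto (fun k => v k x) atTop (𝓝 (w x)) := by
  have hmeas : ∀ k, Measurable fun x => ENNReal.ofReal (Φ |v k x|) := fun k =>
    (Φ.measurable_abs.comp (hv k)).ennreal_ofReal
  have hlim : ∫⁻ x, liminf (fun k => ENNReal.ofReal (Φ |v k x|)) atTop ∂μ ≤ 1 :=
    (lintegral_liminf_le hmeas).trans
      (liminf_le_of_frequently_le' (Eventually.frequently (Eventually.of_forall hmod)))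
  have hfin := ae_lt_top (Measurable.liminf hmeas) (hlim.trans_lt ENNReal.one_lt_top).ne
  set d := Φ.density 1
  have hd : 0 < d := Φ.density_pos 1 one_pos
  have hconv : ∀ᵐ x ∂μ, Tendsto (fun k => v k x) atTop (𝓝 (⨆ k, v k x)) ∧
      ∀ k, v k x ≤ ⨆ k, v k x := by
    filter_upwards [hfin, ae_all_iff.2 h0, ae_all_iff.2 hmono] with x hx hx0 hxm
    have hm : Monotone fun k => v k x := monotone_nat_of_le_succ hxm
    -- A finite liminf of Φ(v_k(x)) gives a bound M for infinitely many k; the tangent at 1 turns it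
    -- into a bound for v_k(x), and monotonicity extends it to all k.
    have hb : BddAbove (range fun k => v k x) := by
      obtain ⟨M, hM1, hM2⟩ := exists_between hx
      have hfreq := frequently_lt_of_liminf_lt (by isBoundedDefault) hM1
      refine ⟨d⁻¹ * M.toReal + 1, ?_⟩
      rintro _ ⟨k, rfl⟩
      obtain ⟨j, hkj, hj⟩ := (frequently_atTop.1 hfreq) k
      have h1 : Φ |v j x| ≤ M.toReal := (ENNReal.ofReal_le_iff_le_toReal hM2.ne).1 hj.le
      have h2 := Φ.sub_mul_density_le zero_le_one (abs_nonneg (v j x))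
      have h3 : v k x ≤ |v j x| := (hm hkj).trans (le_abs_self _)
      have h4 : |v j x| - 1 ≤ d⁻¹ * M.toReal := by
        rw [inv_mul_eq_div, le_div_iff₀ hd]
        linarith
      simp only
      linarith
    exact ⟨tendsto_atTop_ciSup hm hb, fun k => le_ciSup hb k⟩
  have hwm : Measurable fun x => ⨆ k, v k x := Measurable.iSup hv
  have hmodw : orliczModular Φ μ (fun x => ⨆ k, v k x) ≤ 1 := by
    refine le_trans (le_of_eq ?_) hlim
    apply lintegral_congr_ae
    filter_upwards [hconv] with x hx
    exact (ENNReal.tendsto_ofReal ((Φ.continuous_abs.tendsto _).comp hx.1)).liminf_eq.symm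
  have hne := luxemburgSet_nonempty_of_modular_lt_top (hmodw.trans_lt ENNReal.one_lt_top)
  have hw := coeFn_mk _ hwm.aestronglyMeasurable hne
  refine ⟨mk _ hwm.aestronglyMeasurable hne, fun k => ?_, ?_⟩
  · filter_upwards [hw, hconv] with x h1 h2
    rw [h1]
    exact h2.2 k
  · filter_upwards [hw, hconv] with x h1 h2
    rw [h1]
    exact h2.1

variable [IsFiniteMeasure μ]

theorem memLp_trunc (k : ℕ) (u : OrliczSpace Φ μ) (p : ℝ≥0∞) : MemLp (trunc k u) p μ := by
  apply MemLp.of_bound (trunc k u).aestronglyMeasurable k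
  filter_upwards [coeFn_trunc k u] with x hx
  rw [hx, Real.norm_eq_abs, abs_of_nonneg (le_min (abs_nonneg _) k.cast_nonneg)]
  exact min_le_right _ _

/-- The difference u - min(u, k) lives on {u ≥ k}, whose measure is at most C/k by Chebyshev,
uniformly over the unit ball. -/
theorem exists_forall_abs_apply_sub_trunc_le (hΦ : DeltaTwo Φ) (hΨ : DeltaTwo Φ.compl)
    (l : OrliczSpace Φ μ →L[ℝ] ℝ) {ε : ℝ} (hε : 0 < ε) :
    ∀ᶠ k : ℕ in atTop, ∀ u : OrliczSpace Φ μ, ‖u‖ < 1 → (∀ᵐ x ∂μ, 0 ≤ u x) →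
      |l (u - trunc k u)| ≤ ε := by
  obtain ⟨δ, hδ, h⟩ := exists_abs_apply_le_of_measure_lt hΦ hΨ l hε
  obtain ⟨C, hC, hC'⟩ := exists_lintegral_enorm_le Φ μ
  have hlim : Tendsto (fun k : ℕ => ENNReal.ofReal C / k) atTop (𝓝 0) := by
    have h1 := ENNReal.Tendsto.const_mul (a := ENNReal.ofReal C) ENNReal.tendsto_inv_nat_nhds_zero
      (Or.inr ENNReal.ofReal_ne_top)
    rw [mul_zero] at h1
    exact h1.congr fun k => (div_eq_mul_inv _ _).symm
  filter_upwards [hlim.eventually (gt_mem_nhds hδ), eventually_gt_atTop 0] with k hk hk0 u hu hu0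
  apply h (u - trunc k u) _ {x | (k : ℝ) ≤ u x} (measurableSet_le measurable_const u.measurable)
  · refine lt_of_le_of_lt ?_ hk
    rw [ENNReal.le_div_iff_mul_le (by simp [hk0.ne']) (by simp), mul_comm]
    calc (k : ℝ≥0∞) * μ {x | (k : ℝ) ≤ u x} ≤ k * μ {x | (k : ℝ≥0∞) ≤ ‖u x‖ₑ} := by
          refine mul_le_mul' le_rfl (measure_mono fun x hx => ?_)
          have hx : (k : ℝ) ≤ u x := hx
          have h1 := ENNReal.ofReal_le_ofReal (hx.trans (le_abs_self _))
          rwa [ENNReal.ofReal_natCast, ← Real.enorm_eq_ofReal_abs] at h1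
      _ ≤ ∫⁻ x, ‖u x‖ₑ ∂μ := mul_meas_ge_le_lintegral u.measurable.enorm _
      _ ≤ ENNReal.ofReal (C * ‖u‖) := hC' u
      _ ≤ ENNReal.ofReal C := by
          apply ENNReal.ofReal_le_ofReal
          nlinarith
  · filter_upwards [coeFn_trunc k u, coeFn_sub u (trunc k u), hu0] with x h1 h2 h3 h4
    have h4 : ¬ (k : ℝ) ≤ u x := h4
    rw [h2, Pi.sub_apply, h1, abs_of_nonneg h3, min_eq_left (by linarith), sub_self]
  · refine lt_of_le_of_lt (norm_le_norm_of_abs_le ?_) hu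
    filter_upwards [coeFn_trunc k u, coeFn_sub u (trunc k u), hu0] with x h1 h2 h3
    rw [h2, Pi.sub_apply, h1, abs_of_nonneg h3]
    have h4 := min_le_left (u x) (k : ℝ)
    have h5 : 0 ≤ min (u x) (k : ℝ) := le_min h3 k.cast_nonneg
    rw [abs_of_nonneg (by linarith)]
    linarith

/-- For each k the truncations min(w_i, k) are bounded in L² and have a weak limit v_k. The v_k
increase in k with modular at most 1, hence converge in L_Φ to some w₀. Since truncation changes
l(w_i) by little, uniformly in i, the limits in k and along U may be interchanged. Nonnegativity
makes the truncations monotone in k. -/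
theorem exists_weakLim_of_nonneg (hΦ : DeltaTwo Φ) (hΨ : DeltaTwo Φ.compl) {ι : Type*}
    (U : Ultrafilter ι) (w : ι → OrliczSpace Φ μ) (hw : ∀ i, ‖w i‖ < 1)
    (hw0 : ∀ i, ∀ᵐ x ∂μ, 0 ≤ w i x) : ∃ w₀, WeakLim (U : Filter ι) w w₀ := by
  let a : ℕ → ι → Lp ℝ 2 μ := fun k i => (memLp_trunc k (w i) 2).toLp _
  have ha : ∀ k i, a k i =ᵐ[μ] trunc k (w i) := fun k i => MemLp.coeFn_toLp _
  have ha' : ∀ k i, a k i =ᵐ[μ] fun x => min (w i x) k := by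
    intro k i
    filter_upwards [ha k i, coeFn_trunc k (w i), hw0 i] with x h1 h2 h3
    rw [h1, h2, abs_of_nonneg h3]
  have hak : ∀ k i, ∀ᵐ x ∂μ, |a k i x| ≤ k := by
    intro k i
    filter_upwards [ha' k i, hw0 i] with x h1 h2
    rw [h1, abs_of_nonneg (le_min h2 k.cast_nonneg)]
    exact min_le_right _ _
  have hbdd : ∀ k i, ‖a k i‖ ≤ μ.real univ ^ (2 : ℝ≥0∞).toReal⁻¹ * k := fun k i =>
    Lp.norm_le_of_ae_bound k.cast_nonneg (hak k i)
  choose v hv using fun k => exists_weakLim_of_inner U (a k) (hbdd k)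
  have hv0 : ∀ k, ∀ᵐ x ∂μ, 0 ≤ v k x := fun k => by
    apply ae_nonneg_of_weakLim (hv k)
    intro i
    filter_upwards [ha' k i, hw0 i] with x h1 h2
    rw [h1]
    exact le_min h2 k.cast_nonneg
  have hvm : ∀ k, ∀ᵐ x ∂μ, v k x ≤ v (k + 1) x := fun k => by
    have h1 := ae_nonneg_of_weakLim ((hv (k + 1)).sub (hv k)) (fun i => by
      filter_upwards [ha' k i, ha' (k + 1) i, Lp.coeFn_sub (a (k + 1) i) (a k i)] with x h1 h2 h3
      rw [h3, Pi.sub_apply, h1, h2, sub_nonneg]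
      apply min_le_min le_rfl
      push_cast
      linarith)
    filter_upwards [h1, Lp.coeFn_sub (v (k + 1)) (v k)] with x h2 h3
    rw [h3, Pi.sub_apply] at h2
    linarith
  have hmod : ∀ k, orliczModular Φ μ (v k) ≤ 1 := fun k => by
    apply orliczModular_le_of_weakLim (hv k)
    intro i
    have h1 : orliczModular Φ μ (w i) ≤ 1 := by simpa using modular_le_one (hw i)
    refine le_trans (orliczModular_mono_ae Φ ?_) h1
    filter_upwards [ha' k i, hw0 i] with x h1 h2
    rw [h1, abs_of_nonneg (le_min h2 k.cast_nonneg)]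
    exact (min_le_left _ _).trans (le_abs_self _)
  obtain ⟨w₀, hw1, hw2⟩ := exists_limit_of_monotone (Φ := Φ)
    (fun k => (Lp.stronglyMeasurable (v k)).measurable) hv0 hvm hmod
  have hne : ∀ k, (luxemburgSet Φ μ (v k)).Nonempty := fun k =>
    luxemburgSet_nonempty_of_modular_lt_top ((hmod k).trans_lt ENNReal.one_lt_top)
  let y : ℕ → OrliczSpace Φ μ := fun k => mk _ (Lp.aestronglyMeasurable (v k)) (hne k)
  have hy : ∀ k, y k =ᵐ[μ] v k := fun k => coeFn_mk _ _ _
  have hylim : Tendsto y atTop (𝓝 w₀) := by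
    rw [tendsto_iff_norm_sub_tendsto_zero]
    apply tendsto_norm_zero_of_dominated hΦ w₀
    · intro k
      filter_upwards [hy k, coeFn_sub (y k) w₀, hw1 k, hv0 k] with x h1 h2 h3 h4
      rw [h2, Pi.sub_apply, h1, abs_of_nonneg (h4.trans h3), abs_of_nonpos (by linarith)]
      linarith
    · filter_upwards [ae_all_iff.2 hy, ae_all_iff.2 fun k => coeFn_sub (y k) w₀, hw2]
        with x h1 h2 h3
      have : (fun k => (y k - w₀) x) = fun k => v k x - w₀ x := by
        funext k
        rw [h2, Pi.sub_apply, h1]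
      rw [this]
      simpa using h3.sub_const (w₀ x)
  refine ⟨w₀, fun l => ?_⟩
  have hly : ∀ k, Tendsto (fun i => l (trunc k (w i))) U (𝓝 (l (y k))) := fun k => by
    have hle : ∀ (l : OrliczSpace Φ μ →L[ℝ] ℝ) (c : ℝ),
        (∀ᶠ i in U, l (trunc k (w i)) ≤ c) → l (y k) ≤ c := fun l c hc =>
      le_of_weakLim_of_bounded hΦ (hv k) (hak k) l (fun i => (ha k i).symm) (hy k) hc
    refine tendsto_of_ultrafilter (hle l) fun c hc => ?_
    have := hle (-l) (-c) (hc.mono fun i hi => by simpa using hi)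
    simpa using this
  rw [Metric.tendsto_nhds]
  intro ε hε
  have h1 : ∀ᶠ k in atTop, dist (l (y k)) (l w₀) < ε / 3 :=
    Metric.tendsto_nhds.1 ((l.continuous.tendsto w₀).comp hylim) _ (by positivity)
  obtain ⟨k, hk1, hk2⟩ := (h1.and (exists_forall_abs_apply_sub_trunc_le hΦ hΨ l
    (by positivity : 0 < ε / 3))).exists
  filter_upwards [Metric.tendsto_nhds.1 (hly k) _ (by positivity : 0 < ε / 3)] with i hi
  have h3 := hk2 (w i) (hw i) (hw0 i)
  rw [map_sub, ← Real.dist_eq] at h3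
  have h4 := dist_triangle4 (l (w i)) (l (trunc k (w i))) (l (y k)) (l w₀)
  linarith

/-- Bounded families in `L_Φ` have weak limits along ultrafilters, if `Φ` and its complementary
function satisfy the `Δ₂`-condition. -/
theorem exists_weakLim (hΦ : DeltaTwo Φ) (hΨ : DeltaTwo Φ.compl) {ι : Type*}
    (U : Ultrafilter ι) (w : ι → OrliczSpace Φ μ) {C : ℝ} (hw : ∀ i, ‖w i‖ ≤ C) :
    ∃ w₀, WeakLim (U : Filter ι) w w₀ := by
  set D := |C| + 1 with hD
  have hD0 : 0 < D := by positivity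
  -- For s = 1 and s = -1 these are the positive and negative parts of w_i / D; D > C makes their
  -- norms strictly less than 1.
  have part : ∀ s : ℝ, |s| = 1 → ∃ p : ι → OrliczSpace Φ μ, (∀ i, ‖p i‖ < 1) ∧
      ∀ i, p i =ᵐ[μ] fun x => max (s * (D⁻¹ * w i x)) 0 := by
    intro s hs
    have hle : ∀ i, ∀ x, |max (s * (D⁻¹ * w i x)) 0| ≤ |D⁻¹ * w i x| := fun i x => by
      rw [abs_of_nonneg (le_max_right _ _)]
      apply max_le _ (abs_nonneg _)
      refine (le_abs_self _).trans (le_of_eq ?_)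
      rw [abs_mul, hs, one_mul]
    have hle' : ∀ i, ∀ᵐ x ∂μ, |max (s * (D⁻¹ * w i x)) 0| ≤ |(D⁻¹ • w i) x| := fun i => by
      filter_upwards [coeFn_smul D⁻¹ (w i)] with x hx
      rw [hx]
      exact hle i x
    have hm : ∀ i, AEStronglyMeasurable (fun x => max (s * (D⁻¹ * w i x)) 0) μ := fun i => by
      have := (w i).measurable
      exact Measurable.aestronglyMeasurable (by fun_prop)
    refine ⟨fun i => mk _ (hm i) (nonempty_of_abs_le (D⁻¹ • w i) (hle' i)), fun i => ?_,
      fun i => coeFn_mk _ _ _⟩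
    have h1 : ‖D⁻¹ • w i‖ < 1 := by
      rw [norm_smul, Real.norm_eq_abs, abs_of_pos (inv_pos.2 hD0), inv_mul_lt_iff₀ hD0]
      have := (hw i).trans (le_abs_self C)
      linarith
    refine lt_of_le_of_lt (norm_le_norm_of_abs_le ?_) h1
    filter_upwards [coeFn_mk _ (hm i) (nonempty_of_abs_le (D⁻¹ • w i) (hle' i)), hle' i] with x h2 h3
    rwa [h2]
  obtain ⟨p, hp1, hp⟩ := part 1 (by simp)
  obtain ⟨q, hq1, hq⟩ := part (-1) (by simp)
  obtain ⟨p₀, hp₀⟩ := exists_weakLim_of_nonneg hΦ hΨ U p hp1 fun i => by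
    filter_upwards [hp i] with x hx
    rw [hx]
    exact le_max_right _ _
  obtain ⟨q₀, hq₀⟩ := exists_weakLim_of_nonneg hΦ hΨ U q hq1 fun i => by
    filter_upwards [hq i] with x hx
    rw [hx]
    exact le_max_right _ _
  refine ⟨D • (p₀ - q₀), ?_⟩
  have h1 : w = fun i => D • (p i - q i) := by
    funext i
    apply ext_ae
    filter_upwards [coeFn_smul D (p i - q i), coeFn_sub (p i) (q i), hp i, hq i] with x e1 e2 e3 e4
    simp only [e1, Pi.smul_apply, e2, Pi.sub_apply, e3, e4, smul_eq_mul]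
    rcases le_total 0 (D⁻¹ * w i x) with h | h
    · rw [max_eq_left (by linarith), max_eq_right (by linarith)]
      field_simp
      ring
    · rw [max_eq_right (by linarith), max_eq_left (by linarith)]
      field_simp
      ring
  rw [h1]
  exact (hp₀.sub hq₀).map (D • ContinuousLinearMap.id ℝ _)

end OrliczSpace

end OrliczReflexive

/-! ### Pointwise and integral estimates for C¹ functions under the cone property. -/

section SobolevEstimates

variable {n : ℕ} {Ω : Set (EuclideanSpace ℝ (Fin n))} {φ : EuclideanSpace ℝ (Fin n) → ℝ}
  {V : EuclideanSpace ℝ (Fin n) → EuclideanSpace ℝ (Fin n)}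

namespace IsC1Closure

/-- Fundamental theorem of calculus along the segment. V is extended by zero so that the right side
makes sense for all x and y and can be integrated over the whole space. -/
theorem enorm_apply_add_sub_le (h : IsC1Closure Ω φ V) {x y : EuclideanSpace ℝ (Fin n)}
    (hxy : ∀ t ∈ Icc (0 : ℝ) 1, x + t • y ∈ Ω) :
    ‖φ (x + y) - φ x‖ₑ ≤ ‖y‖ₑ * ∫⁻ t in Ioc (0 : ℝ) 1, ‖Ω.indicator V (x + t • y)‖ₑ := by
  have hd : ∀ t ∈ uIcc (0 : ℝ) 1, HasDerivAt (fun t : ℝ => φ (x + t • y))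
      (inner ℝ (V (x + t • y)) y) t := by
    intro t ht
    rw [uIcc_of_le zero_le_one] at ht
    have h1 := (h.2.2 _ (hxy t ht)).hasFDerivAt
    have h2 : HasDerivAt (fun t : ℝ => x + t • y) y t := by
      simpa using ((hasDerivAt_id t).smul_const y).const_add x
    have h3 := h1.comp_hasDerivAt t h2
    rw [InnerProductSpace.toDual_apply_apply] at h3
    exact h3
  have hc : ContinuousOn (fun t : ℝ => inner ℝ (V (x + t • y)) y) (uIcc 0 1) := by
    rw [uIcc_of_le zero_le_one]
    have : ContinuousOn (fun t : ℝ => V (x + t • y)) (Icc 0 1) :=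
      h.2.1.comp (by fun_prop) fun t ht => subset_closure (hxy t ht)
    exact this.inner continuousOn_const
  have hint := intervalIntegral.integral_eq_sub_of_hasDerivAt hd hc.intervalIntegrable
  simp only [one_smul, zero_smul, add_zero] at hint
  rw [← hint, intervalIntegral.integral_of_le zero_le_one, ← lintegral_const_mul' _ _ enorm_ne_top]
  refine (enorm_integral_le_lintegral_enorm _).trans ?_
  apply setLIntegral_mono' measurableSet_Ioc
  intro t ht
  rw [indicator_of_mem (hxy t (Ioc_subset_Icc_self ht)), mul_comm]
  rw [← ofReal_norm, ← ofReal_norm, ← ofReal_norm, ← ENNReal.ofReal_mul (norm_nonneg _)]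
  exact ENNReal.ofReal_le_ofReal (norm_inner_le_norm _ _)

theorem measurable_indicator_fun (h : IsC1Closure Ω φ V) (hΩ : IsOpen Ω) :
    Measurable (Ω.indicator φ) := by
  classical
  rw [← piecewise_eq_indicator]
  exact (h.1.mono subset_closure).measurable_piecewise continuousOn_const hΩ.measurableSet

theorem measurable_indicator_grad (h : IsC1Closure Ω φ V) (hΩ : IsOpen Ω) :
    Measurable (Ω.indicator V) := by
  classical
  rw [← piecewise_eq_indicator]
  exact (h.2.1.mono subset_closure).measurable_piecewise continuousOn_const hΩ.measurableSet

end IsC1Closure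

/-- For fixed y and t, translation by t y preserves Lebesgue measure; the rest is Tonelli. It is
used with ν Lebesgue measure on a ball and with ν a tent measure. -/
theorem lintegral_lintegral_translate (ν : Measure (EuclideanSpace ℝ (Fin n))) [SFinite ν]
    {H : EuclideanSpace ℝ (Fin n) → ℝ≥0∞} (hH : Measurable H) :
    ∫⁻ x, ∫⁻ y, (∫⁻ t in Ioc (0 : ℝ) 1, H (x + t • y)) ∂ν = ν univ * ∫⁻ x, H x := by
  have hm : Measurable fun p : (EuclideanSpace ℝ (Fin n) × EuclideanSpace ℝ (Fin n)) × ℝ =>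
      H (p.1.1 + p.2 • p.1.2) := hH.comp (by fun_prop)
  rw [lintegral_lintegral_swap (hm.lintegral_prod_right' (ν := volume.restrict _)).aemeasurable]
  have : ∀ y, ∫⁻ x, ∫⁻ t in Ioc (0 : ℝ) 1, H (x + t • y) = ∫⁻ x, H x := by
    intro y
    rw [lintegral_lintegral_swap (by
      have : Measurable fun p : EuclideanSpace ℝ (Fin n) × ℝ => H (p.1 + p.2 • y) :=
        hH.comp (by fun_prop)
      exact this.aemeasurable)]
    simp_rw [lintegral_add_right_eq_self]
    simp
  simp_rw [this]
  rw [lintegral_const, mul_comm]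

/-- Jensen's inequality for a finite measure that is not normalised, by integrating the tangent line
at `a`. In `ℝ≥0∞` the integral of s may be infinite. -/
theorem NFunction.eval_mul_measure_le (Φ : NFunction) {β : Type*} [MeasurableSpace β]
    (P : Measure β) [IsFiniteMeasure P] {s : β → ℝ} (hs0 : ∀ b, 0 ≤ s b)
    {a : ℝ} (ha : 0 ≤ a)
    (h : ENNReal.ofReal a * P univ ≤ ∫⁻ b, ENNReal.ofReal (s b) ∂P) :
    ENNReal.ofReal (Φ a) * P univ ≤ ∫⁻ b, ENNReal.ofReal (Φ (s b)) ∂P := by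
  set d := Φ.density a
  have hd : 0 ≤ d := Φ.density_nonneg ha
  have hpt : ∀ b, ENNReal.ofReal (Φ a) + ENNReal.ofReal d * ENNReal.ofReal (s b) ≤
      ENNReal.ofReal (Φ (s b)) + ENNReal.ofReal d * ENNReal.ofReal a := by
    intro b
    rw [← ENNReal.ofReal_mul hd, ← ENNReal.ofReal_mul hd, ← ENNReal.ofReal_add (Φ.eval_nonneg ha)
      (mul_nonneg hd (hs0 b)), ← ENNReal.ofReal_add (Φ.eval_nonneg (hs0 b)) (mul_nonneg hd ha)]
    apply ENNReal.ofReal_le_ofReal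
    rcases le_total a (s b) with hab | hab
    · have := Φ.le_sub ha hab
      linarith
    · have := Φ.sub_le (hs0 b) hab
      linarith
  have h1 := lintegral_mono (μ := P) hpt
  rw [lintegral_add_left measurable_const, lintegral_add_right _ measurable_const,
    lintegral_const_mul' _ _ ENNReal.ofReal_ne_top, lintegral_const, lintegral_const] at h1
  have hfin : ENNReal.ofReal d * ENNReal.ofReal a * P univ ≠ ⊤ :=
    ENNReal.mul_ne_top (ENNReal.mul_ne_top ENNReal.ofReal_ne_top ENNReal.ofReal_ne_top)
      (measure_ne_top _ _)
  rw [← ENNReal.add_le_add_iff_right hfin]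
  refine le_trans ?_ h1
  rw [mul_assoc]
  gcongr

/-- Every point of `Ω` sees a ball of fixed size within `Ω`. -/
theorem ConeProperty.exists_ball (h : ConeProperty Ω) : ∃ r > 0, ∃ ρ > 0, ∀ x ∈ Ω,
    ∃ c : EuclideanSpace ℝ (Fin n), ∀ y ∈ Metric.ball c ρ, y ∈ Metric.ball 0 r ∧
      ∀ t ∈ Icc (0 : ℝ) 1, x + t • y ∈ Ω := by
  obtain ⟨r, hr, κ, ⟨hκ0, hκ1⟩, h⟩ := h
  -- ρ solves κ (r/2 + ρ) = r/2 - ρ. A point y of the ball of radius ρ about (r/2) e has |y| < r/2 +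
  -- ρ and ⟨e, y⟩ > r/2 - ρ, so it lies in the cone, and with it the segment from the vertex.
  set ρ := r / 2 * ((1 - κ) / (1 + κ)) with hρ
  have hq : 0 < (1 - κ) / (1 + κ) := div_pos (by linarith) (by linarith)
  have hρ0 : 0 < ρ := by positivity
  have hρ1 : ρ < r / 2 := by
    have : (1 - κ) / (1 + κ) < 1 := by
      rw [div_lt_one (by linarith)]
      linarith
    rw [hρ]
    nlinarith
  have hρκ : κ * (r / 2 + ρ) = r / 2 - ρ := by
    rw [hρ]
    field_simp
    ring
  refine ⟨r, hr, ρ, hρ0, fun x hx => ?_⟩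
  obtain ⟨e, he, hcone⟩ := h x hx
  refine ⟨(r / 2) • e, fun y hy => ?_⟩
  rw [Metric.mem_ball, dist_eq_norm] at hy
  have hre : ‖(r / 2) • e‖ = r / 2 := by
    rw [norm_smul, he, Real.norm_eq_abs, abs_of_pos (by positivity), mul_one]
  have hy1 : ‖y‖ < r / 2 + ρ := by
    have := norm_le_norm_add_norm_sub' y ((r / 2) • e)
    linarith
  have hin : r / 2 - ρ < inner ℝ e y := by
    have h1 : inner ℝ e y = inner ℝ e (y - (r / 2) • e) + r / 2 := by
      rw [inner_sub_right, inner_smul_right, real_inner_self_eq_norm_sq, he]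
      ring
    have h2 := abs_le.1 ((Real.norm_eq_abs _).symm.le.trans
      (norm_inner_le_norm (𝕜 := ℝ) e (y - (r / 2) • e)))
    rw [he, one_mul] at h2
    linarith [h2.1]
  have hy0 : 0 < ‖y‖ := by
    have := (le_abs_self _).trans ((Real.norm_eq_abs _).symm.le.trans
      (norm_inner_le_norm (𝕜 := ℝ) e y))
    rw [he, one_mul] at this
    linarith
  refine ⟨by rw [mem_ball_zero_iff]; linarith, fun t ht => ?_⟩
  rcases ht.1.eq_or_lt with h0 | h0
  · rw [← h0, zero_smul, add_zero]
    exact hx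
  · apply hcone
    · rw [norm_smul, Real.norm_eq_abs, abs_of_pos h0]
      positivity
    · rw [norm_smul, Real.norm_eq_abs, abs_of_pos h0]
      nlinarith [ht.2]
    · rw [norm_smul, Real.norm_eq_abs, abs_of_pos h0, inner_smul_right]
      have : κ * ‖y‖ < inner ℝ e y := by nlinarith
      nlinarith

namespace IsC1Closure

/-- Average |φ(x)| ≤ |φ(x + y)| + r ∫ |V(x + t y)| dt over the ball of radius ρ seen from x. The
first term averages to at most `a`; Jensen for Φ handles the second. Enlarging that ball to the one
of radius r about 0 removes the dependence of the domain on x. -/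
theorem eval_mul_measure_le (h : IsC1Closure Ω φ V) (hΩ : IsOpen Ω) (Φ : NFunction)
    {r ρ a b : ℝ} (hr : 0 < r) (ha : 0 ≤ a) (hb : 0 < b)
    (hφ : ∫⁻ x in Ω, ‖φ x‖ₑ ≤ ENNReal.ofReal a * volume (Metric.ball (0 : EuclideanSpace ℝ (Fin n)) ρ))
    {x c : EuclideanSpace ℝ (Fin n)} (hc : ∀ y ∈ Metric.ball c ρ, y ∈ Metric.ball 0 r ∧
      ∀ t ∈ Icc (0 : ℝ) 1, x + t • y ∈ Ω) :
    ENNReal.ofReal (Φ (max ((|φ x| - a) / (r * b)) 0)) *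
        volume (Metric.ball (0 : EuclideanSpace ℝ (Fin n)) ρ) ≤
      ∫⁻ y in Metric.ball 0 r, ∫⁻ t in Ioc (0 : ℝ) 1,
        ENNReal.ofReal (Φ (‖Ω.indicator V (x + t • y)‖ / b)) := by
  set m := volume (Metric.ball (0 : EuclideanSpace ℝ (Fin n)) ρ) with hm
  have hmc : volume (Metric.ball c ρ) = m := Measure.addHaar_ball_center _ _ _
  have hV := h.measurable_indicator_grad hΩ
  have hjoint : Measurable fun p : EuclideanSpace ℝ (Fin n) × ℝ =>
      Ω.indicator V (x + p.2 • p.1) := hV.comp (by fun_prop)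
  set J : EuclideanSpace ℝ (Fin n) → ℝ≥0∞ :=
    fun y => ∫⁻ t in Ioc (0 : ℝ) 1, ‖Ω.indicator V (x + t • y)‖ₑ with hJ
  have hpt : ∀ y ∈ Metric.ball c ρ, ‖φ x‖ₑ ≤
      ‖Ω.indicator φ (x + y)‖ₑ + ENNReal.ofReal r * J y := by
    intro y hy
    obtain ⟨hyr, hyΩ⟩ := hc y hy
    have h1 := hyΩ 1 (by simp)
    rw [one_smul] at h1
    rw [indicator_of_mem h1]
    have h2 := h.enorm_apply_add_sub_le hyΩ
    have h3 : ‖φ x‖ₑ ≤ ‖φ (x + y)‖ₑ + ‖φ (x + y) - φ x‖ₑ := by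
      have := enorm_sub_le (a := φ (x + y)) (b := φ (x + y) - φ x)
      rwa [sub_sub_cancel] at this
    have h4 : ‖y‖ₑ ≤ ENNReal.ofReal r := by
      rw [← ofReal_norm]
      exact ENNReal.ofReal_le_ofReal (mem_ball_zero_iff.1 hyr).le
    exact h3.trans (by gcongr; exact h2.trans (by gcongr))
  have hmain : ENNReal.ofReal (|φ x| - a) * m ≤
      ENNReal.ofReal r * ∫⁻ y in Metric.ball c ρ, J y := by
    rw [ENNReal.ofReal_sub _ ha, ENNReal.sub_mul (fun _ _ => measure_ball_lt_top.ne),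
      tsub_le_iff_left, ← Real.enorm_eq_ofReal_abs]
    calc ‖φ x‖ₑ * m = ∫⁻ y in Metric.ball c ρ, ‖φ x‖ₑ := by rw [setLIntegral_const, hmc]
      _ ≤ ∫⁻ y in Metric.ball c ρ, (‖Ω.indicator φ (x + y)‖ₑ + ENNReal.ofReal r * J y) :=
          setLIntegral_mono' Metric.isOpen_ball.measurableSet hpt
      _ = (∫⁻ y in Metric.ball c ρ, ‖Ω.indicator φ (x + y)‖ₑ) +
          ENNReal.ofReal r * ∫⁻ y in Metric.ball c ρ, J y := by
          rw [lintegral_add_left, lintegral_const_mul' _ _ ENNReal.ofReal_ne_top]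
          exact ((h.measurable_indicator_fun hΩ).comp (measurable_const_add x)).enorm
      _ ≤ _ := by
          gcongr
          refine le_trans ?_ hφ
          calc _ ≤ ∫⁻ y, ‖Ω.indicator φ (x + y)‖ₑ := setLIntegral_le_lintegral _ _
            _ = ∫⁻ y, ‖Ω.indicator φ y‖ₑ := lintegral_add_left_eq_self (fun y => ‖Ω.indicator φ y‖ₑ) x
            _ = ∫⁻ y in Ω, ‖φ y‖ₑ := by
              rw [← lintegral_indicator hΩ.measurableSet]
              simp_rw [enorm_indicator_eq_indicator_enorm]
  have hP : ((volume.restrict (Metric.ball c ρ)).prod (volume.restrict (Ioc (0 : ℝ) 1))) univ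
      = m := by
    rw [← univ_prod_univ, Measure.prod_prod]
    simp [hmc]
  have : IsFiniteMeasure
      ((volume.restrict (Metric.ball c ρ)).prod (volume.restrict (Ioc (0 : ℝ) 1))) :=
    ⟨hP ▸ measure_ball_lt_top⟩
  have hfinal := Φ.eval_mul_measure_le
    ((volume.restrict (Metric.ball c ρ)).prod (volume.restrict (Ioc (0 : ℝ) 1)))
    (s := fun p => ‖Ω.indicator V (x + p.2 • p.1)‖ / b) (fun p => by positivity)
    (a := max ((|φ x| - a) / (r * b)) 0) (le_max_right _ _) (by
      rw [hP, lintegral_prod _ (hjoint.norm.div_const b).ennreal_ofReal.aemeasurable]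
      have h1 : ∀ z : EuclideanSpace ℝ (Fin n), ENNReal.ofReal (‖Ω.indicator V z‖ / b) =
          ENNReal.ofReal b⁻¹ * ‖Ω.indicator V z‖ₑ := fun z => by
        rw [← ofReal_norm, ← ENNReal.ofReal_mul (by positivity), div_eq_inv_mul]
      simp_rw [h1, lintegral_const_mul' _ _ ENNReal.ofReal_ne_top]
      have h2 : ENNReal.ofReal (max ((|φ x| - a) / (r * b)) 0) =
          ENNReal.ofReal (r * b)⁻¹ * ENNReal.ofReal (|φ x| - a) := by
        rw [← ENNReal.ofReal_mul (by positivity), ← div_eq_inv_mul]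
        simp [ENNReal.ofReal, Real.toNNReal]
      rw [h2, mul_assoc]
      calc _ ≤ ENNReal.ofReal (r * b)⁻¹ * (ENNReal.ofReal r * ∫⁻ y in Metric.ball c ρ, J y) := by
            gcongr
        _ = _ := by
            rw [← mul_assoc, ← ENNReal.ofReal_mul (by positivity)]
            congr 2
            field_simp)
  rw [hP, lintegral_prod _ (by
    have h1 := (Φ.measurable_abs.comp (hjoint.norm.div_const b)).ennreal_ofReal
    refine Measurable.aemeasurable ?_
    convert h1 using 3 with p
    simp only [Function.comp]
    rw [abs_of_nonneg (by positivity)])] at hfinal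
  refine hfinal.trans (lintegral_mono_set fun y hy => (hc y hy).1)

/-- Integrate the pointwise bound over x ∈ Ω; translation invariance collapses the triple integral.
-/
theorem modular_mul_measure_le (h : IsC1Closure Ω φ V) (hΩ : IsOpen Ω) (Φ : NFunction)
    {r ρ a b : ℝ} (hr : 0 < r) (ha : 0 ≤ a) (hb : 0 < b)
    (hφ : ∫⁻ x in Ω, ‖φ x‖ₑ ≤ ENNReal.ofReal a * volume (Metric.ball (0 : EuclideanSpace ℝ (Fin n)) ρ))
    (hc : ∀ x ∈ Ω, ∃ c : EuclideanSpace ℝ (Fin n), ∀ y ∈ Metric.ball c ρ, y ∈ Metric.ball 0 r ∧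
      ∀ t ∈ Icc (0 : ℝ) 1, x + t • y ∈ Ω) :
    orliczModular Φ (volume.restrict Ω) (fun x => max ((|φ x| - a) / (r * b)) 0) *
        volume (Metric.ball (0 : EuclideanSpace ℝ (Fin n)) ρ) ≤
      volume (Metric.ball (0 : EuclideanSpace ℝ (Fin n)) r) *
        orliczModular Φ (volume.restrict Ω) (fun x => ‖V x‖ / b) := by
  have hV := h.measurable_indicator_grad hΩ
  have hH : Measurable fun z => ENNReal.ofReal (Φ (‖Ω.indicator V z‖ / b)) := by
    have h1 := (Φ.measurable_abs.comp (hV.norm.div_const b)).ennreal_ofReal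
    convert h1 using 3 with p
    simp only [Function.comp]
    rw [abs_of_nonneg (by positivity)]
  have htr := lintegral_lintegral_translate
    (volume.restrict (Metric.ball (0 : EuclideanSpace ℝ (Fin n)) r)) hH
  rw [Measure.restrict_apply_univ] at htr
  have hHΩ : ∫⁻ z, ENNReal.ofReal (Φ (‖Ω.indicator V z‖ / b)) =
      orliczModular Φ (volume.restrict Ω) (fun x => ‖V x‖ / b) := by
    unfold orliczModular
    rw [← lintegral_indicator hΩ.measurableSet]
    congr 1
    funext z
    by_cases hz : z ∈ Ω
    · rw [indicator_of_mem hz, indicator_of_mem hz, abs_of_nonneg (by positivity)]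
    · rw [indicator_of_notMem hz, indicator_of_notMem hz]
      simp [Φ.eval_zero]
  rw [← hHΩ, ← htr, orliczModular, ← lintegral_mul_const' _ _ measure_ball_lt_top.ne]
  refine le_trans ?_ (setLIntegral_le_lintegral Ω _)
  apply setLIntegral_mono' hΩ.measurableSet
  intro x hx
  obtain ⟨c, hc⟩ := hc x hx
  rw [abs_of_nonneg (le_max_right _ _)]
  exact h.eval_mul_measure_le hΩ Φ hr ha hb hφ hc

end IsC1Closure

end SobolevEstimates

/-! ### Coercivity: the norm of W¹_Φ in terms of ‖u‖₁ and the gradient. -/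

namespace OrliczSpace

variable {α : Type*} [MeasurableSpace α] {Φ : NFunction} {μ : Measure α}

/-- Provides an element of L_Φ that majorizes the Euclidean length of the gradient and obeys the
triangle inequality. -/
theorem exists_sum_abs_le {ι : Type*} (s : Finset ι) (w : ι → OrliczSpace Φ μ) :
    ∃ S : OrliczSpace Φ μ, ‖S‖ ≤ ∑ i ∈ s, ‖w i‖ ∧ ∀ᵐ x ∂μ, ∑ i ∈ s, |w i x| ≤ S x := by
  classical
  induction s using Finset.induction_on with
  | empty =>
    refine ⟨0, by simp, ?_⟩
    filter_upwards [coeFn_zero (Φ := Φ) (μ := μ)] with x hx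
    simp [hx]
  | insert i s hi ih =>
    obtain ⟨S, hS, hS'⟩ := ih
    have hm : AEStronglyMeasurable (fun x => |w i x|) μ := by
      have := (w i).measurable
      exact Measurable.aestronglyMeasurable (by fun_prop)
    have hne : (luxemburgSet Φ μ fun x => |w i x|).Nonempty :=
      nonempty_of_abs_le (w i) (by simp)
    have ha := coeFn_mk _ hm hne
    refine ⟨mk _ hm hne + S, ?_, ?_⟩
    · rw [Finset.sum_insert hi]
      refine (norm_add_le _ _).trans (add_le_add (norm_le_norm_of_abs_le ?_) hS)
      filter_upwards [ha] with x hx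
      rw [hx, abs_abs]
    · filter_upwards [ha, hS', coeFn_add (mk _ hm hne) S] with x h1 h2 h3
      rw [Finset.sum_insert hi, h3, Pi.add_apply, h1]
      linarith

end OrliczSpace

theorem EuclideanSpace.norm_le_sum_abs {n : ℕ} (v : EuclideanSpace ℝ (Fin n)) :
    ‖v‖ ≤ ∑ i, |v i| := by
  rw [EuclideanSpace.norm_eq]
  apply Real.sqrt_le_iff.2 ⟨Finset.sum_nonneg fun i _ => abs_nonneg _, ?_⟩
  simpa using Finset.sum_sq_le_sq_sum_of_nonneg (s := Finset.univ) (f := fun i => |v i|)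
    fun i _ => abs_nonneg _

section Coercivity

variable {n : ℕ} {Ω : Set (EuclideanSpace ℝ (Fin n))} {Φ : NFunction}

/-- `‖u‖_Φ ≤ C (‖u‖₁ + ∑ᵢ ‖∂ᵢu‖_Φ)`. -/
theorem exists_norm_fst_le [IsFiniteMeasure (volume.restrict Ω)] (hΩ : IsOpen Ω)
    (hc : ConeProperty Ω) (Φ : NFunction) :
    ∃ C ≥ 0, ∀ w ∈ (smoothJets Φ Ω).topologicalClosure,
      ‖w.1‖ ≤ C * (‖OrliczSpace.toL1 Φ (volume.restrict Ω) w.1‖ + ∑ i, ‖w.2 i‖) := by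
  obtain ⟨r, hr, ρ, hρ, hball⟩ := hc.exists_ball
  set m := volume (Metric.ball (0 : EuclideanSpace ℝ (Fin n)) ρ) with hm
  have hm0 : 0 < m.toReal :=
    ENNReal.toReal_pos (Metric.measure_ball_pos _ _ hρ).ne' measure_ball_lt_top.ne
  set C₀ := max 1 (volume (Metric.ball (0 : EuclideanSpace ℝ (Fin n)) r) / m).toReal
  obtain ⟨C₁, hC₁, hconst⟩ := OrliczSpace.norm_const_mul_le Φ (volume.restrict Ω)
  have hC₀ : 1 ≤ C₀ := le_max_left _ _
  refine ⟨max (C₀ * r) (C₁ / m.toReal), by positivity, ?_⟩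
  -- Both sides are continuous on jets, so it suffices to treat smooth ones.
  have hclosed : IsClosed {w : OrliczJet Φ Ω | ‖w.1‖ ≤ max (C₀ * r) (C₁ / m.toReal) *
      (‖OrliczSpace.toL1 Φ (volume.restrict Ω) w.1‖ + ∑ i, ‖w.2 i‖)} := by
    apply isClosed_le (by fun_prop)
    fun_prop
  intro w hw
  refine closure_minimal ?_ hclosed hw
  rintro w ⟨φ, V, h, hφ, hV⟩
  set N := ‖OrliczSpace.toL1 Φ (volume.restrict Ω) w.1‖ with hN
  have hN0 : 0 ≤ N := norm_nonneg _
  set a := N / m.toReal with ha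
  have ha0 : 0 ≤ a := by positivity
  have hφa : ∫⁻ x in Ω, ‖φ x‖ₑ ≤ ENNReal.ofReal a * m := by
    have h1 : ∫⁻ x in Ω, ‖φ x‖ₑ = ENNReal.ofReal N := by
      rw [hN, L1.ofReal_norm_eq_lintegral]
      apply lintegral_congr_ae
      filter_upwards [hφ, OrliczSpace.coeFn_toL1 w.1] with x h1 h2
      rw [h2, h1]
    rw [h1, ← ENNReal.ofReal_toReal (a := m) measure_ball_lt_top.ne, ← ENNReal.ofReal_mul ha0, ha,
      div_mul_cancel₀ _ hm0.ne']
  -- Taking b strictly above the sum keeps b positive and the modular of |V|/b at most 1; then b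
  -- decreases to the sum.
  suffices hs : ∀ b > ∑ i, ‖w.2 i‖, ‖w.1‖ ≤ C₀ * (r * b) + C₁ * a by
    have h1 : ‖w.1‖ ≤ C₀ * (r * ∑ i, ‖w.2 i‖) + C₁ * a := by
      have hcont : Continuous fun b : ℝ => C₀ * (r * b) + C₁ * a := by fun_prop
      apply ge_of_tendsto (hcont.continuousWithinAt (s := Ioi (∑ i, ‖w.2 i‖)))
      filter_upwards [self_mem_nhdsWithin] with b hb using hs b hb
    have h2 : C₁ * a = C₁ / m.toReal * N := by rw [ha]; ring
    have h3 := mul_le_mul_of_nonneg_right (le_max_left (C₀ * r) (C₁ / m.toReal))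
      (Finset.sum_nonneg fun i (_ : i ∈ Finset.univ) => norm_nonneg (w.2 i))
    have h4 := mul_le_mul_of_nonneg_right (le_max_right (C₀ * r) (C₁ / m.toReal)) hN0
    change ‖w.1‖ ≤ _ * (N + _)
    linarith
  intro b hb
  have hb0 : 0 < b := (Finset.sum_nonneg fun i _ => norm_nonneg _).trans_lt hb
  obtain ⟨S, hS, hS'⟩ := OrliczSpace.exists_sum_abs_le Finset.univ w.2
  have hVmod : orliczModular Φ (volume.restrict Ω) (fun x => ‖V x‖ / b) ≤ 1 := by
    refine le_trans (orliczModular_mono_ae Φ ?_) (OrliczSpace.modular_le_one (hS.trans_lt hb))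
    filter_upwards [hS', ae_all_iff.2 hV] with x h1 h2
    simp only [Pi.smul_apply, smul_eq_mul, abs_mul, abs_div, abs_norm, abs_inv]
    rw [div_eq_inv_mul]
    gcongr
    refine (EuclideanSpace.norm_le_sum_abs _).trans (le_trans ?_ (le_abs_self _))
    simpa only [h2] using h1
  have hmod := h.modular_mul_measure_le hΩ Φ hr ha0 hb0 hφa hball
  have hmod' : orliczModular Φ (volume.restrict Ω) (fun x => max ((|φ x| - a) / (r * b)) 0) ≤
      ENNReal.ofReal C₀ := by
    have h1 : orliczModular Φ (volume.restrict Ω) (fun x => max ((|φ x| - a) / (r * b)) 0) ≤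
        volume (Metric.ball (0 : EuclideanSpace ℝ (Fin n)) r) / m := by
      rw [ENNReal.le_div_iff_mul_le (Or.inl (Metric.measure_ball_pos _ _ hρ).ne')
        (Or.inl measure_ball_lt_top.ne)]
      refine hmod.trans ?_
      calc _ ≤ volume (Metric.ball (0 : EuclideanSpace ℝ (Fin n)) r) * 1 := by gcongr
        _ = _ := mul_one _
    refine h1.trans ?_
    rw [← ENNReal.ofReal_toReal (ENNReal.div_lt_top measure_ball_lt_top.ne
      (Metric.measure_ball_pos volume (0 : EuclideanSpace ℝ (Fin n)) hρ).ne').ne]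
    exact ENNReal.ofReal_le_ofReal (le_max_right _ _)
  -- Split |u| ≤ Y + a with Y = (|u| - a)⁺. The modular of Y/(r b) is at most C₀, which bounds ‖Y‖;
  -- the constant `a` is a multiple of ‖u‖₁.
  have hYm : AEStronglyMeasurable (fun x => max (|w.1 x| - a) 0) (volume.restrict Ω) := by
    have := w.1.measurable
    exact Measurable.aestronglyMeasurable (by fun_prop)
  have hYne : (luxemburgSet Φ (volume.restrict Ω) fun x => max (|w.1 x| - a) 0).Nonempty := by
    apply OrliczSpace.nonempty_of_abs_le w.1 (ae_of_all _ fun x => ?_)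
    rw [abs_of_nonneg (le_max_right _ _)]
    exact max_le (by linarith) (abs_nonneg _)
  have hY := OrliczSpace.coeFn_mk _ hYm hYne
  set Y := OrliczSpace.mk _ hYm hYne
  have hYnorm : ‖Y‖ ≤ C₀ * (r * b) := by
    apply OrliczSpace.norm_le_of_modular_le (by positivity) hC₀
    refine le_trans (orliczModular_mono_ae Φ ?_) hmod'
    filter_upwards [hY, hφ] with x h1 h2
    apply le_of_eq
    rw [Pi.smul_apply, h1, h2, smul_eq_mul, div_eq_inv_mul,
      mul_max_of_nonneg _ _ (by positivity : 0 ≤ (r * b)⁻¹), mul_zero]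
  have hAne : (luxemburgSet Φ (volume.restrict Ω)
      fun _ : EuclideanSpace ℝ (Fin n) => a).Nonempty :=
    OrliczSpace.nonempty_of_bounded (k := |a|) (by simp)
  have hA := OrliczSpace.coeFn_mk _ aestronglyMeasurable_const hAne
  have hAnorm := hconst (OrliczSpace.mk _ aestronglyMeasurable_const hAne) a ha0 (by
    filter_upwards [hA] with x hx
    rw [hx, abs_of_nonneg ha0])
  calc ‖w.1‖ ≤ ‖Y + OrliczSpace.mk _ aestronglyMeasurable_const hAne‖ := by
        apply OrliczSpace.norm_le_norm_of_abs_le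
        filter_upwards [hY, hA, OrliczSpace.coeFn_add Y
          (OrliczSpace.mk _ aestronglyMeasurable_const hAne)] with x h1 h2 h3
        rw [h3, Pi.add_apply, h1, h2]
        have := le_max_left (|w.1 x| - a) 0
        exact le_trans (by linarith) (le_abs_self _)
    _ ≤ _ := (norm_add_le _ _).trans (add_le_add hYnorm hAnorm)

theorem OrliczSobolev.abs_le_norm_grad (u : OrliczSobolev Φ Ω) (i : Fin n)
    (x : EuclideanSpace ℝ (Fin n)) : |u.1.2 i x| ≤ ‖u.grad x‖ :=
  PiLp.norm_apply_le (u.grad x) i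

/-- Coercivity: bounds on `∫ Φ(|Du|)` and `∫ B(|u|)` bound the norm of `W¹_Φ(Ω)`. -/
theorem exists_norm_le_of_modular_le [IsFiniteMeasure (volume.restrict Ω)] (hΩ : IsOpen Ω)
    (hc : ConeProperty Ω) (Φ B : NFunction) {K : ℝ} (hK : 0 ≤ K) :
    ∃ M, ∀ u : OrliczSobolev Φ Ω,
      orliczModular Φ (volume.restrict Ω) (fun x => ‖u.grad x‖) ≤ ENNReal.ofReal K →
      orliczModular B (volume.restrict Ω) u.fn ≤ ENNReal.ofReal K → ‖u‖ ≤ M := by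
  obtain ⟨C, hC, h⟩ := exists_norm_fst_le hΩ hc Φ
  obtain ⟨D, hD, h'⟩ := OrliczSpace.exists_lintegral_enorm_le_of_modular_le B (volume.restrict Ω)
  refine ⟨max (C * (D * (1 + K) + n * max 1 K)) (max 1 K), fun u hu hu' => ?_⟩
  have hgrad : ∀ i, ‖u.1.2 i‖ ≤ max 1 K := by
    intro i
    have := OrliczSpace.norm_le_of_modular_le (u := u.1.2 i) (r := 1) (K := max 1 K) one_pos
      (le_max_left _ _) (by
        rw [inv_one, one_smul]
        refine (orliczModular_mono Φ fun x => ?_).trans (hu.trans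
          (ENNReal.ofReal_le_ofReal (le_max_right _ _)))
        rw [abs_norm]
        exact u.abs_le_norm_grad i x)
    rwa [mul_one] at this
  -- B grows at least linearly, so its modular bounds the L¹ norm, the only lower order quantity in
  -- `exists_norm_fst_le`.
  have hL1 : ‖OrliczSpace.toL1 Φ (volume.restrict Ω) u.1.1‖ ≤ D * (1 + K) := by
    have h1 := h' _ K hK hu'
    rw [L1.norm_def]
    apply ENNReal.toReal_le_of_le_ofReal (by positivity)
    refine le_trans (le_of_eq ?_) h1
    apply lintegral_congr_ae
    filter_upwards [OrliczSpace.coeFn_toL1 u.1.1] with x hx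
    rw [hx]
    rfl
  change ‖u.1‖ ≤ _
  rw [Prod.norm_def]
  apply max_le_max
  · refine (h u.1 u.2).trans ?_
    gcongr
    refine (Finset.sum_le_sum fun i _ => hgrad i).trans ?_
    simp
  · exact (pi_norm_le_iff_of_nonneg (by positivity)).2 hgrad

end Coercivity

theorem OrliczSpace.ofReal_norm_toL1 {α : Type*} [MeasurableSpace α] {Φ : NFunction}
    {μ : Measure α} [IsFiniteMeasure μ] (u : OrliczSpace Φ μ) :
    ENNReal.ofReal ‖toL1 Φ μ u‖ = ∫⁻ x, ‖u x‖ₑ ∂μ := by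
  rw [L1.ofReal_norm_eq_lintegral]
  apply lintegral_congr_ae
  filter_upwards [coeFn_toL1 u] with x hx
  rw [hx]

/-! ### Comparison of a function with its averages at scale ε. -/

section LocalCompactness

variable {n : ℕ} {Ω : Set (EuclideanSpace ℝ (Fin n))} {Φ : NFunction}

/-- The kernel `max (0, ε - |y|)`. -/
noncomputable def tent (ε : ℝ) (y : EuclideanSpace ℝ (Fin n)) : ℝ := max 0 (ε - ‖y‖)

theorem continuous_tent (ε : ℝ) : Continuous (tent (n := n) ε) := by
  unfold tent
  fun_prop

theorem tent_nonneg (ε : ℝ) (y : EuclideanSpace ℝ (Fin n)) : 0 ≤ tent ε y := le_max_left _ _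

theorem norm_lt_of_tent_ne_zero {ε : ℝ} {y : EuclideanSpace ℝ (Fin n)} (h : tent ε y ≠ 0) :
    ‖y‖ < ε := by
  by_contra hne
  exact h (max_eq_left (by linarith))

theorem abs_tent_sub_le (ε : ℝ) (y z : EuclideanSpace ℝ (Fin n)) :
    |tent ε y - tent ε z| ≤ ‖y - z‖ := by
  unfold tent
  rw [max_comm 0, max_comm 0]
  refine (abs_max_sub_max_le_abs _ _ _).trans ?_
  rw [sub_sub_sub_cancel_left, abs_sub_comm]
  exact abs_norm_sub_norm_le _ _

/-- The measure with density `max (0, ε - |y|)`. -/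
noncomputable def tentMeasure (n : ℕ) (ε : ℝ) : Measure (EuclideanSpace ℝ (Fin n)) :=
  volume.withDensity fun y => ENNReal.ofReal (tent ε y)

theorem ae_tentMeasure_norm_lt (ε : ℝ) : ∀ᵐ y ∂tentMeasure n ε, ‖y‖ < ε := by
  refine (ae_withDensity_iff (continuous_tent ε).measurable.ennreal_ofReal).2
    (ae_of_all _ fun y hy => norm_lt_of_tent_ne_zero fun h => hy ?_)
  rw [h, ENNReal.ofReal_zero]

instance {ε : ℝ} : IsFiniteMeasure (tentMeasure n ε) := by
  refine ⟨?_⟩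
  rw [tentMeasure, withDensity_apply _ MeasurableSet.univ, Measure.restrict_univ]
  calc ∫⁻ y, ENNReal.ofReal (tent ε y) ≤ ∫⁻ y in Metric.ball (0 : EuclideanSpace ℝ (Fin n)) ε,
        ENNReal.ofReal |ε| := by
        rw [← lintegral_indicator Metric.isOpen_ball.measurableSet]
        apply lintegral_mono
        intro y
        by_cases hy : y ∈ Metric.ball (0 : EuclideanSpace ℝ (Fin n)) ε
        · simp only [indicator_of_mem hy]
          apply ENNReal.ofReal_le_ofReal
          exact max_le (abs_nonneg _) (by linarith [norm_nonneg y, le_abs_self ε])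
        · simp only [indicator_of_notMem hy]
          have : tent ε y = 0 := by
            by_contra hne
            exact hy (mem_ball_zero_iff.2 (norm_lt_of_tent_ne_zero hne))
          simp [this]
    _ < ⊤ := by
        rw [setLIntegral_const]
        exact ENNReal.mul_lt_top ENNReal.ofReal_lt_top measure_ball_lt_top

theorem tentMeasure_real_univ_pos {ε : ℝ} (hε : 0 < ε) : 0 < (tentMeasure n ε).real univ := by
  apply ENNReal.toReal_pos _ (measure_ne_top _ _)
  rw [tentMeasure, withDensity_apply _ MeasurableSet.univ, Measure.restrict_univ]
  intro h
  rw [lintegral_eq_zero_iff (continuous_tent ε).measurable.ennreal_ofReal] at h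
  have h1 : volume (Metric.ball (0 : EuclideanSpace ℝ (Fin n)) ε) = 0 := by
    refine measure_mono_null (fun y hy => ?_) (ae_iff.1 h)
    have hy : ‖y‖ < ε := mem_ball_zero_iff.1 hy
    have : 0 < tent ε y := lt_max_of_lt_right (by linarith)
    simpa using this
  exact (Metric.measure_ball_pos _ _ hε).ne' h1

theorem integrable_tent_mul {μ : Measure (EuclideanSpace ℝ (Fin n))} (ε : ℝ)
    (x : EuclideanSpace ℝ (Fin n)) {f : EuclideanSpace ℝ (Fin n) → ℝ} (hf : Integrable f μ) :
    Integrable (fun y => tent ε (y - x) * f y) μ := by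
  apply hf.bdd_mul (c := |ε|)
  · exact ((continuous_tent ε).comp (by fun_prop)).aestronglyMeasurable
  · refine ae_of_all _ fun y => ?_
    rw [Real.norm_eq_abs, abs_of_nonneg (tent_nonneg _ _)]
    exact max_le (abs_nonneg _) (by linarith [norm_nonneg (y - x), le_abs_self ε])

/-- The functional `f ↦ ∫ max (0, ε - |y - x|) f(y) dy` on `L¹`. -/
noncomputable def tentAverage (μ : Measure (EuclideanSpace ℝ (Fin n))) (ε : ℝ)
    (x : EuclideanSpace ℝ (Fin n)) : (EuclideanSpace ℝ (Fin n) →₁[μ] ℝ) →L[ℝ] ℝ :=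
  LinearMap.mkContinuous
    { toFun := fun f => ∫ y, tent ε (y - x) * f y ∂μ
      map_add' := fun f g => by
        rw [← integral_add (integrable_tent_mul ε x (L1.integrable_coeFn f))
          (integrable_tent_mul ε x (L1.integrable_coeFn g))]
        apply integral_congr_ae
        filter_upwards [Lp.coeFn_add f g] with y hy
        rw [hy, Pi.add_apply, mul_add]
      map_smul' := fun c f => by
        rw [RingHom.id_apply, ← integral_smul]
        apply integral_congr_ae
        filter_upwards [Lp.coeFn_smul c f] with y hy
        rw [hy, Pi.smul_apply, smul_eq_mul, smul_eq_mul]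
        ring } |ε| (fun f => by
    rw [L1.norm_eq_integral_norm, ← integral_const_mul]
    refine norm_integral_le_of_norm_le ((L1.integrable_coeFn f).norm.const_mul _)
      (ae_of_all _ fun y => ?_)
    rw [norm_mul, Real.norm_eq_abs, abs_of_nonneg (tent_nonneg _ _)]
    gcongr
    exact max_le (abs_nonneg _) (by linarith [norm_nonneg (y - x), le_abs_self ε]))

theorem tentAverage_apply (μ : Measure (EuclideanSpace ℝ (Fin n))) (ε : ℝ)
    (x : EuclideanSpace ℝ (Fin n)) (f : EuclideanSpace ℝ (Fin n) →₁[μ] ℝ) :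
    tentAverage μ ε x f = ∫ y, tent ε (y - x) * f y ∂μ := rfl

theorem abs_tentAverage_le (μ : Measure (EuclideanSpace ℝ (Fin n))) {ε : ℝ} (hε : 0 ≤ ε)
    (x : EuclideanSpace ℝ (Fin n)) (f : EuclideanSpace ℝ (Fin n) →₁[μ] ℝ) :
    |tentAverage μ ε x f| ≤ ε * ‖f‖ := by
  have h1 := (tentAverage μ ε x).le_of_opNorm_le (LinearMap.mkContinuous_norm_le _ (abs_nonneg ε) _) f
  rwa [abs_of_nonneg hε] at h1

/-- The kernel is 1-Lipschitz, so averages of an L¹-bounded family are equicontinuous in x.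
Smallness on a compact set then reduces to finitely many points. -/
theorem abs_tentAverage_sub_le (μ : Measure (EuclideanSpace ℝ (Fin n))) (ε : ℝ)
    (x x' : EuclideanSpace ℝ (Fin n)) (f : EuclideanSpace ℝ (Fin n) →₁[μ] ℝ) :
    |tentAverage μ ε x f - tentAverage μ ε x' f| ≤ ‖x - x'‖ * ‖f‖ := by
  rw [tentAverage_apply, tentAverage_apply,
    ← integral_sub (integrable_tent_mul ε x (L1.integrable_coeFn f))
      (integrable_tent_mul ε x' (L1.integrable_coeFn f)), L1.norm_eq_integral_norm,
    ← integral_const_mul, ← Real.norm_eq_abs]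
  refine norm_integral_le_of_norm_le ((L1.integrable_coeFn f).norm.const_mul _)
    (ae_of_all _ fun y => ?_)
  rw [← sub_mul, norm_mul]
  gcongr
  refine (abs_tent_sub_le _ _ _).trans (le_of_eq ?_)
  rw [sub_sub_sub_cancel_left, norm_sub_rev]

/-- Up to the total mass of the kernel, φ(x) is the weighted average of φ(x + y) minus that of φ(x +
y) - φ(x); the increments are integrals of V along segments of length less than ε. -/
theorem IsC1Closure.measure_mul_enorm_le {φ : EuclideanSpace ℝ (Fin n) → ℝ}
    {V : EuclideanSpace ℝ (Fin n) → EuclideanSpace ℝ (Fin n)} (h : IsC1Closure Ω φ V)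
    (hΩ : IsOpen Ω) (hΩb : Bornology.IsBounded Ω) {ε : ℝ} {x : EuclideanSpace ℝ (Fin n)}
    (hx : ∀ y, ‖y‖ ≤ ε → x + y ∈ Ω) :
    tentMeasure n ε univ * ‖φ x‖ₑ ≤ ‖∫ y in Ω, tent ε (y - x) * φ y‖ₑ +
      ENNReal.ofReal ε * ∫⁻ y, (∫⁻ t in Ioc (0 : ℝ) 1, ‖Ω.indicator V (x + t • y)‖ₑ)
        ∂tentMeasure n ε := by
  obtain ⟨C, hC⟩ := (Metric.isCompact_of_isClosed_isBounded isClosed_closure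
    hΩb.closure).exists_bound_of_continuousOn h.1
  have hφm := h.measurable_indicator_fun hΩ
  have hint : Integrable (fun y => Ω.indicator φ (x + y)) (tentMeasure n ε) := by
    apply Integrable.of_bound (C := |C|) (hφm.comp (measurable_const_add x)).aestronglyMeasurable
    refine ae_of_all _ fun y => ?_
    rw [Function.comp_apply]
    by_cases hy : x + y ∈ Ω
    · rw [indicator_of_mem hy]
      exact (hC _ (subset_closure hy)).trans (le_abs_self _)
    · rw [indicator_of_notMem hy, norm_zero]
      exact abs_nonneg _
  have h1 : ∫ y in Ω, tent ε (y - x) * φ y = ∫ y, Ω.indicator φ (x + y) ∂tentMeasure n ε := by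
    rw [tentMeasure, integral_withDensity_eq_integral_toReal_smul
      (continuous_tent ε).measurable.ennreal_ofReal (ae_of_all _ fun _ => ENNReal.ofReal_lt_top),
      ← integral_indicator hΩ.measurableSet,
      ← integral_add_left_eq_self (fun y => Ω.indicator (fun y => tent ε (y - x) * φ y) y) x]
    congr 1
    funext y
    rw [ENNReal.toReal_ofReal (tent_nonneg _ _), smul_eq_mul]
    by_cases hy : x + y ∈ Ω
    · rw [indicator_of_mem hy, indicator_of_mem hy, add_sub_cancel_left]
    · rw [indicator_of_notMem hy, indicator_of_notMem hy, mul_zero]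
  have h2 : (tentMeasure n ε).real univ * φ x = ∫ y, Ω.indicator φ (x + y) ∂tentMeasure n ε -
      ∫ y, (Ω.indicator φ (x + y) - φ x) ∂tentMeasure n ε := by
    rw [integral_sub hint (integrable_const _), integral_const, smul_eq_mul]
    ring
  have h3 : tentMeasure n ε univ * ‖φ x‖ₑ = ‖(tentMeasure n ε).real univ * φ x‖ₑ := by
    rw [enorm_mul, Real.enorm_of_nonneg measureReal_nonneg, ofReal_measureReal]
  rw [h3, h2, h1]
  refine enorm_sub_le.trans ?_
  gcongr
  rw [← lintegral_const_mul' _ _ ENNReal.ofReal_ne_top]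
  refine (enorm_integral_le_lintegral_enorm _).trans (lintegral_mono_ae ?_)
  filter_upwards [ae_tentMeasure_norm_lt ε] with y hy
  rw [indicator_of_mem (hx y hy.le)]
  refine (h.enorm_apply_add_sub_le fun t ht => hx _ ?_).trans ?_
  · rw [norm_smul, Real.norm_eq_abs, abs_of_nonneg ht.1]
    nlinarith [ht.2, norm_nonneg y]
  · gcongr
    rw [← ofReal_norm]
    exact ENNReal.ofReal_le_ofReal hy.le

theorem IsC1Closure.measure_mul_lintegral_le {φ : EuclideanSpace ℝ (Fin n) → ℝ}
    {V : EuclideanSpace ℝ (Fin n) → EuclideanSpace ℝ (Fin n)} (h : IsC1Closure Ω φ V)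
    (hΩ : IsOpen Ω) (hΩb : Bornology.IsBounded Ω) {ε M : ℝ} {K : Set (EuclideanSpace ℝ (Fin n))}
    (hK : MeasurableSet K) (hKΩ : ∀ x ∈ K, ∀ y, ‖y‖ ≤ ε → x + y ∈ Ω)
    (hM : ∀ x ∈ K, |∫ y in Ω, tent ε (y - x) * φ y| ≤ M) :
    tentMeasure n ε univ * ∫⁻ x in K, ‖φ x‖ₑ ≤ ENNReal.ofReal M * volume K +
      ENNReal.ofReal ε * (tentMeasure n ε univ * ∫⁻ x in Ω, ‖V x‖ₑ) := by
  have hV := h.measurable_indicator_grad hΩ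
  have hVΩ : ∫⁻ x in Ω, ‖V x‖ₑ = ∫⁻ x, ‖Ω.indicator V x‖ₑ := by
    rw [← lintegral_indicator hΩ.measurableSet]
    simp_rw [enorm_indicator_eq_indicator_enorm]
  rw [hVΩ, ← lintegral_lintegral_translate _ hV.enorm,
    ← lintegral_const_mul' _ _ (measure_ne_top _ _),
    ← lintegral_const_mul' _ _ ENNReal.ofReal_ne_top, ← setLIntegral_const]
  calc _ ≤ ∫⁻ x in K, (ENNReal.ofReal M + ENNReal.ofReal ε *
        ∫⁻ y, (∫⁻ t in Ioc (0 : ℝ) 1, ‖Ω.indicator V (x + t • y)‖ₑ) ∂tentMeasure n ε) := by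
        apply setLIntegral_mono' hK
        intro x hx
        refine (h.measure_mul_enorm_le hΩ hΩb (hKΩ x hx)).trans ?_
        gcongr
        rw [Real.enorm_eq_ofReal_abs]
        exact ENNReal.ofReal_le_ofReal (hM x hx)
    _ ≤ _ := by
        rw [lintegral_add_left measurable_const]
        gcongr
        exact Measure.restrict_le_self

end LocalCompactness

/-! ### From weak convergence in W¹_Φ to convergence almost everywhere. -/

section WeakToStrong

variable {n : ℕ} {Ω : Set (EuclideanSpace ℝ (Fin n))} {Φ : NFunction}

theorem OrliczSpace.setIntegral_norm_le_add {α : Type*} [MeasurableSpace α] {Φ : NFunction}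
    {μ : Measure α} [IsFiniteMeasure μ] (u v : OrliczSpace Φ μ) (K : Set α) :
    ∫ x in K, ‖u x‖ ∂μ ≤ ∫ x in K, ‖v x‖ ∂μ + ‖toL1 Φ μ (u - v)‖ := by
  calc ∫ x in K, ‖u x‖ ∂μ ≤ ∫ x in K, (‖v x‖ + ‖(u - v) x‖) ∂μ := by
        apply integral_mono_ae u.integrable.norm.integrableOn
          (v.integrable.norm.add (u - v).integrable.norm).integrableOn
        filter_upwards [ae_restrict_of_ae (coeFn_sub u v)] with x hx
        rw [Pi.add_apply, hx, Pi.sub_apply]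
        exact norm_le_norm_add_norm_sub' (u x) (v x)
    _ = ∫ x in K, ‖v x‖ ∂μ + ∫ x in K, ‖(u - v) x‖ ∂μ :=
        integral_add v.integrable.norm.integrableOn (u - v).integrable.norm.integrableOn
    _ ≤ _ := by
        rw [norm_toL1]
        refine add_le_add le_rfl ?_
        exact setIntegral_le_integral (u - v).integrable.norm (ae_of_all _ fun x => norm_nonneg _)

variable [IsFiniteMeasure (volume.restrict Ω)]

theorem measure_mul_integral_le_of_smooth (hΩ : IsOpen Ω) (hΩb : Bornology.IsBounded Ω)
    {ε M : ℝ} (hε : 0 ≤ ε) (hM0 : 0 ≤ M) {K : Set (EuclideanSpace ℝ (Fin n))}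
    (hK : IsCompact K) (hKΩ : ∀ x ∈ K, ∀ y, ‖y‖ ≤ ε → x + y ∈ Ω)
    {w : OrliczJet Φ Ω} (hw : w ∈ smoothJets Φ Ω)
    (hM : ∀ x ∈ K, |tentAverage (volume.restrict Ω) ε x (OrliczSpace.toL1 Φ _ w.1)| ≤ M) :
    (tentMeasure n ε).real univ * ∫ x in K, ‖w.1 x‖ ∂volume.restrict Ω ≤ M * volume.real K +
      ε * ((tentMeasure n ε).real univ * ∑ i, ‖OrliczSpace.toL1 Φ _ (w.2 i)‖) := by
  obtain ⟨φ, V, h, hφ, hV⟩ := hw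
  have hsub : K ⊆ Ω := fun x hx => by simpa using hKΩ x hx 0 (by simpa using hε)
  have hmain := h.measure_mul_lintegral_le hΩ hΩb (M := M) hK.measurableSet hKΩ (fun x hx => by
    convert hM x hx using 2
    rw [tentAverage_apply]
    apply integral_congr_ae
    filter_upwards [hφ, OrliczSpace.coeFn_toL1 w.1] with y h1 h2
    rw [h2, h1])
  have hI : ENNReal.ofReal (∫ x in K, ‖w.1 x‖ ∂volume.restrict Ω) = ∫⁻ x in K, ‖φ x‖ₑ := by
    rw [ofReal_integral_norm_eq_lintegral_enorm w.1.integrable.integrableOn,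
      Measure.restrict_restrict_of_subset hsub]
    apply lintegral_congr_ae
    filter_upwards [ae_restrict_of_ae_restrict_of_subset hsub hφ] with x hx
    rw [hx]
  have hVle : ∫⁻ x in Ω, ‖V x‖ₑ ≤ ENNReal.ofReal (∑ i, ‖OrliczSpace.toL1 Φ _ (w.2 i)‖) := by
    rw [ENNReal.ofReal_sum_of_nonneg fun i _ => norm_nonneg _]
    simp_rw [OrliczSpace.ofReal_norm_toL1]
    rw [← lintegral_finsetSum _ fun i _ => (w.2 i).measurable.enorm]
    apply lintegral_mono_ae
    filter_upwards [ae_all_iff.2 hV] with x hx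
    simp_rw [hx, Real.enorm_eq_ofReal_abs]
    rw [← ENNReal.ofReal_sum_of_nonneg fun i _ => abs_nonneg _, ← ofReal_norm]
    exact ENNReal.ofReal_le_ofReal (EuclideanSpace.norm_le_sum_abs _)
  rw [← ENNReal.ofReal_le_ofReal_iff (by positivity), ENNReal.ofReal_mul measureReal_nonneg,
    ENNReal.ofReal_add (by positivity) (by positivity), ENNReal.ofReal_mul hM0,
    ENNReal.ofReal_mul hε, ENNReal.ofReal_mul measureReal_nonneg, hI, ofReal_measureReal,
    ofReal_measureReal hK.measure_lt_top.ne]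
  exact hmain.trans (by gcongr)

theorem measure_mul_integral_le (hΩ : IsOpen Ω) (hΩb : Bornology.IsBounded Ω)
    {ε M : ℝ} (hε : 0 ≤ ε) (hM0 : 0 ≤ M) {K : Set (EuclideanSpace ℝ (Fin n))}
    (hK : IsCompact K) (hKΩ : ∀ x ∈ K, ∀ y, ‖y‖ ≤ ε → x + y ∈ Ω)
    {w : OrliczJet Φ Ω} (hw : w ∈ (smoothJets Φ Ω).topologicalClosure)
    (hM : ∀ x ∈ K, |tentAverage (volume.restrict Ω) ε x (OrliczSpace.toL1 Φ _ w.1)| ≤ M) :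
    (tentMeasure n ε).real univ * ∫ x in K, ‖w.1 x‖ ∂volume.restrict Ω ≤ M * volume.real K +
      ε * ((tentMeasure n ε).real univ * ∑ i, ‖OrliczSpace.toL1 Φ _ (w.2 i)‖) := by
  obtain ⟨z, hz, hzw⟩ := mem_closure_iff_seq_limit.1 hw
  set T := OrliczSpace.toL1 Φ (volume.restrict Ω)
  set c := (tentMeasure n ε).real univ
  -- R z is the bound that a smooth z near w gives for w: the averages of z are bounded by M only up
  -- to ε ‖z₁ - w₁‖₁, and replacing w by z on the left costs c ‖w₁ - z₁‖₁. R is continuous, and R w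
  -- is the claim.
  let R : OrliczJet Φ Ω → ℝ := fun z => (M + ε * ‖T (z.1 - w.1)‖) * volume.real K +
    ε * (c * ∑ i, ‖T (z.2 i)‖) + c * ‖T (w.1 - z.1)‖
  have hR : Continuous R := by
    have h1 : ∀ i : Fin n, Continuous fun z : OrliczJet Φ Ω => T (z.2 i) := fun i =>
      T.continuous.comp ((continuous_apply i).comp continuous_snd)
    have h2 : Continuous fun z : OrliczJet Φ Ω => T (z.1 - w.1) :=
      T.continuous.comp (continuous_fst.sub continuous_const)
    have h3 : Continuous fun z : OrliczJet Φ Ω => T (w.1 - z.1) :=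
      T.continuous.comp (continuous_const.sub continuous_fst)
    fun_prop
  have hRw : R w = M * volume.real K + ε * (c * ∑ i, ‖T (w.2 i)‖) := by simp [R]
  rw [← hRw]
  refine ge_of_tendsto' ((hR.tendsto w).comp hzw) fun k => ?_
  have h1 := measure_mul_integral_le_of_smooth hΩ hΩb hε
    (M := M + ε * ‖T ((z k).1 - w.1)‖) (by positivity) hK hKΩ (hz k) (fun x hx => by
      have e1 := abs_tentAverage_le (volume.restrict Ω) hε x (T ((z k).1 - w.1))
      have e2 := hM x hx
      have e3 : tentAverage (volume.restrict Ω) ε x (T (z k).1) =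
          tentAverage (volume.restrict Ω) ε x (T w.1) +
          tentAverage (volume.restrict Ω) ε x (T ((z k).1 - w.1)) := by
        rw [map_sub, map_sub]
        ring
      rw [e3]
      exact (abs_add_le _ _).trans (add_le_add e2 e1))
  have h2 := mul_le_mul_of_nonneg_left (OrliczSpace.setIntegral_norm_le_add w.1 (z k).1 K)
    (measureReal_nonneg : 0 ≤ c)
  simp only [Function.comp, R]
  linarith

/-- Weak convergence of a bounded family in `W¹_Φ(Ω)` implies convergence in `L¹` on compact
subsets. -/
theorem tendsto_integral_of_weakLim (hΩ : IsOpen Ω) (hΩb : Bornology.IsBounded Ω) {ι : Type*}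
    {U : Filter ι} {u : ι → OrliczSobolev Φ Ω} {u₀ : OrliczSobolev Φ Ω} (h : WeakLim U u u₀)
    {M : ℝ} (hM : ∀ i, ‖u i‖ ≤ M) {K : Set (EuclideanSpace ℝ (Fin n))} (hK : IsCompact K)
    (hKΩ : K ⊆ Ω) {δ : ℝ} (hδ : 0 < δ) :
    ∀ᶠ i in U, ∫ x in K, ‖(u i - u₀).1.1 x‖ ∂volume.restrict Ω < δ := by
  set T := OrliczSpace.toL1 Φ (volume.restrict Ω)
  set D := |M| + ‖u₀‖ with hD
  have hD0 : 0 ≤ D := by positivity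
  have hw : ∀ i, ‖(u i - u₀).1‖ ≤ D := fun i =>
    (norm_sub_le (u i) u₀).trans (by linarith [hM i, le_abs_self M])
  have hT1 : ∀ i, ‖T (u i - u₀).1.1‖ ≤ ‖T‖ * D := fun i =>
    (T.le_opNorm _).trans (by gcongr; exact (norm_fst_le _).trans (hw i))
  have hT2 : ∀ i j, ‖T ((u i - u₀).1.2 j)‖ ≤ ‖T‖ * D := fun i j =>
    (T.le_opNorm _).trans (by
      gcongr
      exact (norm_le_pi_norm _ j).trans ((norm_snd_le _).trans (hw i)))
  obtain ⟨ε₀, hε₀, hsub⟩ := hK.exists_cthickening_subset_open hΩ hKΩ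
  have hL : 0 ≤ n * (‖T‖ * D) := by positivity
  -- The scale keeps the ε-neighbourhood of K inside Ω and the gradient contribution below c δ/2.
  set ε := min ε₀ (δ / (2 * (n * (‖T‖ * D) + 1))) with hε
  have hε0 : 0 < ε := lt_min hε₀ (by positivity)
  have hεδ : ε * (n * (‖T‖ * D)) < δ / 2 := by
    have h1 : ε * (2 * (n * (‖T‖ * D) + 1)) ≤ δ := by
      rw [← le_div_iff₀ (by positivity)]
      exact min_le_right _ _
    nlinarith
  set c := (tentMeasure n ε).real univ with hc
  have hc0 : 0 < c := tentMeasure_real_univ_pos hε0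
  have hKv : 0 ≤ volume.real K := measureReal_nonneg
  -- Averages bounded by N on K contribute at most c δ/2.
  set N := c * δ / (2 * (volume.real K + 1)) with hN
  have hN0 : 0 < N := by positivity
  have hNK : N * volume.real K ≤ c * (δ / 2) := by
    rw [hN, div_mul_eq_mul_div, div_le_iff₀ (by positivity)]
    nlinarith [mul_pos hc0 hδ]
  -- On a net of mesh η, the Lipschitz bound costs at most N/2 between a point of K and its centre.
  -- Weak convergence makes the averages at the finitely many centres less than N/2.
  set η := N / (2 * (‖T‖ * D + 1)) with hη
  have hTD : 0 ≤ ‖T‖ * D := by positivity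
  have hη0 : 0 < η := by positivity
  obtain ⟨t, -, htf, hcover⟩ := hK.finite_cover_balls hη0
  have hev : ∀ᶠ i in U, ∀ x ∈ t,
      |tentAverage (volume.restrict Ω) ε x (T (u i - u₀).1.1)| < N / 2 := by
    rw [eventually_all_finite htf]
    intro x _
    let l : OrliczSobolev Φ Ω →L[ℝ] ℝ := (tentAverage (volume.restrict Ω) ε x).comp
      (T.comp ((ContinuousLinearMap.fst ℝ _ _).comp (Submodule.subtypeL _)))
    have h1 := (h l).sub_const (l u₀)
    rw [sub_self] at h1
    have h2 := h1.abs
    rw [abs_zero] at h2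
    filter_upwards [h2.eventually (gt_mem_nhds (half_pos hN0))] with i hi
    rwa [← map_sub] at hi
  filter_upwards [hev] with i hi
  have hbound : ∀ x ∈ K, |tentAverage (volume.restrict Ω) ε x (T (u i - u₀).1.1)| ≤ N := by
    intro x hx
    obtain ⟨y, hy, hxy⟩ := mem_iUnion₂.1 (hcover hx)
    have h1 := abs_tentAverage_sub_le (volume.restrict Ω) ε x y (T (u i - u₀).1.1)
    have h2 := hi y hy
    have h3 : ‖x - y‖ * ‖T (u i - u₀).1.1‖ ≤ η * (‖T‖ * D) := by
      gcongr
      · rw [← dist_eq_norm]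
        exact (Metric.mem_ball.1 hxy).le
      · exact hT1 i
    have h4 : η * (‖T‖ * D) ≤ N / 2 := by
      rw [hη, div_mul_eq_mul_div, div_le_iff₀ (by positivity)]
      nlinarith
    have h5 := abs_sub_abs_le_abs_sub (tentAverage (volume.restrict Ω) ε x (T (u i - u₀).1.1))
      (tentAverage (volume.restrict Ω) ε y (T (u i - u₀).1.1))
    linarith
  have hfin := measure_mul_integral_le hΩ hΩb hε0.le hN0.le hK (fun x hx y hy => by
    apply hsub
    apply Metric.mem_cthickening_of_dist_le (x + y) x _ _ hx
    rw [dist_eq_norm, add_sub_cancel_left]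
    exact hy.trans (min_le_left _ _)) (u i - u₀).2 hbound
  have hsum : ∑ j, ‖T ((u i - u₀).1.2 j)‖ ≤ n * (‖T‖ * D) := by
    refine (Finset.sum_le_sum fun j _ => hT2 i j).trans (by simp)
  have h6 : ε * (c * ∑ j, ‖T ((u i - u₀).1.2 j)‖) ≤ c * (ε * (n * (‖T‖ * D))) := by
    calc _ ≤ ε * (c * (n * (‖T‖ * D))) := by gcongr
      _ = _ := by ring
  have h7 : c * (ε * (n * (‖T‖ * D))) < c * (δ / 2) := by gcongr
  have h8 : c * ∫ x in K, ‖(u i - u₀).1.1 x‖ ∂volume.restrict Ω < c * δ := by linarith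
  exact lt_of_mul_lt_mul_left h8 hc0.le

/-- A bounded family in `W¹_Φ(Ω)` with a weak limit along a filter contains a sequence, with indices
in any given set of the filter, that converges to this limit almost everywhere. -/
theorem exists_seq_tendsto_ae_of_weakLim (hΩ : IsOpen Ω) (hΩb : Bornology.IsBounded Ω)
    {ι : Type*} {U : Filter ι} [U.NeBot] {u : ι → OrliczSobolev Φ Ω} {u₀ : OrliczSobolev Φ Ω}
    (h : WeakLim U u u₀) {M : ℝ} (hM : ∀ i, ‖u i‖ ≤ M) {p : ι → Prop} (hp : ∀ᶠ i in U, p i) :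
    ∃ σ : ℕ → ι, (∀ m, p (σ m)) ∧
      ∀ᵐ x ∂volume.restrict Ω, Tendsto (fun m => (u (σ m)).fn x) atTop (𝓝 (u₀.fn x)) := by
  obtain ⟨K, hKc, hKΩ, hKU, hKm⟩ := hΩ.exists_iUnion_isClosed
  have hKcomp : ∀ m, IsCompact (K m) := fun m =>
    Metric.isCompact_of_isClosed_isBounded (hKc m) (hΩb.subset (hKΩ m))
  -- The filter need not have a countable basis, so the sequence is built by hand: on the m-th set
  -- of an exhaustion of Ω the L¹ distance is below 2^(-m). The distances are summable, which forces
  -- convergence almost everywhere on each fixed set.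
  choose σ hσ using fun m : ℕ => (hp.and (tendsto_integral_of_weakLim hΩ hΩb h hM (hKcomp m)
    (hKΩ m) (by positivity : (0 : ℝ) < (1 / 2) ^ m))).exists
  refine ⟨σ, fun m => (hσ m).1, ?_⟩
  have hmeas : ∀ m, Measurable ((K m).indicator fun x => ‖(u (σ m) - u₀).1.1 x‖ₑ) := fun m =>
    (u (σ m) - u₀).1.1.measurable.enorm.indicator (hKc m).measurableSet
  have hsum : ∫⁻ x in Ω, ∑' m, (K m).indicator (fun x => ‖(u (σ m) - u₀).1.1 x‖ₑ) x ≠ ⊤ := by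
    rw [lintegral_tsum fun m => (hmeas m).aemeasurable]
    refine ne_top_of_le_ne_top (b := ∑' m : ℕ, ENNReal.ofReal ((1 / 2) ^ m)) ?_ ?_
    · exact (summable_geometric_two).tsum_ofReal_ne_top
    · refine ENNReal.tsum_le_tsum fun m => ?_
      rw [lintegral_indicator (hKc m).measurableSet, ← ofReal_integral_norm_eq_lintegral_enorm
        (u (σ m) - u₀).1.1.integrable.integrableOn]
      exact ENNReal.ofReal_le_ofReal (hσ m).2.le
  have hdiff : ∀ m, ∀ᵐ x ∂volume.restrict Ω, (u (σ m) - u₀).1.1 x =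
      (u (σ m)).fn x - u₀.fn x := fun m => OrliczSpace.coeFn_sub (u (σ m)).1.1 u₀.1.1
  filter_upwards [ae_lt_top (Measurable.tsum hmeas) hsum, ae_all_iff.2 hdiff,
    ae_restrict_mem hΩ.measurableSet] with x hx hd hxΩ
  have h1 := ENNReal.tendsto_atTop_zero_of_tsum_ne_top hx.ne
  rw [← hKU] at hxΩ
  obtain ⟨j, hj⟩ := mem_iUnion.1 hxΩ
  rw [tendsto_iff_edist_tendsto_0]
  refine h1.congr' ?_
  filter_upwards [eventually_ge_atTop j] with m hm
  rw [indicator_of_mem (hKm hm hj), hd m, edist_eq_enorm_sub]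

end WeakToStrong

/-! ### Weak limits in products and subspaces. -/

section WeakLimExtend

variable {ι E : Type*} [NormedAddCommGroup E] [NormedSpace ℝ E] {U : Filter ι}

theorem WeakLim.sum {κ : Type*} (s : Finset κ) {w : κ → ι → E} {w₀ : κ → E}
    (h : ∀ j ∈ s, WeakLim U (w j) (w₀ j)) :
    WeakLim U (fun i => ∑ j ∈ s, w j i) (∑ j ∈ s, w₀ j) := fun l => by
  simp only [map_sum]
  exact tendsto_finsetSum s fun j hj => h j hj l

theorem WeakLim.prod_pi {F : Type*} [NormedAddCommGroup F] [NormedSpace ℝ F] {n : ℕ}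
    {w : ι → F × (Fin n → E)} {a : F} {b : Fin n → E} (ha : WeakLim U (fun i => (w i).1) a)
    (hb : ∀ j, WeakLim U (fun i => (w i).2 j) (b j)) : WeakLim U w (a, b) := by
  have h1 := (ha.map (ContinuousLinearMap.inl ℝ F (Fin n → E))).add
    (WeakLim.sum Finset.univ fun j _ => (hb j).map ((ContinuousLinearMap.inr ℝ F (Fin n → E)).comp
      (ContinuousLinearMap.single ℝ (fun _ : Fin n => E) j)))
  have key : ∀ (x : F) (y : Fin n → E), ContinuousLinearMap.inl ℝ F (Fin n → E) x +
      ∑ j, ((ContinuousLinearMap.inr ℝ F (Fin n → E)).comp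
        (ContinuousLinearMap.single ℝ (fun _ : Fin n => E) j)) (y j) = (x, y) := by
    intro x y
    simp only [ContinuousLinearMap.comp_apply, ← map_sum, ContinuousLinearMap.single_apply,
      Finset.univ_sum_single]
    simp
  simp only [key] at h1
  exact h1

/-- Functionals on the subspace extend by Hahn–Banach. -/
theorem WeakLim.of_subtype {p : Submodule ℝ E} {w : ι → p} {w₀ : p}
    (h : WeakLim U (fun i => (w i : E)) (w₀ : E)) : WeakLim U w w₀ := fun l => by
  obtain ⟨g, hg, -⟩ := _root_.exists_extension_norm_eq p l
  simpa only [hg] using h g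

end WeakLimExtend

/-! ### Lower semicontinuity of the two energy terms. -/

section Functionals

variable {n : ℕ} {Ω : Set (EuclideanSpace ℝ (Fin n))} {Φ : NFunction}

/-- Bounded families in `W¹_Φ(Ω)` have weak limits along ultrafilters. -/
theorem OrliczSobolev.exists_weakLim [IsFiniteMeasure (volume.restrict Ω)] (hΦ : DeltaTwo Φ)
    (hΨ : DeltaTwo Φ.compl) {ι : Type*} (U : Ultrafilter ι) (u : ι → OrliczSobolev Φ Ω) {M : ℝ}
    (hM : ∀ i, ‖u i‖ ≤ M) : ∃ u₀, WeakLim (U : Filter ι) u u₀ := by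
  have hM' : ∀ i, ‖(u i).1‖ ≤ M := hM
  obtain ⟨a, ha⟩ := OrliczSpace.exists_weakLim hΦ hΨ U (fun i => (u i).1.1)
    fun i => (norm_fst_le _).trans (hM' i)
  choose b hb using fun j => OrliczSpace.exists_weakLim hΦ hΨ U (fun i => (u i).1.2 j)
    fun i => (norm_le_pi_norm _ j).trans ((norm_snd_le _).trans (hM' i))
  have h : WeakLim (U : Filter ι) (fun i => (u i).1) (a, b) := WeakLim.prod_pi ha hb
  -- The Sobolev space is a closed subspace of the space of jets, hence weakly closed: the weak
  -- limit of the gradients is the gradient of the weak limit.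
  have hmem : (a, b) ∈ (smoothJets Φ Ω).topologicalClosure :=
    h.mem_of_convex (S := (smoothJets Φ Ω).topologicalClosure) (Submodule.convex _)
      (Submodule.isClosed_topologicalClosure _) (Eventually.of_forall fun i => (u i).2)
  exact ⟨⟨(a, b), hmem⟩, WeakLim.of_subtype h⟩

/-- This is e = e⁺ - e⁻ shifted by b, arranged without subtraction so that it can be integrated in
`ℝ≥0∞`. -/
theorem EReal.toENNReal_add_ofReal {e : EReal} {b : ℝ} (hb : 0 ≤ b) (h : ((-b : ℝ) : EReal) ≤ e) :
    e.toENNReal + ENNReal.ofReal b = (e + b).toENNReal + (-e).toENNReal := by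
  induction e with
  | bot => simp at h
  | top => simp
  | coe r =>
    have h : -b ≤ r := EReal.coe_le_coe_iff.1 h
    rw [← EReal.coe_add, ← EReal.coe_neg, EReal.real_coe_toENNReal, EReal.real_coe_toENNReal,
      EReal.real_coe_toENNReal]
    rcases le_total 0 r with hr | hr
    · rw [ENNReal.ofReal_of_nonpos (by linarith : -r ≤ 0), add_zero, ENNReal.ofReal_add hr hb]
    · rw [ENNReal.ofReal_of_nonpos hr, zero_add, ← ENNReal.ofReal_add (by linarith) (by linarith)]
      congr 1
      ring

section ExtIntegral

variable {α : Type*} [MeasurableSpace α] {μ : Measure α} {b : α → ℝ}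

/-- Adding the integrable function b reduces the extended integral to that of a nonnegative
function. The integral of the negative part is at most that of b, hence finite, and cancels. -/
theorem extIntegral_add_integral {h : α → EReal} (hm : AEMeasurable h μ) (hb : Integrable b μ)
    (hb0 : ∀ x, 0 ≤ b x) (hle : ∀ᵐ x ∂μ, ((-b x : ℝ) : EReal) ≤ h x) :
    extIntegral μ h + ((∫ x, b x ∂μ : ℝ) : EReal) =
      ((∫⁻ x, (h x + b x).toENNReal ∂μ : ℝ≥0∞) : EReal) := by
  have hbe : ENNReal.ofReal (∫ x, b x ∂μ) = ∫⁻ x, ENNReal.ofReal (b x) ∂μ :=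
    ofReal_integral_eq_lintegral_ofReal hb (ae_of_all _ hb0)
  have hneg : ∫⁻ x, (-h x).toENNReal ∂μ ≤ ∫⁻ x, ENNReal.ofReal (b x) ∂μ := by
    apply lintegral_mono_ae
    filter_upwards [hle] with x hx
    rw [← EReal.real_coe_toENNReal]
    apply EReal.toENNReal_le_toENNReal
    rwa [EReal.neg_le, ← EReal.coe_neg]
  have hfin : ∫⁻ x, (-h x).toENNReal ∂μ ≠ ⊤ :=
    (hneg.trans_lt (hbe ▸ ENNReal.ofReal_lt_top)).ne
  have hsum : ∫⁻ x, (h x).toENNReal ∂μ + ENNReal.ofReal (∫ x, b x ∂μ) =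
      ∫⁻ x, (h x + b x).toENNReal ∂μ + ∫⁻ x, (-h x).toENNReal ∂μ := by
    have hnm : AEMeasurable (fun x => (-h x).toENNReal) μ :=
      (measurable_ereal_toENNReal.comp continuous_neg.measurable).comp_aemeasurable hm
    rw [hbe, ← lintegral_add_left' hm.ereal_toENNReal, ← lintegral_add_right' _ hnm]
    apply lintegral_congr_ae
    filter_upwards [hle] with x hx
    exact EReal.toENNReal_add_ofReal (hb0 x) hx
  have hB : ((∫ x, b x ∂μ : ℝ) : EReal) = ((ENNReal.ofReal (∫ x, b x ∂μ) : ℝ≥0∞) : EReal) := by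
    rw [EReal.coe_ennreal_ofReal, max_eq_left (integral_nonneg hb0)]
  rw [hB, extIntegral]
  lift ∫⁻ x, (-h x).toENNReal ∂μ to NNReal using hfin with N
  have h1 := congrArg (fun x : ℝ≥0∞ => (x : EReal)) hsum
  simp only [EReal.coe_ennreal_add] at h1
  have h2 : ((N : ℝ≥0∞) : EReal) = ((N : ℝ) : EReal) := rfl
  rw [h2] at h1 ⊢
  rw [sub_eq_add_neg, add_right_comm, h1, ← sub_eq_add_neg, EReal.add_sub_cancel_right]

theorem extIntegral_eq_sub {h : α → EReal} (hm : AEMeasurable h μ) (hb : Integrable b μ)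
    (hb0 : ∀ x, 0 ≤ b x) (hle : ∀ᵐ x ∂μ, ((-b x : ℝ) : EReal) ≤ h x) :
    extIntegral μ h = ((∫⁻ x, (h x + b x).toENNReal ∂μ : ℝ≥0∞) : EReal) -
      ((∫ x, b x ∂μ : ℝ) : EReal) := by
  rw [← extIntegral_add_integral hm hb hb0 hle, EReal.add_sub_cancel_right]

theorem neg_integral_le_extIntegral {h : α → EReal} (hm : AEMeasurable h μ) (hb : Integrable b μ)
    (hb0 : ∀ x, 0 ≤ b x) (hle : ∀ᵐ x ∂μ, ((-b x : ℝ) : EReal) ≤ h x) :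
    ((-∫ x, b x ∂μ : ℝ) : EReal) ≤ extIntegral μ h := by
  rw [extIntegral_eq_sub hm hb hb0 hle, EReal.coe_neg, ← zero_sub]
  exact EReal.sub_le_sub (EReal.coe_ennreal_nonneg _) le_rfl

/-- Fatou's lemma for extended real integrals. -/
theorem extIntegral_le_of_le_liminf {h : ℕ → α → EReal} {h₀ : α → EReal}
    (hm : ∀ m, AEMeasurable (h m) μ) (hm₀ : AEMeasurable h₀ μ) (hb : Integrable b μ)
    (hb0 : ∀ x, 0 ≤ b x) (hle : ∀ m, ∀ᵐ x ∂μ, ((-b x : ℝ) : EReal) ≤ h m x)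
    (hle₀ : ∀ᵐ x ∂μ, ((-b x : ℝ) : EReal) ≤ h₀ x)
    (hlim : ∀ᵐ x ∂μ, h₀ x ≤ liminf (fun m => h m x) atTop) {c : EReal}
    (hc : ∀ m, extIntegral μ (h m) ≤ c) : extIntegral μ h₀ ≤ c := by
  rw [extIntegral_eq_sub hm₀ hb hb0 hle₀]
  apply EReal.sub_le_of_le_add
  set β := ((∫ x, b x ∂μ : ℝ) : EReal)
  have hP : ∀ m, ((∫⁻ x, (h m x + b x).toENNReal ∂μ : ℝ≥0∞) : EReal) ≤ c + β := fun m => by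
    rw [← extIntegral_add_integral (hm m) hb hb0 (hle m)]
    exact add_le_add (hc m) le_rfl
  have hc0 : 0 ≤ c + β := (EReal.coe_ennreal_nonneg _).trans (hP 0)
  rw [← EReal.coe_toENNReal hc0, EReal.coe_ennreal_le_coe_ennreal_iff]
  have hP' : ∀ m, ∫⁻ x, (h m x + b x).toENNReal ∂μ ≤ (c + β).toENNReal := fun m => by
    rw [← EReal.coe_ennreal_le_coe_ennreal_iff, EReal.coe_toENNReal hc0]
    exact hP m
  calc ∫⁻ x, (h₀ x + b x).toENNReal ∂μ
      ≤ ∫⁻ x, liminf (fun m => (h m x + b x).toENNReal) atTop ∂μ := by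
        apply lintegral_mono_ae
        filter_upwards [hlim] with x hx
        -- The shift e ↦ (e + b(x))⁺ is monotone and continuous, so it commutes with the liminf and
        -- Fatou's lemma for nonnegative functions applies.
        have hmono : Monotone fun e : EReal => (e + b x).toENNReal := fun e e' hee =>
          EReal.toENNReal_le_toENNReal (add_le_add hee le_rfl)
        have hcont : Continuous fun e : EReal => (e + b x).toENNReal := by
          apply EReal.continuous_toENNReal.comp
          rw [continuous_iff_continuousAt]
          intro e
          exact (EReal.continuousAt_add (p := (e, (b x : EReal))) (Or.inr (by simp))
            (Or.inr (by simp))).comp (f := fun e : EReal => (e, (b x : EReal))) (by fun_prop)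
        exact (hmono hx).trans (hmono.map_liminf_of_continuousAt _ hcont.continuousAt).le
    _ ≤ liminf (fun m => ∫⁻ x, (h m x + b x).toENNReal ∂μ) atTop := by
        apply lintegral_liminf_le'
        intro m
        exact ((hm m).add hb.aemeasurable.coe_real_ereal).ereal_toENNReal
    _ ≤ (c + β).toENNReal :=
        liminf_le_of_frequently_le' (Eventually.frequently (Eventually.of_forall hP'))

end ExtIntegral

/-- Carathéodory's argument: for simple q the composition is a finite sum of measurable pieces, and
continuity in the second variable passes to the limit. -/
theorem aemeasurable_comp_of_continuous {α E : Type*} [MeasurableSpace α] {μ : Measure α}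
    [TopologicalSpace E] [MeasurableSpace E] [TopologicalSpace.PseudoMetrizableSpace E]
    [SecondCountableTopology E] [OpensMeasurableSpace E] {f : α → E → ℝ}
    (hf : ∀ p, AEMeasurable (fun x => f x p) μ) (hc : ∀ᵐ x ∂μ, Continuous (f x)) {q : α → E}
    (hq : Measurable q) : AEMeasurable (fun x => f x (q x)) μ := by
  have hq' := hq.stronglyMeasurable
  have hs : ∀ s : SimpleFunc α E, AEMeasurable (fun x => f x (s x)) μ := by
    intro s
    have : (fun x => f x (s x)) =
        fun x => ∑ p ∈ s.range, (s ⁻¹' {p}).indicator (fun x => f x p) x := by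
      funext x
      rw [Finset.sum_eq_single (s x)]
      · simp
      · intro p _ hp
        exact indicator_of_notMem (fun h => hp h.symm) _
      · intro h
        exact absurd (s.mem_range_self x) h
    rw [this]
    exact Finset.aemeasurable_fun_sum _ fun p _ => (hf p).indicator (s.measurableSet_fiber p)
  refine aemeasurable_of_tendsto_metrizable_ae atTop (fun m => hs (hq'.approx m)) ?_
  filter_upwards [hc] with x hx
  exact (hx.tendsto _).comp (hq'.tendsto_approx x)

theorem OrliczSobolev.measurable_grad (u : OrliczSobolev Φ Ω) : Measurable u.grad :=
  (PiLp.continuous_toLp 2 _).measurable.comp (measurable_pi_lambda _ fun i => (u.1.2 i).measurable)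

theorem OrliczSobolev.grad_add_ae (u v : OrliczSobolev Φ Ω) (a b : ℝ) :
    (a • u + b • v).grad =ᵐ[volume.restrict Ω] fun x => a • u.grad x + b • v.grad x := by
  have h : ∀ i, ∀ᵐ x ∂volume.restrict Ω,
      (a • u + b • v).1.2 i x = a * u.1.2 i x + b * v.1.2 i x := fun i => by
    filter_upwards [OrliczSpace.coeFn_add (a • u.1.2 i) (b • v.1.2 i),
      OrliczSpace.coeFn_smul a (u.1.2 i), OrliczSpace.coeFn_smul b (v.1.2 i)] with x h1 h2 h3
    rw [Pi.add_apply, h2, h3] at h1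
    exact h1
  filter_upwards [ae_all_iff.2 h] with x hx
  ext i
  exact hx i

/-- The L¹ norms of the differences are summable, so by Tonelli the differences are summable at
almost every point. -/
theorem OrliczSpace.tendsto_ae_of_norm_sub_le {α : Type*} [MeasurableSpace α] {μ : Measure α}
    [IsFiniteMeasure μ] {w : ℕ → OrliczSpace Φ μ} {w₀ : OrliczSpace Φ μ}
    (h : ∀ m, ‖w m - w₀‖ ≤ (1 / 2) ^ m) : ∀ᵐ x ∂μ, Tendsto (fun m => w m x) atTop (𝓝 (w₀ x)) := by
  have hsum : ∫⁻ x, ∑' m, ‖(w m - w₀) x‖ₑ ∂μ ≠ ⊤ := by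
    rw [lintegral_tsum fun m => (w m - w₀).measurable.enorm.aemeasurable]
    refine ne_top_of_le_ne_top (b := ∑' m : ℕ, ENNReal.ofReal (‖toL1 Φ μ‖ * (1 / 2) ^ m))
      (summable_geometric_two.mul_left _).tsum_ofReal_ne_top ?_
    refine ENNReal.tsum_le_tsum fun m => ?_
    rw [← ofReal_norm_toL1]
    exact ENNReal.ofReal_le_ofReal (((toL1 Φ μ).le_opNorm _).trans (by gcongr; exact h m))
  filter_upwards [ae_lt_top (Measurable.tsum fun m => (w m - w₀).measurable.enorm) hsum,
    ae_all_iff.2 fun m => coeFn_sub (w m) w₀] with x hx hd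
  have h1 := ENNReal.tendsto_atTop_zero_of_tsum_ne_top hx.ne
  rw [tendsto_iff_edist_tendsto_0]
  refine h1.congr fun m => ?_
  rw [hd m, edist_eq_enorm_sub, Pi.sub_apply]

/-- Sublevel sets of `u ↦ ∫ f(x, Du(x)) dx` are stable under weak convergence. -/
theorem lintegral_grad_le_of_weakLim [IsFiniteMeasure (volume.restrict Ω)]
    {f : EuclideanSpace ℝ (Fin n) → EuclideanSpace ℝ (Fin n) → ℝ}
    (hf_meas : ∀ p, AEMeasurable (fun x => f x p) (volume.restrict Ω))
    (hf_cont : ∀ᵐ x ∂volume.restrict Ω, Continuous (f x))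
    (hf_conv : ∀ᵐ x ∂volume.restrict Ω, ConvexOn ℝ univ (f x))
    (hf_nonneg : ∀ᵐ x ∂volume.restrict Ω, ∀ p, 0 ≤ f x p) {ι : Type*} {U : Filter ι} [U.NeBot]
    {u : ι → OrliczSobolev Φ Ω} {u₀ : OrliczSobolev Φ Ω} (h : WeakLim U u u₀) {c : ℝ≥0∞}
    (hc : ∀ᶠ i in U, ∫⁻ x in Ω, ENNReal.ofReal (f x ((u i).grad x)) ≤ c) :
    ∫⁻ x in Ω, ENNReal.ofReal (f x (u₀.grad x)) ≤ c := by
  have hm : ∀ v : OrliczSobolev Φ Ω, AEMeasurable (fun x => ENNReal.ofReal (f x (v.grad x)))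
      (volume.restrict Ω) := fun v =>
    (aemeasurable_comp_of_continuous hf_meas hf_cont v.measurable_grad).ennreal_ofReal
  -- The sublevel set is convex because f(x, ·) is, and norm closed by Fatou along a fast convergent
  -- subsequence of gradients; Mazur's theorem applies.
  refine h.mem_of_convex
    (S := {v : OrliczSobolev Φ Ω | ∫⁻ x in Ω, ENNReal.ofReal (f x (v.grad x)) ≤ c}) ?_ ?_ hc
  · intro v hv w hw a b ha hb hab
    calc ∫⁻ x in Ω, ENNReal.ofReal (f x ((a • v + b • w).grad x))
        ≤ ∫⁻ x in Ω, (ENNReal.ofReal a * ENNReal.ofReal (f x (v.grad x)) +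
            ENNReal.ofReal b * ENNReal.ofReal (f x (w.grad x))) := by
          apply lintegral_mono_ae
          filter_upwards [hf_conv, hf_nonneg, v.grad_add_ae w a b] with x h1 h2 h3
          rw [h3, ← ENNReal.ofReal_mul ha, ← ENNReal.ofReal_mul hb,
            ← ENNReal.ofReal_add (mul_nonneg ha (h2 _)) (mul_nonneg hb (h2 _))]
          exact ENNReal.ofReal_le_ofReal (h1.2 (mem_univ _) (mem_univ _) ha hb hab)
      _ = ENNReal.ofReal a * (∫⁻ x in Ω, ENNReal.ofReal (f x (v.grad x))) +
            ENNReal.ofReal b * ∫⁻ x in Ω, ENNReal.ofReal (f x (w.grad x)) := by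
          rw [lintegral_add_left' ((hm v).const_mul _),
            lintegral_const_mul' _ _ ENNReal.ofReal_ne_top,
            lintegral_const_mul' _ _ ENNReal.ofReal_ne_top]
      _ ≤ ENNReal.ofReal a * c + ENNReal.ofReal b * c := by
          gcongr
          · exact hv
          · exact hw
      _ = c := by
          rw [← add_mul, ← ENNReal.ofReal_add ha hb, hab, ENNReal.ofReal_one, one_mul]
  · refine IsSeqClosed.isClosed fun v v₀ hv hlim => ?_
    choose σ hσ using fun m : ℕ => ((Metric.tendsto_nhds.1 hlim ((1 / 2) ^ m)
      (by positivity))).exists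
    have hgrad : ∀ i, ∀ᵐ x ∂volume.restrict Ω,
        Tendsto (fun m => (v (σ m)).1.2 i x) atTop (𝓝 (v₀.1.2 i x)) := fun i => by
      apply OrliczSpace.tendsto_ae_of_norm_sub_le
      intro m
      have h1 := (hσ m).le
      rw [dist_eq_norm] at h1
      have h2 : ‖(v (σ m)).1 - v₀.1‖ ≤ (1 / 2) ^ m := h1
      exact (norm_le_pi_norm ((v (σ m)).1.2 - v₀.1.2) i).trans ((norm_snd_le _).trans h2)
    calc ∫⁻ x in Ω, ENNReal.ofReal (f x (v₀.grad x))
        = ∫⁻ x in Ω, liminf (fun m => ENNReal.ofReal (f x ((v (σ m)).grad x))) atTop := by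
          apply lintegral_congr_ae
          filter_upwards [ae_all_iff.2 hgrad, hf_cont] with x h1 h2
          have h3 : Tendsto (fun m => (v (σ m)).grad x) atTop (𝓝 (v₀.grad x)) :=
            ((PiLp.continuous_toLp 2 _).tendsto _).comp (tendsto_pi_nhds.2 h1)
          exact (ENNReal.tendsto_ofReal ((h2.tendsto _).comp h3)).liminf_eq.symm
      _ ≤ liminf (fun m => ∫⁻ x in Ω, ENNReal.ofReal (f x ((v (σ m)).grad x))) atTop :=
          lintegral_liminf_le' fun m => hm _
      _ ≤ c := liminf_le_of_frequently_le' (Eventually.frequently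
          (Eventually.of_forall fun m => hv (σ m)))

theorem energyF_eq_lintegral {f : EuclideanSpace ℝ (Fin n) → EuclideanSpace ℝ (Fin n) → ℝ}
    (hf_nonneg : ∀ᵐ x ∂volume.restrict Ω, ∀ p, 0 ≤ f x p) (u : OrliczSobolev Φ Ω) :
    energyF f u = ((∫⁻ x in Ω, ENNReal.ofReal (f x (u.grad x)) : ℝ≥0∞) : EReal) := by
  have h : ∫⁻ x in Ω, (-(f x (u.grad x) : EReal)).toENNReal = 0 := by
    rw [← lintegral_zero (μ := volume.restrict Ω)]
    apply lintegral_congr_ae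
    filter_upwards [hf_nonneg] with x hx
    rw [← EReal.coe_neg, EReal.real_coe_toENNReal]
    exact ENNReal.ofReal_of_nonpos (by linarith [hx (u.grad x)])
  rw [energyF, extIntegral, h]
  simp

end Functionals

/-! ### The direct method. -/

theorem tendsto_lim_of_ultrafilter {ι : Type*} (U : Ultrafilter ι) (f : ι → EReal) :
    ∃ a, Tendsto f U (𝓝 a) := by
  obtain ⟨a, -, ha⟩ := (isCompact_univ (X := EReal)).ultrafilter_le_nhds (U.map f) (by simp)
  exact ⟨a, ha⟩

/-- Each c above the limit bounds f eventually. Lower semicontinuity along U is thereby reduced to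
the stability of sublevel sets. -/
theorem le_lim_of_ultrafilter {ι : Type*} {U : Ultrafilter ι} {f : ι → EReal} {a b : EReal}
    (ha : Tendsto f U (𝓝 a)) (h : ∀ c, (∀ᶠ i in U, f i ≤ c) → b ≤ c) : b ≤ a :=
  le_of_forall_gt_imp_ge_of_dense fun c hc =>
    h c ((ha.eventually (gt_mem_nhds hc)).mono fun _ hi => hi.le)

theorem theorem3 {n : ℕ} (hn : 1 ≤ n)
    -- the domain
    (Ω : Set (EuclideanSpace ℝ (Fin n))) (hΩo : IsOpen Ω) (hΩb : Bornology.IsBounded Ω)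
    (hΩc : ConeProperty Ω)
    -- the N-function `Φ`, its Sobolev conjugate `Φ_*`, and `B ≺≺ Φ_*`
    (Φ : NFunction) (hΦ : DeltaTwo Φ) (hΨ : DeltaTwo Φ.compl) (hS : HasSobolevConjugate Φ n)
    (B : NFunction) (hB : EssentiallySlower B (sobolevConjugate Φ n))
    -- the integrand `f`
    (f : EuclideanSpace ℝ (Fin n) → EuclideanSpace ℝ (Fin n) → ℝ)
    (hf_meas : ∀ p, AEMeasurable (fun x => f x p) (volume.restrict Ω))
    (hf_cont : ∀ᵐ x ∂volume.restrict Ω, Continuous (f x))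
    (hf_conv : ∀ᵐ x ∂volume.restrict Ω, ConvexOn ℝ univ (f x))
    (c₁ c₂ : ℝ) (hc₁ : 0 < c₁) (hc₂ : 0 < c₂)
    (hf_growth : ∀ᵐ x ∂volume.restrict Ω, ∀ p,
      c₁ * Φ ‖p‖ ≤ f x p ∧ f x p ≤ c₂ * (1 + Φ ‖p‖))
    -- the integrand `g`
    (g : EuclideanSpace ℝ (Fin n) → ℝ → EReal)
    (hg_meas : ∀ v : EuclideanSpace ℝ (Fin n) → ℝ, Measurable v →
      AEMeasurable (fun x => g x (v x)) (volume.restrict Ω))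
    (hg_lsc : ∀ᵐ x ∂volume.restrict Ω, LowerSemicontinuous (g x))
    (c_g : ℝ) (hc_g : 0 < c_g) (b_g : EuclideanSpace ℝ (Fin n) → ℝ)
    (hb_g : Integrable b_g (volume.restrict Ω))
    (hg_below : ∀ᵐ x ∂volume.restrict Ω, ∀ s : ℝ, ((c_g * B |s| - b_g x : ℝ) : EReal) ≤ g x s)
    -- the nonempty weakly closed set of competitors
    (X : Set (OrliczSobolev Φ Ω)) (hX_ne : X.Nonempty)
    (hX : IsClosed (toWeakSpace ℝ (OrliczSobolev Φ Ω) '' X)) :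
    (∀ v : OrliczSobolev Φ Ω, energyG f g v ≠ ⊥) ∧
      ∃ u ∈ X, ∀ v ∈ X, energyG f g u ≤ energyG f g v := by
  have hfin : IsFiniteMeasure (volume.restrict Ω) := ⟨by simpa using hΩb.measure_lt_top⟩
  -- the terms of the energy
  have hf_nonneg : ∀ᵐ x ∂volume.restrict Ω, ∀ p, 0 ≤ f x p := by
    filter_upwards [hf_growth] with x hx p
    exact (mul_nonneg hc₁.le (Φ.eval_nonneg (norm_nonneg p))).trans (hx p).1
  have hfn : ∀ u : OrliczSobolev Φ Ω, Measurable u.fn := fun u => u.1.1.measurable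
  have hb_abs : Integrable (fun x => |b_g x|) (volume.restrict Ω) := hb_g.abs
  set β := ∫ x in Ω, |b_g x| with hβ
  have hβ0 : 0 ≤ β := integral_nonneg fun x => abs_nonneg _
  have hg_low : ∀ᵐ x ∂volume.restrict Ω, ∀ s, ((-|b_g x| : ℝ) : EReal) ≤ g x s := by
    filter_upwards [hg_below] with x hx s
    refine le_trans (EReal.coe_le_coe_iff.2 ?_) (hx s)
    have h1 := mul_nonneg hc_g.le (B.eval_nonneg (abs_nonneg s))
    have h2 := le_abs_self (b_g x)
    linarith
  have hg_low' : ∀ u : OrliczSobolev Φ Ω, ∀ᵐ x ∂volume.restrict Ω,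
      ((-|b_g x| : ℝ) : EReal) ≤ g x (u.fn x) := fun u => hg_low.mono fun x hx => hx _
  set I : OrliczSobolev Φ Ω → EReal := fun u =>
    extIntegral (volume.restrict Ω) fun x => g x (u.fn x) with hI
  have hI_low : ∀ u, ((-β : ℝ) : EReal) ≤ I u := fun u =>
    neg_integral_le_extIntegral (hg_meas _ (hfn u)) hb_abs (fun _ => abs_nonneg _) (hg_low' u)
  have hF_low : ∀ u : OrliczSobolev Φ Ω, 0 ≤ energyF f u := fun u => by
    rw [energyF_eq_lintegral hf_nonneg]
    exact EReal.coe_ennreal_nonneg _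
  have hG : ∀ u : OrliczSobolev Φ Ω, energyG f g u = energyF f u + I u := fun u => rfl
  refine ⟨fun v => ?_, ?_⟩
  · rw [hG, EReal.add_ne_bot_iff]
    exact ⟨(EReal.bot_lt_zero.trans_le (hF_low v)).ne',
      ((EReal.bot_lt_coe _).trans_le (hI_low v)).ne'⟩
  -- a minimizing sequence
  obtain ⟨a, -, halim, haS⟩ := exists_seq_tendsto_sInf (hX_ne.image (energyG f g))
    (OrderBot.bddBelow _)
  set m := sInf (energyG f g '' X) with hm
  have hm_le : ∀ v ∈ X, m ≤ energyG f g v := fun v hv => sInf_le ⟨v, hv, rfl⟩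
  -- If the infimum is +∞, every competitor is a minimizer.
  rcases eq_top_or_lt_top m with htop | hlt
  · obtain ⟨u, hu⟩ := hX_ne
    refine ⟨u, hu, fun v hv => ?_⟩
    have h1 := hm_le v hv
    rw [htop, top_le_iff] at h1
    rw [h1]
    exact le_top
  obtain ⟨L, hmL⟩ := EReal.lt_iff_exists_real_btwn.1 hlt
  -- Dropping the first N terms puts every energy below one real L, so that the bounds hold for all
  -- indices.
  obtain ⟨N, hN⟩ := eventually_atTop.1 (halim.eventually (gt_mem_nhds hmL.1))
  choose u' hu'X hu'a using haS
  set u : ℕ → OrliczSobolev Φ Ω := fun i => u' (i + N) with hu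
  have huX : ∀ i, u i ∈ X := fun i => hu'X _
  have huL : ∀ i, energyG f g (u i) ≤ L := fun i => by
    rw [hu, hu'a]
    exact (hN _ (by omega)).le
  have hulim : Tendsto (fun i => energyG f g (u i)) atTop (𝓝 m) := by
    have h1 := halim.comp (tendsto_add_atTop_nat N)
    refine h1.congr fun i => ?_
    rw [hu, hu'a]
    rfl
  -- it is bounded
  have hF_le : ∀ i, energyF f (u i) ≤ ((L + β : ℝ) : EReal) := fun i => by
    have h1 : energyF f (u i) + ((-β : ℝ) : EReal) ≤ L :=
      (add_le_add le_rfl (hI_low _)).trans ((hG (u i)).symm.le.trans (huL i))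
    rw [EReal.coe_add]
    rw [EReal.coe_neg, ← sub_eq_add_neg] at h1
    exact (EReal.sub_le_iff_le_add (Or.inl (EReal.coe_ne_bot _))
      (Or.inl (EReal.coe_ne_top _))).1 h1
  have hI_le : ∀ i, I (u i) ≤ L := fun i => by
    refine le_trans ?_ (huL i)
    rw [hG]
    exact le_add_of_nonneg_left (hF_low _)
  have hmodF : ∀ i, orliczModular Φ (volume.restrict Ω) (fun x => ‖(u i).grad x‖) ≤
      ENNReal.ofReal (c₁⁻¹ * (L + β)) := fun i => by
    have h1 := hF_le i
    rw [energyF_eq_lintegral hf_nonneg] at h1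
    have h2 : ∫⁻ x in Ω, ENNReal.ofReal (f x ((u i).grad x)) ≤ ENNReal.ofReal (L + β) := by
      rw [← EReal.coe_ennreal_le_coe_ennreal_iff, EReal.coe_ennreal_ofReal]
      exact h1.trans (EReal.coe_le_coe_iff.2 (le_max_left _ _))
    rw [ENNReal.ofReal_mul (by positivity)]
    calc _ ≤ ∫⁻ x in Ω, ENNReal.ofReal c₁⁻¹ * ENNReal.ofReal (f x ((u i).grad x)) := by
          apply lintegral_mono_ae
          filter_upwards [hf_growth] with x hx
          rw [← ENNReal.ofReal_mul (by positivity), abs_norm]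
          apply ENNReal.ofReal_le_ofReal
          rw [le_inv_mul_iff₀ hc₁]
          exact (hx _).1
      _ = ENNReal.ofReal c₁⁻¹ * ∫⁻ x in Ω, ENNReal.ofReal (f x ((u i).grad x)) :=
          lintegral_const_mul' _ _ ENNReal.ofReal_ne_top
      _ ≤ _ := by gcongr
  have hmodB : ∀ i, orliczModular B (volume.restrict Ω) (u i).fn ≤
      ENNReal.ofReal (c_g⁻¹ * (L + β)) := fun i => by
    have h1 := extIntegral_add_integral (hg_meas _ (hfn (u i))) hb_abs (fun _ => abs_nonneg _)
      (hg_low' (u i))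
    have h2 : ∫⁻ x in Ω, (g x ((u i).fn x) + ((|b_g x| : ℝ) : EReal)).toENNReal ≤
        ENNReal.ofReal (L + β) := by
      rw [← EReal.coe_ennreal_le_coe_ennreal_iff, EReal.coe_ennreal_ofReal, ← h1]
      refine le_trans ?_ (EReal.coe_le_coe_iff.2 (le_max_left _ _))
      rw [EReal.coe_add]
      exact add_le_add (hI_le i) le_rfl
    rw [ENNReal.ofReal_mul (by positivity)]
    calc _ ≤ ∫⁻ x in Ω, ENNReal.ofReal c_g⁻¹ *
          (g x ((u i).fn x) + ((|b_g x| : ℝ) : EReal)).toENNReal := by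
          apply lintegral_mono_ae
          filter_upwards [hg_below] with x hx
          calc ENNReal.ofReal (B |(u i).fn x|)
              = ENNReal.ofReal c_g⁻¹ * ENNReal.ofReal (c_g * B |(u i).fn x|) := by
                rw [← ENNReal.ofReal_mul (by positivity), inv_mul_cancel_left₀ hc_g.ne']
            _ ≤ _ := by
                gcongr
                rw [← EReal.real_coe_toENNReal]
                apply EReal.toENNReal_le_toENNReal
                refine le_trans ?_ (add_le_add (hx _) le_rfl)
                rw [← EReal.coe_add, EReal.coe_le_coe_iff]
                linarith [le_abs_self (b_g x)]
      _ = ENNReal.ofReal c_g⁻¹ *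
          ∫⁻ x in Ω, (g x ((u i).fn x) + ((|b_g x| : ℝ) : EReal)).toENNReal :=
          lintegral_const_mul' _ _ ENNReal.ofReal_ne_top
      _ ≤ _ := by gcongr
  obtain ⟨M, hM⟩ := exists_norm_le_of_modular_le hΩo hΩc Φ B
    (K := max (max (c₁⁻¹ * (L + β)) (c_g⁻¹ * (L + β))) 0) (le_max_right _ _)
  have huM : ∀ i, ‖u i‖ ≤ M := fun i => hM (u i)
    ((hmodF i).trans (ENNReal.ofReal_le_ofReal ((le_max_left _ _).trans (le_max_left _ _))))
    ((hmodB i).trans (ENNReal.ofReal_le_ofReal ((le_max_right _ _).trans (le_max_left _ _))))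
  -- its weak limit along an ultrafilter is a minimizer
  set U : Ultrafilter ℕ := hyperfilter ℕ with hU
  obtain ⟨u₀, hu₀⟩ := OrliczSobolev.exists_weakLim hΦ hΨ U u huM
  have hu₀X : u₀ ∈ X := by
    have h1 := hX.mem_of_tendsto hu₀.tendsto_toWeakSpace
      (Eventually.of_forall fun i => mem_image_of_mem _ (huX i))
    exact (toWeakSpace ℝ (OrliczSobolev Φ Ω)).injective.mem_set_image.1 h1
  refine ⟨u₀, hu₀X, fun v hv => le_trans ?_ (hm_le v hv)⟩
  -- By compactness of the extended line each energy term has its own limit along U, so the two can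
  -- be compared with their values at u₀ separately.
  obtain ⟨F₀, hF₀⟩ := tendsto_lim_of_ultrafilter U fun i => energyF f (u i)
  obtain ⟨I₀, hI₀⟩ := tendsto_lim_of_ultrafilter U fun i => I (u i)
  have hF₀_low : 0 ≤ F₀ := ge_of_tendsto' hF₀ fun i => hF_low _
  have hI₀_low : ((-β : ℝ) : EReal) ≤ I₀ := ge_of_tendsto' hI₀ fun i => hI_low _
  have hFu : energyF f u₀ ≤ F₀ := by
    refine le_lim_of_ultrafilter hF₀ fun c hc => ?_
    have hc0 : 0 ≤ c := by
      obtain ⟨i, hi⟩ := hc.exists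
      exact (hF_low _).trans hi
    simp only [energyF_eq_lintegral hf_nonneg] at hc ⊢
    rw [← EReal.coe_toENNReal hc0, EReal.coe_ennreal_le_coe_ennreal_iff]
    refine lintegral_grad_le_of_weakLim hf_meas hf_cont hf_conv hf_nonneg hu₀ (hc.mono fun i hi => ?_)
    rwa [← EReal.coe_ennreal_le_coe_ennreal_iff, EReal.coe_toENNReal hc0]
  have hIu : I u₀ ≤ I₀ := by
    refine le_lim_of_ultrafilter hI₀ fun c hc => ?_
    -- The almost everywhere convergent sequence is extracted inside the sublevel set {I(u_i) ≤ c},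
    -- so the bound c survives in Fatou's lemma.
    obtain ⟨σ, hσ, hσlim⟩ := exists_seq_tendsto_ae_of_weakLim hΩo hΩb hu₀ huM hc
    refine extIntegral_le_of_le_liminf (fun k => hg_meas _ (hfn (u (σ k)))) (hg_meas _ (hfn u₀))
      hb_abs (fun _ => abs_nonneg _) (fun k => hg_low' _) (hg_low' u₀) ?_ hσ
    filter_upwards [hσlim, hg_lsc] with x h1 h2
    refine (lowerSemicontinuousAt_iff_le_liminf.1 (h2 (u₀.fn x))).trans ?_
    exact liminf_le_liminf_of_le h1
  -- Neither limit is -∞, so addition is continuous at (F₀, I₀); the hyperfilter refines `atTop`, so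
  -- the sum tends to the infimum.
  have hsum : F₀ + I₀ = m := by
    have h1 : Tendsto (fun i => energyF f (u i) + I (u i)) U (𝓝 (F₀ + I₀)) :=
      (EReal.continuousAt_add (p := (F₀, I₀))
        (Or.inr ((EReal.bot_lt_coe _).trans_le hI₀_low).ne')
        (Or.inl (EReal.bot_lt_zero.trans_le hF₀_low).ne')).tendsto.comp (hF₀.prodMk_nhds hI₀)
    exact tendsto_nhds_unique h1 (hulim.mono_left Nat.hyperfilter_le_atTop)
  rw [hG, ← hsum]
  exact add_le_add hFu hIu
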